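/- Let $V$ be a complex vector space of dimension $n$, let $F_1\subset\dots\subset F_n=V$ be a complete flag with $\dim F_j=j$, and let $0=k_0<k_1<\dots<k_h\le n$. Let $a^\alpha$ be a Schubert index for the partial flag variety $F(k_1,\dots,k_h;n)$, that is, a sequence $1\le a_1<\dots<a_{k_h}\le n$ together with a sequence $\alpha_1,\dots,\alpha_{k_h}\in\{1,\dots,h\}$ such that $\#\{i\mid\alpha_i=t\}=k_t-k_{t-1}$ for $1\le t\le h$. Put $\mu_{i,t}=\#\{i'\le i\mid\alpha_{i'}\le t\}$ for $1\le i\le k_h$, $1\le t\le h$. The Schubert variety is $$\Sigma_{a^\alpha}=\{(\Lambda_1\subset\dots\subset\Lambda_h)\in F(k_1,\dots,k_h;n)\mid \dim(F_{a_i}\cap\Lambda_t)\ge\mu_{i,t}\text{ for all } i,t\},$$ and the Schubert cell $\Sigma_{a^\alpha}^\circ\subset\Sigma_{a^\alpha}$ consists of the flags with $\dim(F_j\cap\Lambda_t)=\#\{i\mid a_i\le j,\ \alpha_i\le t\}$ for all $1\le j\le n$, $1\le t\le h$. Let $$\Gamma\subset\prod_{t=1}^{h}\prod_{i=1}^{k_h}G(\mu_{i,t},V)$$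 be the variety of all families $(W^{t,i})$ of subspaces with $\dim W^{t,i}=\mu_{i,t}$ such that $W^{t,i}\subset W^{t,i'}$ for $i\le i'$, $W^{t,i}\subset W^{t',i}$ for $t\le t'$, and $W^{h,i}\subset F_{a_i}$ for all $i$ (so $W^{t,i}=W^{t,i'}$ whenever $\mu_{i,t}=\mu_{i',t}$). Let $\pi:\Gamma\to\Sigma_{a^\alpha}$ be the projection $(W^{t,i})\mapsto(\Lambda_1,\dots,\Lambda_h)$, $\Lambda_t=W^{t,k_h}$. Here $\Sigma_{a^\alpha}$ and $\Gamma$ carry the reduced structure as Zariski closed subsets of products of Grassmannians. Then: 1. $\Gamma$ is an iterated tower of Grassmannians: it is obtained from a point by successively taking Zariski locally trivial fibre bundles whose fibres are Grassmannians $G(p,q)$, $0\le p\le q$. 2. $\pi:\Gamma\to\Sigma_{a^\alpha}$ is a resolution of singularities: $\Gamma$ and $\Sigma_{a^\alpha}$ are varieties, $\Gamma$ is nonsingular and irreducible, and $\pi$ is a proper birational morphism. 3. The Schubert cell $\Sigma_{a^\alpha}^\circ$ is open and dense in $\Sigma_{a^\alpha}$, and $\pi$ restricts to an isomorphism $\pi^{-1}(\Sigma_{a^\alpha}^\circ)\to\Sigma_{a^\alpha}^\circ$.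 More generally, $\pi$ is an isomorphism over the locus of all flags in $\Sigma_{a^\alpha}$ with $\dim(F_{a_i}\cap\Lambda_t)=\mu_{i,t}$ for all $i,t$, which contains the Schubert cell. -/

import Mathlib

/-!
Complex algebraic varieties in the classical language: a variety is a topological space together
with a sheaf of complex valued functions which is locally a Zariski closed subset of `ℂ ^ m` with
its regular functions.  A sheaf of functions is recorded by its germs.
-/

open Filter Topology

universe u v w

/-- A space with functions: a topological space together with a sheaf of `ℂ`-algebras of complex
valued functions, such that the non-vanishing locus of a regular function is open and the inverse
is regular there.  The sheaf is given by the germs of its sections: a function `f` is regular on an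
open set `U` iff its germ at every `x ∈ U` lies in `stalk x`. -/
structure SpaceWithFunctions where
  carrier : Type u
  top : TopologicalSpace carrier
  stalk : ∀ x : carrier, Subring ((𝓝 x).Germ ℂ)
  const_mem : ∀ (x : carrier) (c : ℂ), ((fun _ => c : carrier → ℂ) : (𝓝 x).Germ ℂ) ∈ stalk x
  eventually_mem : ∀ (x : carrier) (f : carrier → ℂ), (f : (𝓝 x).Germ ℂ) ∈ stalk x →
    ∀ᶠ y in 𝓝 x, (f : (𝓝 y).Germ ℂ) ∈ stalk y
  inv_mem : ∀ (x : carrier) (f : carrier → ℂ), (f : (𝓝 x).Germ ℂ) ∈ stalk x → f x ≠ 0 →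
    (∀ᶠ y in 𝓝 x, f y ≠ 0) ∧ ((f⁻¹ : carrier → ℂ) : (𝓝 x).Germ ℂ) ∈ stalk x

namespace SpaceWithFunctions

instance : CoeSort SpaceWithFunctions.{u} (Type u) := ⟨carrier⟩

instance (X : SpaceWithFunctions.{u}) : TopologicalSpace X := X.top

/-- `f` is regular on a neighbourhood of `x`. -/
def RegularAt (X : SpaceWithFunctions.{u}) (f : X → ℂ) (x : X) : Prop :=
  (f : (𝓝 x).Germ ℂ) ∈ X.stalk x

theorem RegularAt.congr {X : SpaceWithFunctions.{u}} {f g : X → ℂ} {x : X}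
    (hf : X.RegularAt f x) (h : f =ᶠ[𝓝 x] g) : X.RegularAt g x := by
  have : (f : (𝓝 x).Germ ℂ) = g := Germ.coe_eq.2 h
  unfold RegularAt at *
  rwa [← this]

theorem RegularAt.add {X : SpaceWithFunctions.{u}} {f g : X → ℂ} {x : X}
    (hf : X.RegularAt f x) (hg : X.RegularAt g x) : X.RegularAt (f + g) x := by
  unfold RegularAt at *
  rw [Germ.coe_add]
  exact add_mem hf hg

theorem RegularAt.mul {X : SpaceWithFunctions.{u}} {f g : X → ℂ} {x : X}
    (hf : X.RegularAt f x) (hg : X.RegularAt g x) : X.RegularAt (f * g) x := by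
  unfold RegularAt at *
  rw [Germ.coe_mul]
  exact mul_mem hf hg

theorem RegularAt.neg {X : SpaceWithFunctions.{u}} {f : X → ℂ} {x : X}
    (hf : X.RegularAt f x) : X.RegularAt (-f) x := by
  unfold RegularAt at *
  rw [Germ.coe_neg]
  exact neg_mem hf

theorem regularAt_const (X : SpaceWithFunctions.{u}) (c : ℂ) (x : X) :
    X.RegularAt (fun _ => c) x := X.const_mem x c

/-- A regular germ has a neighbourhood, cut out by a regular function, on which it is regular. -/
theorem RegularAt.exists_cut {X : SpaceWithFunctions.{u}} {f : X → ℂ} {x : X}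
    (hf : X.RegularAt f x) : ∃ e : X → ℂ, X.RegularAt e x ∧ e x ≠ 0 ∧
      ∀ y, e y ≠ 0 → X.RegularAt f y ∧ X.RegularAt e y := by
  classical
  obtain ⟨U, hU, hUo, hxU⟩ := eventually_nhds_iff.1 (X.eventually_mem x f hf)
  have key : ∀ y ∈ U, X.RegularAt (U.indicator fun _ => (1 : ℂ)) y := fun y hy =>
    (X.regularAt_const 1 y).congr <| by
      filter_upwards [hUo.mem_nhds hy] with z hz
      simp [hz]
  refine ⟨U.indicator fun _ => 1, key x hxU, by simp [hxU], fun y hy => ?_⟩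
  have hyU : y ∈ U := by
    by_contra h
    simp [h] at hy
  exact ⟨hU y hyU, key y hyU⟩

/-- A morphism: a continuous map which pulls back regular functions to regular functions. -/
def IsMorphism {X : SpaceWithFunctions.{u}} {Y : SpaceWithFunctions.{v}} (φ : X → Y) : Prop :=
  Continuous φ ∧ ∀ (x : X) (f : Y → ℂ), Y.RegularAt f (φ x) → X.RegularAt (f ∘ φ) x

/-- An isomorphism: a morphism with a two-sided inverse morphism. -/
def IsIsomorphism {X : SpaceWithFunctions.{u}} {Y : SpaceWithFunctions.{v}} (φ : X → Y) : Prop :=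
  IsMorphism φ ∧ ∃ ψ : Y → X, IsMorphism ψ ∧ Function.LeftInverse ψ φ ∧ Function.RightInverse ψ φ

/-! ### Subspaces, quotients, products -/

/-- A subset with the induced topology; the regular functions are those that are locally
restrictions of regular functions of the ambient space. -/
def restrict (X : SpaceWithFunctions.{u}) (S : Set X) : SpaceWithFunctions.{u} where
  carrier := S
  top := inferInstanceAs (TopologicalSpace S)
  stalk x :=
    { carrier := {γ | ∃ f : X → ℂ, X.RegularAt f x ∧ γ = ((fun y : S => f y : S → ℂ) :)}
      mul_mem' := by
        rintro _ _ ⟨f, hf, rfl⟩ ⟨g, hg, rfl⟩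
        exact ⟨f * g, hf.mul hg, rfl⟩
      one_mem' := ⟨fun _ => 1, X.regularAt_const 1 _, rfl⟩
      add_mem' := by
        rintro _ _ ⟨f, hf, rfl⟩ ⟨g, hg, rfl⟩
        exact ⟨f + g, hf.add hg, rfl⟩
      zero_mem' := ⟨fun _ => 0, X.regularAt_const 0 _, rfl⟩
      neg_mem' := by
        rintro _ ⟨f, hf, rfl⟩
        exact ⟨-f, hf.neg, rfl⟩ }
  const_mem x c := ⟨fun _ => c, X.regularAt_const c _, rfl⟩
  eventually_mem := by
    rintro x g ⟨f, hf, hgf⟩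
    have h1 : ∀ᶠ y : S in 𝓝 x, X.RegularAt f y :=
      continuous_subtype_val.continuousAt.eventually (X.eventually_mem x f hf)
    filter_upwards [h1, eventually_eventually_nhds.2 (Germ.coe_eq.1 hgf)] with y hy hy'
    exact ⟨f, hy, Germ.coe_eq.2 hy'⟩
  inv_mem := by
    rintro x g ⟨f, hf, hgf⟩ hgx
    have hgf' := Germ.coe_eq.1 hgf
    have hfx : f x ≠ 0 := by rwa [← hgf'.eq_of_nhds]
    obtain ⟨h1, h2⟩ := X.inv_mem x f hf hfx
    have h1' : ∀ᶠ y : S in 𝓝 x, f y ≠ 0 := continuous_subtype_val.continuousAt.eventually h1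
    refine ⟨?_, f⁻¹, h2, Germ.coe_eq.2 ?_⟩
    · filter_upwards [h1', hgf'] with y hy hy'
      rwa [hy']
    · filter_upwards [hgf'] with y hy
      simp [hy]

/-- The quotient structure along a map `σ : X → T` (used for surjective `σ`): a subset is open iff
its preimage is open, and a function is regular iff its pullback is regular. -/
def quotient (X : SpaceWithFunctions.{u}) {T : Type v} (σ : X → T) : SpaceWithFunctions.{v} :=
  letI : TopologicalSpace T := TopologicalSpace.coinduced σ X.top
  { carrier := T
    top := TopologicalSpace.coinduced σ X.top
    stalk := fun x =>
      { carrier := {γ | ∃ f : T → ℂ, γ = f ∧ ∀ᶠ y in 𝓝 x, ∀ a, σ a = y → X.RegularAt (f ∘ σ) a}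
        mul_mem' := by
          rintro _ _ ⟨f, rfl, hf⟩ ⟨g, rfl, hg⟩
          refine ⟨f * g, rfl, ?_⟩
          filter_upwards [hf, hg] with y h1 h2 a ha
          exact (h1 a ha).mul (h2 a ha)
        one_mem' := ⟨fun _ => 1, rfl, .of_forall fun _ a _ => X.regularAt_const 1 a⟩
        add_mem' := by
          rintro _ _ ⟨f, rfl, hf⟩ ⟨g, rfl, hg⟩
          refine ⟨f + g, rfl, ?_⟩
          filter_upwards [hf, hg] with y h1 h2 a ha
          exact (h1 a ha).add (h2 a ha)
        zero_mem' := ⟨fun _ => 0, rfl, .of_forall fun _ a _ => X.regularAt_const 0 a⟩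
        neg_mem' := by
          rintro _ ⟨f, rfl, hf⟩
          refine ⟨-f, rfl, ?_⟩
          filter_upwards [hf] with y h1 a ha
          exact (h1 a ha).neg }
    const_mem := fun x c => ⟨fun _ => c, rfl, .of_forall fun _ a _ => X.regularAt_const c a⟩
    eventually_mem := by
      rintro x g ⟨f, hgf, hf⟩
      filter_upwards [eventually_eventually_nhds.2 hf,
        eventually_eventually_nhds.2 (Germ.coe_eq.1 hgf)] with y hy hy'
      exact ⟨f, Germ.coe_eq.2 hy', hy⟩
    inv_mem := by
      rintro x g ⟨f, hgf, hf⟩ hgx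
      have hgf' := Germ.coe_eq.1 hgf
      have hfx : f x ≠ 0 := by rwa [← hgf'.eq_of_nhds]
      obtain ⟨U, hU, hUo, hxU⟩ := eventually_nhds_iff.1 hf
      have hσ : Continuous σ := continuous_coinduced_rng
      have hopen : IsOpen {y | y ∈ U ∧ f y ≠ 0} := by
        rw [isOpen_coinduced, isOpen_iff_eventually]
        rintro a ⟨haU, ha⟩
        filter_upwards [(hUo.preimage hσ).mem_nhds haU,
          (X.inv_mem a (f ∘ σ) (hU _ haU a rfl) ha).1] with b h1 h2
        exact ⟨h1, h2⟩
      have hev : ∀ᶠ y in 𝓝 x, y ∈ U ∧ f y ≠ 0 := hopen.mem_nhds ⟨hxU, hfx⟩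
      refine ⟨?_, f⁻¹, Germ.coe_eq.2 ?_, ?_⟩
      · filter_upwards [hev, hgf'] with y hy hy'
        rw [hy']
        exact hy.2
      · filter_upwards [hgf'] with y hy
        simp [hy]
      · filter_upwards [hev] with y hy a ha
        subst ha
        exact (X.inv_mem a (f ∘ σ) (hU _ hy.1 a rfl) hy.2).2 }

section generate

variable {T : Type u} (L : T → Set (T → ℂ))

/-- Each function in the algebra generated by `L x` stays in these algebras near `x`. -/
def Spreads : Prop :=
  ∀ x, ∀ f ∈ L x, ∃ e ∈ Algebra.adjoin ℂ (L x), e x ≠ 0 ∧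
    ∀ y, e y ≠ 0 → f ∈ Algebra.adjoin ℂ (L y) ∧ e ∈ Algebra.adjoin ℂ (L y)

variable {L}

theorem Spreads.adjoin (hL : Spreads L) (x : T) (f : T → ℂ) (hf : f ∈ Algebra.adjoin ℂ (L x)) :
    ∃ e ∈ Algebra.adjoin ℂ (L x), e x ≠ 0 ∧
      ∀ y, e y ≠ 0 → f ∈ Algebra.adjoin ℂ (L y) ∧ e ∈ Algebra.adjoin ℂ (L y) := by
  induction hf using Algebra.adjoin_induction with
  | mem f hf => exact hL x f hf
  | algebraMap r =>
    exact ⟨1, one_mem _, by simp, fun y _ => ⟨Subalgebra.algebraMap_mem _ _, one_mem _⟩⟩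
  | add f g _ _ hf hg =>
    obtain ⟨e, he, hex, h⟩ := hf
    obtain ⟨e', he', hex', h'⟩ := hg
    refine ⟨e * e', mul_mem he he', mul_ne_zero hex hex', fun y hy => ?_⟩
    have h1 := h y (left_ne_zero_of_mul hy)
    have h2 := h' y (right_ne_zero_of_mul hy)
    exact ⟨add_mem h1.1 h2.1, mul_mem h1.2 h2.2⟩
  | mul f g _ _ hf hg =>
    obtain ⟨e, he, hex, h⟩ := hf
    obtain ⟨e', he', hex', h'⟩ := hg
    refine ⟨e * e', mul_mem he he', mul_ne_zero hex hex', fun y hy => ?_⟩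
    have h1 := h y (left_ne_zero_of_mul hy)
    have h2 := h' y (right_ne_zero_of_mul hy)
    exact ⟨mul_mem h1.1 h2.1, mul_mem h1.2 h2.2⟩

variable (L)

/-- The topology in which the non-vanishing loci of the functions generated by `L x` form a basis
of neighbourhoods of `x`. -/
@[reducible]
def generateTop : TopologicalSpace T where
  IsOpen U := ∀ x ∈ U, ∃ f ∈ Algebra.adjoin ℂ (L x), f x ≠ 0 ∧ ∀ y, f y ≠ 0 → y ∈ U
  isOpen_univ := fun _ _ => ⟨1, one_mem _, by simp, fun _ _ => trivial⟩
  isOpen_inter := by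
    rintro U V hU hV x ⟨hxU, hxV⟩
    obtain ⟨f, hf, hfx, h⟩ := hU x hxU
    obtain ⟨g, hg, hgx, h'⟩ := hV x hxV
    exact ⟨f * g, mul_mem hf hg, mul_ne_zero hfx hgx, fun y hy =>
      ⟨h y (left_ne_zero_of_mul hy), h' y (right_ne_zero_of_mul hy)⟩⟩
  isOpen_sUnion := by
    rintro s hs x ⟨U, hU, hxU⟩
    obtain ⟨f, hf, hfx, h⟩ := hs U hU x hxU
    exact ⟨f, hf, hfx, fun y hy => ⟨U, hU, h y hy⟩⟩

variable {L}

theorem Spreads.eventually_ne (hL : Spreads L) (x : T) (f : T → ℂ)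
    (hf : f ∈ Algebra.adjoin ℂ (L x)) (hfx : f x ≠ 0) :
    ∀ᶠ y in @nhds T (generateTop L) x, f ∈ Algebra.adjoin ℂ (L y) ∧ f y ≠ 0 := by
  let _ := generateTop L
  obtain ⟨e, he, hex, h⟩ := hL.adjoin x f hf
  have hopen : IsOpen {y | (e * f) y ≠ 0} := by
    intro y hy
    have := h y (left_ne_zero_of_mul hy)
    exact ⟨e * f, mul_mem this.2 this.1, hy, fun z hz => hz⟩
  filter_upwards [hopen.mem_nhds (mul_ne_zero hex hfx)] with y hy
  exact ⟨(h y (left_ne_zero_of_mul hy)).1, right_ne_zero_of_mul hy⟩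

theorem Spreads.eventually_mem (hL : Spreads L) (x : T) (f : T → ℂ)
    (hf : f ∈ Algebra.adjoin ℂ (L x)) :
    ∀ᶠ y in @nhds T (generateTop L) x, f ∈ Algebra.adjoin ℂ (L y) := by
  let _ := generateTop L
  obtain ⟨e, he, hex, h⟩ := hL.adjoin x f hf
  filter_upwards [hL.eventually_ne x e he hex] with y hy
  exact (h y hy.2).1

/-- The space with functions on a set `T` generated by prescribed local regular functions `L x`
near each point `x`: its topology has the loci `f ≠ 0`, with `f` a polynomial expression in `L x`,
as basic neighbourhoods of `x`, and its regular germs at `x` are the quotients `f / g`, with `f` and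
`g` polynomial expressions in `L x` and `g x ≠ 0`. -/
def generate (L : T → Set (T → ℂ)) (hL : Spreads L) : SpaceWithFunctions.{u} :=
  letI : TopologicalSpace T := generateTop L
  { carrier := T
    top := generateTop L
    stalk := fun x =>
      { carrier := {γ | ∃ f ∈ Algebra.adjoin ℂ (L x), ∃ g ∈ Algebra.adjoin ℂ (L x),
          g x ≠ 0 ∧ γ = (f / g : T → ℂ)}
        mul_mem' := by
          rintro _ _ ⟨f, hf, g, hg, hgx, rfl⟩ ⟨f', hf', g', hg', hgx', rfl⟩
          refine ⟨f * f', mul_mem hf hf', g * g', mul_mem hg hg', mul_ne_zero hgx hgx', ?_⟩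
          rw [← Germ.coe_mul, div_mul_div_comm]
        one_mem' := ⟨1, one_mem _, 1, one_mem _, by simp, by simp⟩
        add_mem' := by
          rintro _ _ ⟨f, hf, g, hg, hgx, rfl⟩ ⟨f', hf', g', hg', hgx', rfl⟩
          refine ⟨f * g' + g * f', add_mem (mul_mem hf hg') (mul_mem hg hf'), g * g',
            mul_mem hg hg', mul_ne_zero hgx hgx', ?_⟩
          rw [← Germ.coe_add]
          refine Germ.coe_eq.2 ?_
          filter_upwards [hL.eventually_ne x g hg hgx, hL.eventually_ne x g' hg' hgx'] with y h h'
          exact div_add_div _ _ h.2 h'.2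
        zero_mem' := ⟨0, zero_mem _, 1, one_mem _, by simp, by simp⟩
        neg_mem' := by
          rintro _ ⟨f, hf, g, hg, hgx, rfl⟩
          refine ⟨-f, neg_mem hf, g, hg, hgx, ?_⟩
          rw [← Germ.coe_neg, neg_div] }
    const_mem := fun x c => ⟨fun _ => c, Subalgebra.algebraMap_mem _ c, 1, one_mem _, by simp, by
      rw [div_one]⟩
    eventually_mem := by
      rintro x q ⟨f, hf, g, hg, hgx, hq⟩
      filter_upwards [hL.eventually_mem x f hf, hL.eventually_ne x g hg hgx,
        eventually_eventually_nhds.2 (Germ.coe_eq.1 hq)] with y h1 h2 h3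
      exact ⟨f, h1, g, h2.1, h2.2, Germ.coe_eq.2 h3⟩
    inv_mem := by
      rintro x q ⟨f, hf, g, hg, hgx, hq⟩ hqx
      have hq' := Germ.coe_eq.1 hq
      have hfx : f x ≠ 0 := by
        intro h
        apply hqx
        rw [hq'.eq_of_nhds]
        simp [h]
      refine ⟨?_, g, hg, f, hf, hfx, Germ.coe_eq.2 ?_⟩
      · filter_upwards [hq', hL.eventually_ne x f hf hfx, hL.eventually_ne x g hg hgx]
          with y h1 h2 h3
        rw [h1]
        exact div_ne_zero h2.2 h3.2
      · filter_upwards [hq'] with y h1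
        simp [h1] }

end generate

/-- A complex vector space `E` as an affine space: Zariski topology, and germs of quotients of
polynomial functions (polynomial expressions in linear functionals). -/
def affine (E : Type u) [AddCommGroup E] [Module ℂ E] : SpaceWithFunctions.{u} :=
  generate (T := E) (fun _ => {f | ∃ l : E →ₗ[ℂ] ℂ, f = fun v => l v}) fun _ _ hf =>
    ⟨1, one_mem _, by simp, fun _ _ => ⟨Algebra.subset_adjoin hf, one_mem _⟩⟩

/-- The product of two spaces with functions: it is generated by the pullbacks of the local regular
functions of the factors.  Its topology is finer than the product topology: the sets
`∑ f_i(x) g_i(y) ≠ 0`, with `f_i` and `g_i` regular on open sets, form a basis. -/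
def prod (X : SpaceWithFunctions.{u}) (Y : SpaceWithFunctions.{v}) :
    SpaceWithFunctions.{max u v} :=
  generate (T := X × Y)
    (fun p => {f | (∃ g : X → ℂ, X.RegularAt g p.1 ∧ f = fun q => g q.1) ∨
      ∃ g : Y → ℂ, Y.RegularAt g p.2 ∧ f = fun q => g q.2}) <| by
    rintro p _ (⟨g, hg, rfl⟩ | ⟨g, hg, rfl⟩)
    · obtain ⟨e, he, hep, h⟩ := hg.exists_cut
      exact ⟨fun q => e q.1, Algebra.subset_adjoin (.inl ⟨e, he, rfl⟩), hep, fun q hq =>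
        ⟨Algebra.subset_adjoin (.inl ⟨g, (h _ hq).1, rfl⟩),
          Algebra.subset_adjoin (.inl ⟨e, (h _ hq).2, rfl⟩)⟩⟩
    · obtain ⟨e, he, hep, h⟩ := hg.exists_cut
      exact ⟨fun q => e q.2, Algebra.subset_adjoin (.inr ⟨e, he, rfl⟩), hep, fun q hq =>
        ⟨Algebra.subset_adjoin (.inr ⟨g, (h _ hq).1, rfl⟩),
          Algebra.subset_adjoin (.inr ⟨e, (h _ hq).2, rfl⟩)⟩⟩

/-- The product of a family of spaces with functions (used for finite families). -/
def pi {ι : Type w} (X : ι → SpaceWithFunctions.{u}) : SpaceWithFunctions.{max u w} :=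
  generate (T := ∀ i, X i)
    (fun p => {f | ∃ (i : ι) (g : X i → ℂ), (X i).RegularAt g (p i) ∧ f = fun q => g (q i)}) <| by
    rintro p _ ⟨i, g, hg, rfl⟩
    obtain ⟨e, he, hep, h⟩ := hg.exists_cut
    exact ⟨fun q => e (q i), Algebra.subset_adjoin ⟨i, e, he, rfl⟩, hep, fun q hq =>
      ⟨Algebra.subset_adjoin ⟨i, g, (h _ hq).1, rfl⟩,
        Algebra.subset_adjoin ⟨i, e, (h _ hq).2, rfl⟩⟩⟩

/-! ### Varieties and properties of morphisms -/

/-- Isomorphic to a Zariski closed subset of some `ℂ ^ m`. -/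
def IsAffine (X : SpaceWithFunctions.{u}) : Prop :=
  ∃ (m : ℕ) (S : Set (affine (Fin m → ℂ))), IsClosed S ∧
    ∃ φ : X → (affine (Fin m → ℂ)).restrict S, IsIsomorphism φ

/-- A complex algebraic variety (not necessarily irreducible): a finite union of affine open
subsets, with closed diagonal. -/
def IsVariety (X : SpaceWithFunctions.{u}) : Prop :=
  (∃ (r : ℕ) (U : Fin r → Set X),
    (∀ j, IsOpen (U j) ∧ (X.restrict (U j)).IsAffine) ∧ ⋃ j, U j = Set.univ) ∧
  IsClosed (X := X.prod X) (Set.range fun x : X => (x, x))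

/-- All local rings are regular. -/
def IsNonsingular (X : SpaceWithFunctions.{u}) : Prop :=
  ∀ x : X, IsRegularLocalRing (X.stalk x)

/-- Proper morphism (between varieties): `X × Z → Y × Z` is a closed map for every variety `Z`. -/
def IsProper {X : SpaceWithFunctions.{u}} {Y : SpaceWithFunctions.{v}} (φ : X → Y) : Prop :=
  IsMorphism φ ∧ ∀ Z : SpaceWithFunctions.{0}, Z.IsVariety →
    IsClosedMap (X := X.prod Z) (Y := Y.prod Z) (Prod.map φ id)

/-- `φ` restricts to an isomorphism from the preimage of `W` onto `W`. -/
def IsIsomorphismOver {X : SpaceWithFunctions.{u}} {Y : SpaceWithFunctions.{v}} (φ : X → Y)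
    (W : Set Y) : Prop :=
  IsIsomorphism (X := X.restrict (φ ⁻¹' W)) (Y := Y.restrict W) (W.restrictPreimage φ)

/-- `φ` restricts to an isomorphism between dense open subsets. -/
def IsBirational {X : SpaceWithFunctions.{u}} {Y : SpaceWithFunctions.{v}} (φ : X → Y) : Prop :=
  IsMorphism φ ∧ ∃ (U : Set X) (W : Set Y) (h : Set.MapsTo φ U W),
    IsOpen U ∧ Dense U ∧ IsOpen W ∧ Dense W ∧
      IsIsomorphism (X := X.restrict U) (Y := Y.restrict W) (h.restrict φ U W)

/-- A resolution of singularities of a variety `Y`: a proper birational morphism from a nonsingular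
irreducible variety. -/
structure IsResolution {X : SpaceWithFunctions.{u}} {Y : SpaceWithFunctions.{v}}
    (φ : X → Y) : Prop where
  variety_source : X.IsVariety
  variety_target : Y.IsVariety
  irreducible : IrreducibleSpace X
  nonsingular : X.IsNonsingular
  proper : IsProper φ
  birational : IsBirational φ

/-! ### Grassmannians -/

/-- The variety of linearly independent `k`-tuples of vectors, an open subset of `V ^ k`. -/
def frames (k : ℕ) (V : Type u) [AddCommGroup V] [Module ℂ V] : SpaceWithFunctions.{u} :=
  (affine (Fin k → V)).restrict {A : Fin k → V | LinearIndependent ℂ A}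

/-- The Grassmannian of `k`-dimensional subspaces of `V`, as the quotient of the variety of
linearly independent `k`-tuples (by `GL_k`) under `A ↦ span A`. -/
def grassmannian (k : ℕ) (V : Type u) [AddCommGroup V] [Module ℂ V] : SpaceWithFunctions.{u} :=
  (frames k V).quotient (T := {W : Submodule ℂ V // Module.finrank ℂ W = k})
    fun A => ⟨Submodule.span ℂ (Set.range A.1), by
      have h : LinearIndependent ℂ (A.1 : Fin k → V) := A.2
      simpa using finrank_span_eq_card h⟩

/-- The subspace of `V` corresponding to a point of a Grassmannian. -/
def sub {k : ℕ} {V : Type u} [AddCommGroup V] [Module ℂ V] (W : grassmannian k V) :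
    Submodule ℂ V :=
  Subtype.val (p := fun W : Submodule ℂ V => Module.finrank ℂ W = k) W

/-- A Zariski locally trivial fibre bundle with fibre the Grassmannian `G(p, q)`. -/
def IsGrassmannianBundle (p q : ℕ) {X : SpaceWithFunctions.{u}} {Y : SpaceWithFunctions.{v}}
    (φ : X → Y) : Prop :=
  IsMorphism φ ∧ ∀ y : Y, ∃ U : Set Y, IsOpen U ∧ y ∈ U ∧
    ∃ e : φ ⁻¹' U → U × grassmannian p (Fin q → ℂ),
      IsIsomorphism (X := X.restrict (φ ⁻¹' U))
        (Y := (Y.restrict U).prod (grassmannian p (Fin q → ℂ))) e ∧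
      ∀ x, (e x).1 = U.restrictPreimage φ x

/-- Iterated towers of Grassmannians: starting from a point, one takes successively bundles with
fibre a (non-empty) Grassmannian. -/
inductive IsGrassmannianTower : SpaceWithFunctions.{u} → Prop
  | point (X : SpaceWithFunctions.{u}) (hX : Nonempty X) (hX' : Subsingleton X) :
      IsGrassmannianTower X
  | bundle (X Y : SpaceWithFunctions.{u}) (φ : X → Y) (p q : ℕ) (hpq : p ≤ q)
      (hφ : IsGrassmannianBundle p q φ) (hY : IsGrassmannianTower Y) : IsGrassmannianTower X

end SpaceWithFunctions

/-! ### Schubert varieties in partial flag varieties -/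

/-- A complete flag `F_0 ⊂ F_1 ⊂ ⋯ ⊂ F_n = V` with `dim F_j = j`. -/
structure CompleteFlag (V : Type u) [AddCommGroup V] [Module ℂ V] (n : ℕ) where
  F : Fin (n + 1) → Submodule ℂ V
  mono : Monotone F
  finrank_eq : ∀ j, Module.finrank ℂ (F j) = j
  eq_top : F (Fin.last n) = ⊤

/-- Dimensions `0 = k_0 < k_1 < ⋯ < k_h` of an `h`-step partial flag.  The index `t : Fin h`
stands for the step `t + 1`, so that the dimension of that step is `k t.succ`, and that of the
preceding one is `k t.castSucc`. -/
structure FlagDims (h : ℕ) where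
  k : Fin (h + 1) → ℕ
  zero : k 0 = 0
  strictMono : StrictMono k

/-- The largest dimension `k_h`. -/
def FlagDims.top {h : ℕ} (K : FlagDims h) : ℕ := K.k (Fin.last h)

/-- A Schubert index `a^α` for `F(k_1, …, k_h; n)`: a sequence `1 ≤ a_1 < ⋯ < a_{k_h} ≤ n` and
colours `α_i` such that exactly `k_t - k_{t-1}` of them are equal to `t`. -/
structure SchubertIndex {h : ℕ} (K : FlagDims h) (n : ℕ) where
  a : Fin K.top → Fin (n + 1)
  a_pos : ∀ i, 0 < a i
  a_strictMono : StrictMono a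
  α : Fin K.top → Fin h
  card_α : ∀ t : Fin h,
    (Finset.univ.filter fun i => α i = t).card = K.k t.succ - K.k t.castSucc

namespace SchubertIndex

open SpaceWithFunctions

variable {h n : ℕ} {K : FlagDims h} (I : SchubertIndex K n)

/-- The entries `μ_{i,t} = #{i' ≤ i | α_{i'} ≤ t}` of the rank matrix. -/
def μ (t : Fin h) (i : Fin K.top) : ℕ :=
  (Finset.univ.filter fun i' => i' ≤ i ∧ I.α i' ≤ t).card

theorem card_α_lt (j : ℕ) (hj : j < h + 1) :
    (Finset.univ.filter fun i => (I.α i : ℕ) < j).card = K.k ⟨j, hj⟩ := by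
  induction j with
  | zero => simpa using K.zero.symm
  | succ j ih =>
    have h1 := ih (by omega)
    have h2 := I.card_α ⟨j, by omega⟩
    have h3 : K.k ⟨j, by omega⟩ < K.k ⟨j + 1, hj⟩ := K.strictMono (by simp)
    have h4 : (Finset.univ.filter fun i => (I.α i : ℕ) < j + 1) =
        (Finset.univ.filter fun i => (I.α i : ℕ) < j) ∪
          (Finset.univ.filter fun i => I.α i = ⟨j, by omega⟩) := by
      ext i
      simp [Fin.ext_iff]
      omega
    rw [h4, Finset.card_union_of_disjoint, h1, h2]
    · simp only [Fin.succ_mk, Fin.castSucc_mk]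
      omega
    · rw [Finset.disjoint_filter]
      intro i _ hi hi'
      simp [hi'] at hi

/-- The index of the last column. -/
def last (K : FlagDims h) (t : Fin h) : Fin K.top :=
  ⟨K.top - 1, by
    have h1 : K.k 0 < K.top := K.strictMono (by
      have := t.2
      rw [Fin.lt_def]
      simp only [Fin.val_zero, Fin.val_last]
      omega)
    omega⟩

theorem μ_last (t : Fin h) : I.μ t (last K t) = K.k t.succ := by
  have := I.card_α_lt (t + 1) (by omega)
  rw [show t.succ = ⟨t + 1, by omega⟩ from rfl, ← this]
  unfold μ
  congr 1
  ext i
  have := i.2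
  simp only [last, Fin.le_def, Finset.mem_filter, Finset.mem_univ, true_and]
  omega

variable {V : Type u} [AddCommGroup V] [Module ℂ V] (F : CompleteFlag V n)

/-- The product `∏_t G(k_t, V)`. -/
def grassmannianProduct (K : FlagDims h) (V : Type u) [AddCommGroup V] [Module ℂ V] :
    SpaceWithFunctions.{u} :=
  pi fun t : Fin h => grassmannian (K.k t.succ) V

/-- The partial flag variety `F(k_1, …, k_h; n)`, as a subset of `∏_t G(k_t, V)`. -/
def flags (K : FlagDims h) (V : Type u) [AddCommGroup V] [Module ℂ V] :
    Set (grassmannianProduct K V) :=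
  {Λ : ∀ t : Fin h, grassmannian (K.k t.succ) V | ∀ t t', t ≤ t' → sub (Λ t) ≤ sub (Λ t')}

/-- The Schubert variety `Σ_{a^α}(F)`: partial flags with `dim (F_{a_i} ∩ Λ_t) ≥ μ_{i,t}`. -/
def schubertVariety : SpaceWithFunctions.{u} :=
  (grassmannianProduct K V).restrict
    {Λ : ∀ t : Fin h, grassmannian (K.k t.succ) V | Λ ∈ flags K V ∧
      ∀ t i, I.μ t i ≤ Module.finrank ℂ ↥(F.F (I.a i) ⊓ sub (Λ t))}

/-- The member `Λ_t` of a partial flag in the Schubert variety. -/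
def step (Λ : I.schubertVariety F) (t : Fin h) : Submodule ℂ V :=
  sub ((Subtype.val Λ : ∀ t : Fin h, grassmannian (K.k t.succ) V) t)

/-- The Schubert cell: partial flags in the relative position to the complete flag prescribed by
the index, that is `dim (F_j ∩ Λ_t) = #{i | a_i ≤ j, α_i ≤ t}` for all `j` and `t`. -/
def cell : Set (I.schubertVariety F) :=
  {Λ | ∀ (t : Fin h) (j : Fin (n + 1)), Module.finrank ℂ ↥(F.F j ⊓ I.step F Λ t) =
    (Finset.univ.filter fun i => I.a i ≤ j ∧ I.α i ≤ t).card}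

/-- The locus where the rank conditions are equalities, `dim (F_{a_i} ∩ Λ_t) = μ_{i,t}`. -/
def rankLocus : Set (I.schubertVariety F) :=
  {Λ | ∀ (t : Fin h) (i : Fin K.top),
    Module.finrank ℂ ↥(F.F (I.a i) ⊓ I.step F Λ t) = I.μ t i}

/-- The product `∏_{t,i} G(μ_{i,t}, V)`. -/
def diagramProduct (V : Type u) [AddCommGroup V] [Module ℂ V] : SpaceWithFunctions.{u} :=
  pi fun p : Fin h × Fin K.top => grassmannian (I.μ p.1 p.2) V

/-- The variety `Γ` of diagrams: subspaces `W^{t,i}` of dimension `μ_{i,t}` which increase along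
rows and columns, the column `i` being continued by `F_{a_i}`.  The last column consists of the
`Λ_t`.  Entries of a row with equal dimensions coincide. -/
def diagrams : SpaceWithFunctions.{u} :=
  (I.diagramProduct V).restrict
    {W : ∀ p : Fin h × Fin K.top, grassmannian (I.μ p.1 p.2) V |
      (∀ t i i', i ≤ i' → sub (W (t, i)) ≤ sub (W (t, i'))) ∧
      (∀ t t' i, t ≤ t' → sub (W (t, i)) ≤ sub (W (t', i))) ∧
      ∀ t i, sub (W (t, i)) ≤ F.F (I.a i)}

/-- The entry `W^{t,i}` of a diagram. -/
def entry (W : I.diagrams F) (t : Fin h) (i : Fin K.top) : Submodule ℂ V :=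
  sub ((Subtype.val W : ∀ p : Fin h × Fin K.top, grassmannian (I.μ p.1 p.2) V) (t, i))

/-- The projection `π : Γ → Σ_{a^α}(F)` to the last column `(Λ_1, …, Λ_h)`. -/
def projection [FiniteDimensional ℂ V] (W : I.diagrams F) : I.schubertVariety F :=
  ⟨fun t => (⟨I.entry F W t (last K t), by
      rw [← I.μ_last t]
      exact Subtype.property
        ((Subtype.val W : ∀ p : Fin h × Fin K.top, grassmannian (I.μ p.1 p.2) V) (t, last K t))⟩ :
      {W : Submodule ℂ V // Module.finrank ℂ W = K.k t.succ}), by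
    obtain ⟨W, hr, hc, hF⟩ := W
    refine ⟨fun t t' htt' => hc t t' _ htt', fun t i => ?_⟩
    have hdim : Module.finrank ℂ (sub (W (t, i))) = I.μ t i := Subtype.property (W (t, i))
    rw [← hdim]
    refine Submodule.finrank_mono (le_inf (hF t i) (hr t i (last K t) ?_))
    have := i.2
    simp only [last, Fin.le_def]
    omega⟩

end SchubertIndex

-- A diagram in Γ can be filled in one entry at a time, by rows from t = h down to t = 1 and from
-- left to right within a row. When its turn comes, W^{t,i} only has to satisfy W^{t,i-1} ⊂ W^{t,i}
-- ⊂ W^{t+1,i}, with 0 or F_{a_i} in place of a missing neighbour; the other inclusions among the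
-- chosen entries follow. Since μ_{i,t} ≤ μ_{i-1,t} + 1, the choice amounts to a subspace of
-- dimension at most 1 in a quotient of constant dimension. Hence Γ is a tower of bundles whose
-- fibres are points or projective spaces (`isGrassmannianBundle_between`, `exists_bundle_insert`).
-- Properties then climb the tower: Γ is irreducible because the bundle maps are open with
-- irreducible fibres, nonsingular because it looks locally like affine space, and complete because
-- projective spaces are complete (`isClosedMap_fst_prod_lines`, by the Nullstellensatz). A morphism
-- from a complete space to a separated one is proper.
--
-- Over the rank locus a diagram is determined by its last column: W^{t,i} lies in F_{a_i} ∩ Λ_t and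
-- has the same dimension. This inverse of π is a morphism because intersecting with a fixed
-- subspace is regular where the dimension is constant (`LiftsAt.inf_const`). The cell is the part
-- of Σ where all dimensions dim (F_j ∩ Λ_t) take their least values, so it is open by
-- semicontinuity; a coordinate flag lies in it.
--
-- Density of the cell follows from irreducibility of Γ once π is known to be surjective, which is
-- the combinatorial core (`IsColumn.exists_prev`). Starting from (Λ_t), the columns are built from
-- right to left. Passing to the previous column, some entries must be cut down to hyperplanes that
-- contain the entry already chosen in the row before and lose as little as possible of the
-- intersections with F; an inequality between entries of the rank matrix shows that this suffices.
--
-- The geometry of Grassmannians is reduced to linear algebra by `LiftsAt`: a map to a Grassmannian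
-- is a morphism exactly when every vector of a subspace of the family extends locally to a regular
-- section of the family. Sums, images and intersections of constant dimension can then be treated
-- by lifting vectors.

universe u' v'

set_option linter.unusedSectionVars false

namespace SpaceWithFunctions

variable {X : SpaceWithFunctions.{u}} {Y : SpaceWithFunctions.{v}} {Z : SpaceWithFunctions.{w}}

/-! ### Regular functions -/

theorem RegularAt.sub {f g : X → ℂ} {x : X} (hf : X.RegularAt f x) (hg : X.RegularAt g x) :
    X.RegularAt (f - g) x := by
  rw [sub_eq_add_neg]
  exact hf.add hg.neg

theorem RegularAt.const_mul {f : X → ℂ} {x : X} (hf : X.RegularAt f x) (c : ℂ) :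
    X.RegularAt (fun y => c * f y) x :=
  (X.regularAt_const c x).mul hf

theorem RegularAt.sum {ι : Type*} {f : ι → X → ℂ} {x : X} {s : Finset ι}
    (hf : ∀ i ∈ s, X.RegularAt (f i) x) : X.RegularAt (fun y => ∑ i ∈ s, f i y) x := by
  classical
  induction s using Finset.induction_on with
  | empty => simpa using X.regularAt_const 0 x
  | insert a s ha ih =>
    simp only [Finset.sum_insert ha]
    exact (hf a (by simp)).add (ih fun i hi => hf i (by simp [hi]))

theorem RegularAt.prod {ι : Type*} {f : ι → X → ℂ} {x : X} {s : Finset ι}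
    (hf : ∀ i ∈ s, X.RegularAt (f i) x) : X.RegularAt (fun y => ∏ i ∈ s, f i y) x := by
  classical
  induction s using Finset.induction_on with
  | empty => simpa using X.regularAt_const 1 x
  | insert a s ha ih =>
    simp only [Finset.prod_insert ha]
    exact (hf a (by simp)).mul (ih fun i hi => hf i (by simp [hi]))

theorem RegularAt.inv {f : X → ℂ} {x : X} (hf : X.RegularAt f x) (hx : f x ≠ 0) :
    X.RegularAt f⁻¹ x := (X.inv_mem x f hf hx).2

theorem RegularAt.eventually_ne {f : X → ℂ} {x : X} (hf : X.RegularAt f x) (hx : f x ≠ 0) :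
    ∀ᶠ y in 𝓝 x, f y ≠ 0 := (X.inv_mem x f hf hx).1

theorem RegularAt.eventually {f : X → ℂ} {x : X} (hf : X.RegularAt f x) :
    ∀ᶠ y in 𝓝 x, X.RegularAt f y := X.eventually_mem x f hf

theorem RegularAt.det {ι : Type*} [Fintype ι] [DecidableEq ι] {M : X → Matrix ι ι ℂ} {x : X}
    (hM : ∀ i j, X.RegularAt (fun y => M y i j) x) : X.RegularAt (fun y => (M y).det) x := by
  simp only [Matrix.det_apply']
  exact .sum fun σ _ => (RegularAt.prod fun i _ => hM _ _).const_mul _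

theorem RegularAt.adjugate {ι : Type*} [Fintype ι] [DecidableEq ι] {M : X → Matrix ι ι ℂ} {x : X}
    (hM : ∀ i j, X.RegularAt (fun y => M y i j) x) (i j : ι) :
    X.RegularAt (fun y => (M y).adjugate i j) x := by
  simp only [Matrix.adjugate_apply]
  refine .det fun k l => ?_
  simp only [Matrix.updateRow_apply]
  split_ifs
  exacts [X.regularAt_const _ x, hM k l]

theorem RegularAt.matrix_inv {ι : Type*} [Fintype ι] [DecidableEq ι] {M : X → Matrix ι ι ℂ} {x : X}
    (hM : ∀ i j, X.RegularAt (fun y => M y i j) x) (hx : (M x).det ≠ 0) (i j : ι) :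
    X.RegularAt (fun y => (M y)⁻¹ i j) x := by
  simp only [Matrix.inv_def, Ring.inverse_eq_inv', Matrix.smul_apply, smul_eq_mul]
  exact ((RegularAt.det hM).inv hx).mul (.adjugate hM i j)

/-! ### Morphisms near a point -/

/-- `φ` is a morphism near `x`, as far as germs at `x` and `φ x` are concerned. -/
def MorphismAt (X : SpaceWithFunctions.{u}) (Y : SpaceWithFunctions.{v}) (φ : X → Y) (x : X) :
    Prop :=
  ContinuousAt φ x ∧ ∀ f : Y → ℂ, Y.RegularAt f (φ x) → X.RegularAt (f ∘ φ) x

theorem isMorphism_iff {φ : X → Y} : IsMorphism φ ↔ ∀ x, MorphismAt X Y φ x :=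
  ⟨fun h x => ⟨h.1.continuousAt, h.2 x⟩, fun h =>
    ⟨continuous_iff_continuousAt.2 fun x => (h x).1, fun x => (h x).2⟩⟩

theorem MorphismAt.comp {φ : X → Y} {ψ : Y → Z} {x : X} (hψ : MorphismAt Y Z ψ (φ x))
    (hφ : MorphismAt X Y φ x) : MorphismAt X Z (fun x => ψ (φ x)) x :=
  ⟨ContinuousAt.comp (g := ψ) hψ.1 hφ.1, fun f hf => hφ.2 _ (hψ.2 f hf)⟩

theorem MorphismAt.congr {φ ψ : X → Y} {x : X} (hφ : MorphismAt X Y φ x) (h : φ =ᶠ[𝓝 x] ψ) :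
    MorphismAt X Y ψ x := by
  refine ⟨hφ.1.congr h, fun f hf => ?_⟩
  rw [← h.eq_of_nhds] at hf
  exact (hφ.2 f hf).congr (h.fun_comp f)

theorem morphismAt_id (x : X) : MorphismAt X X (fun y => y) x :=
  ⟨continuousAt_id, fun _ hf => hf⟩

theorem morphismAt_const (y : Y) (x : X) : MorphismAt X Y (fun _ => y) x :=
  ⟨continuousAt_const, fun f _ => X.regularAt_const (f y) x⟩

theorem IsMorphism.comp {φ : X → Y} {ψ : Y → Z} (hψ : IsMorphism ψ) (hφ : IsMorphism φ) :
    IsMorphism fun x => ψ (φ x) :=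
  isMorphism_iff.2 fun x => (isMorphism_iff.1 hψ _).comp (isMorphism_iff.1 hφ x)

theorem IsIsomorphism.comp {φ : X → Y} {ψ : Y → Z} (hψ : IsIsomorphism ψ) (hφ : IsIsomorphism φ) :
    IsIsomorphism fun x => ψ (φ x) := by
  obtain ⟨h1, φ', h1', hl, hr⟩ := hφ
  obtain ⟨h2, ψ', h2', hl', hr'⟩ := hψ
  exact ⟨h2.comp h1, _, h1'.comp h2', fun x => by simp [hl' (φ x), hl x],
    fun x => by simp [hr (ψ' x), hr' x]⟩

theorem MorphismAt.eventually {φ : X → Y} {x : X} (hφ : MorphismAt X Y φ x) {p : Y → Prop}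
    (hp : ∀ᶠ y in 𝓝 (φ x), p y) : ∀ᶠ y in 𝓝 x, p (φ y) := hφ.1.eventually hp

/-! ### Generated structures -/

section generate

variable {T : Type v} {L : T → Set (T → ℂ)} {hL : Spreads L}

theorem regularAt_generate_of_mem_adjoin {f : T → ℂ} {x : T} (hf : f ∈ Algebra.adjoin ℂ (L x)) :
    (generate L hL).RegularAt f x :=
  ⟨f, hf, 1, one_mem _, by simp, by rw [div_one]; rfl⟩

theorem regularAt_generate_of_mem {f : T → ℂ} {x : T} (hf : f ∈ L x) :
    (generate L hL).RegularAt f x :=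
  regularAt_generate_of_mem_adjoin (Algebra.subset_adjoin hf)

/-- Topology and germs of a generated space are both made from polynomial expressions in the
generators, so it is enough to pull back generators. Continuity comes from basic neighbourhoods
being non-vanishing loci. -/
theorem morphismAt_generate {φ : X → T} {x : X}
    (h : ∀ f ∈ L (φ x), X.RegularAt (f ∘ φ) x) : MorphismAt X (generate L hL) φ x := by
  have key : ∀ f ∈ Algebra.adjoin ℂ (L (φ x)), X.RegularAt (f ∘ φ) x := by
    intro f hf
    induction hf using Algebra.adjoin_induction with
    | mem f hf => exact h f hf
    | algebraMap r => exact X.regularAt_const r x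
    | add f g _ _ hf hg => exact hf.add hg
    | mul f g _ _ hf hg => exact hf.mul hg
  constructor
  · intro s hs
    obtain ⟨t, hts, ht, hxt⟩ := mem_nhds_iff.1 hs
    obtain ⟨f, hf, hfx, hft⟩ := ht _ hxt
    exact ((key f hf).eventually_ne hfx).mono fun y hy => hts (hft _ hy)
  · rintro q ⟨f, hf, g, hg, hgx, hq⟩
    have hq' := Germ.coe_eq.1 hq
    have h1 : X.RegularAt ((f ∘ φ) * (g ∘ φ)⁻¹) x := (key f hf).mul ((key g hg).inv hgx)
    obtain ⟨t, hts, ht, hxt⟩ := mem_nhds_iff.1 hq'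
    obtain ⟨e, he, hex, het⟩ := ht _ hxt
    refine h1.congr ?_
    filter_upwards [(key e he).eventually_ne hex] with y hy
    have h2 : q (φ y) = f (φ y) / g (φ y) := hts (het _ hy)
    change f (φ y) * (g (φ y))⁻¹ = q (φ y)
    rw [h2, div_eq_mul_inv]

end generate

/-! ### Subspaces -/

theorem morphismAt_restrict {S : Set Y} {φ : X → Y.restrict S} {x : X}
    (h : MorphismAt X Y (fun x => (φ x).1) x) : MorphismAt X (Y.restrict S) φ x := by
  have hc : ContinuousAt φ x := Topology.IsInducing.subtypeVal.continuousAt_iff.2 h.1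
  refine ⟨hc, ?_⟩
  rintro q ⟨f, hf, hq⟩
  exact (h.2 f hf).congr (hc.eventually (Germ.coe_eq.1 hq).symm)

theorem regularAt_restrict {S : Set Y} {f : Y → ℂ} {y : Y.restrict S} (hf : Y.RegularAt f y.1) :
    (Y.restrict S).RegularAt (fun z => f z.1) y := ⟨f, hf, rfl⟩

theorem morphismAt_val {S : Set Y} (y : Y.restrict S) :
    MorphismAt (Y.restrict S) Y (fun z => z.1) y :=
  ⟨continuous_subtype_val.continuousAt, fun _ hf => regularAt_restrict hf⟩

theorem isMorphism_val {S : Set Y} : IsMorphism (X := Y.restrict S) (Y := Y) fun z => z.1 :=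
  isMorphism_iff.2 morphismAt_val

theorem isOpen_restrict {S : Set Y} {U : Set Y} (hU : IsOpen U) :
    IsOpen (X := Y.restrict S) {z | z.1 ∈ U} := hU.preimage continuous_subtype_val

/-! ### Products -/

/-- The topology of the product is given by functions, so an open set of the factor enters through
its indicator function, which is regular at its points, being equal to 1 near them. -/
theorem morphismAt_fst (p : X.prod Y) : MorphismAt (X.prod Y) X (fun p => p.1) p := by
  have hreg : ∀ f : X → ℂ, X.RegularAt f p.1 → (X.prod Y).RegularAt (fun q => f q.1) p :=
    fun f hf => regularAt_generate_of_mem (.inl ⟨f, hf, rfl⟩)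
  refine ⟨fun s hs => ?_, hreg⟩
  classical
  obtain ⟨t, hts, ht, hxt⟩ := mem_nhds_iff.1 hs
  have h1 : X.RegularAt (t.indicator fun _ => 1) p.1 := (X.regularAt_const 1 _).congr <| by
    filter_upwards [ht.mem_nhds hxt] with z hz
    simp [hz]
  refine ((hreg _ h1).eventually_ne (by simp [hxt])).mono fun y hy => hts ?_
  by_contra h
  simp [h] at hy

theorem morphismAt_snd (p : X.prod Y) : MorphismAt (X.prod Y) Y (fun p => p.2) p := by
  have hreg : ∀ f : Y → ℂ, Y.RegularAt f p.2 → (X.prod Y).RegularAt (fun q => f q.2) p :=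
    fun f hf => regularAt_generate_of_mem (.inr ⟨f, hf, rfl⟩)
  refine ⟨fun s hs => ?_, hreg⟩
  classical
  obtain ⟨t, hts, ht, hxt⟩ := mem_nhds_iff.1 hs
  have h1 : Y.RegularAt (t.indicator fun _ => 1) p.2 := (Y.regularAt_const 1 _).congr <| by
    filter_upwards [ht.mem_nhds hxt] with z hz
    simp [hz]
  refine ((hreg _ h1).eventually_ne (by simp [hxt])).mono fun y hy => hts ?_
  by_contra h
  simp [h] at hy

theorem MorphismAt.prodMk {φ : Z → X} {ψ : Z → Y} {z : Z} (hφ : MorphismAt Z X φ z)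
    (hψ : MorphismAt Z Y ψ z) : MorphismAt Z (X.prod Y) (fun z => (φ z, ψ z)) z := by
  refine morphismAt_generate ?_
  rintro _ (⟨g, hg, rfl⟩ | ⟨g, hg, rfl⟩)
  exacts [hφ.2 g hg, hψ.2 g hg]

section pi

variable {ι : Type w} {A : ι → SpaceWithFunctions.{u}}

theorem morphismAt_eval (i : ι) (p : pi A) : MorphismAt (pi A) (A i) (fun p => p i) p := by
  have hreg : ∀ f : A i → ℂ, (A i).RegularAt f (p i) → (pi A).RegularAt (fun q => f (q i)) p :=
    fun f hf => regularAt_generate_of_mem ⟨i, f, hf, rfl⟩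
  refine ⟨fun s hs => ?_, hreg⟩
  classical
  obtain ⟨t, hts, ht, hxt⟩ := mem_nhds_iff.1 hs
  have h1 : (A i).RegularAt (t.indicator fun _ => 1) (p i) :=
    ((A i).regularAt_const 1 _).congr <| by
      filter_upwards [ht.mem_nhds hxt] with z hz
      simp [hz]
  refine ((hreg _ h1).eventually_ne (by simp [hxt])).mono fun y hy => hts ?_
  by_contra h
  simp [h] at hy

theorem morphismAt_pi {φ : X → pi A} {x : X} (h : ∀ i, MorphismAt X (A i) (fun x => φ x i) x) :
    MorphismAt X (pi A) φ x := by
  refine morphismAt_generate ?_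
  rintro _ ⟨i, g, hg, rfl⟩
  exact (h i).2 g hg

end pi

/-! ### Vector valued regular functions -/

section vector

variable {E : Type*} [AddCommGroup E] [Module ℂ E] {E' : Type*} [AddCommGroup E'] [Module ℂ E']

/-- A function with values in a vector space is regular near `x` if its coordinates are. -/
def VecRegularAt (X : SpaceWithFunctions.{u}) (f : X → E) (x : X) : Prop :=
  ∀ l : E →ₗ[ℂ] ℂ, X.RegularAt (fun y => l (f y)) x

theorem vecRegularAt_affine (v : affine E) : (affine E).VecRegularAt (E := E) (fun w => w) v :=
  fun l => regularAt_generate_of_mem ⟨l, rfl⟩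

theorem VecRegularAt.morphismAt {f : X → E} {x : X} (hf : X.VecRegularAt f x) :
    MorphismAt X (affine E) f x := by
  refine morphismAt_generate ?_
  rintro _ ⟨l, rfl⟩
  exact hf l

theorem VecRegularAt.comp {f : Y → E} {φ : X → Y} {x : X} (hf : Y.VecRegularAt f (φ x))
    (hφ : MorphismAt X Y φ x) : X.VecRegularAt (fun x => f (φ x)) x :=
  fun l => hφ.2 _ (hf l)

theorem MorphismAt.vecRegularAt {f : X → affine E} {x : X} (hf : MorphismAt X (affine E) f x) :
    X.VecRegularAt (E := E) f x :=
  (vecRegularAt_affine (f x)).comp (φ := f) hf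

theorem vecRegularAt_const (v : E) (x : X) : X.VecRegularAt (fun _ => v) x :=
  fun l => X.regularAt_const (l v) x

theorem VecRegularAt.congr {f g : X → E} {x : X} (hf : X.VecRegularAt f x) (h : f =ᶠ[𝓝 x] g) :
    X.VecRegularAt g x :=
  fun l => (hf l).congr (h.fun_comp l)

theorem VecRegularAt.add {f g : X → E} {x : X} (hf : X.VecRegularAt f x)
    (hg : X.VecRegularAt g x) : X.VecRegularAt (fun y => f y + g y) x := fun l => by
  simp only [map_add]
  exact (hf l).add (hg l)

theorem VecRegularAt.sub {f g : X → E} {x : X} (hf : X.VecRegularAt f x)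
    (hg : X.VecRegularAt g x) : X.VecRegularAt (fun y => f y - g y) x := fun l => by
  simp only [map_sub]
  exact (hf l).sub (hg l)

theorem VecRegularAt.sum {ι : Type*} {f : ι → X → E} {x : X} {s : Finset ι}
    (hf : ∀ i ∈ s, X.VecRegularAt (f i) x) : X.VecRegularAt (fun y => ∑ i ∈ s, f i y) x :=
  fun l => by
    simp only [map_sum]
    exact .sum fun i hi => hf i hi l

theorem RegularAt.smul {c : X → ℂ} {f : X → E} {x : X} (hc : X.RegularAt c x)
    (hf : X.VecRegularAt f x) : X.VecRegularAt (fun y => c y • f y) x := fun l => by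
  simp only [map_smul, smul_eq_mul]
  exact hc.mul (hf l)

theorem VecRegularAt.map {f : X → E} {x : X} (hf : X.VecRegularAt f x) (T : E →ₗ[ℂ] E') :
    X.VecRegularAt (fun y => T (f y)) x := fun l => hf (l ∘ₗ T)

theorem vecRegularAt_pi {ι : Type*} [Finite ι] {f : X → ι → E} {x : X}
    (hf : ∀ i, X.VecRegularAt (fun y => f y i) x) : X.VecRegularAt f x := by
  classical
  cases nonempty_fintype ι
  intro l
  have : ∀ y, l (f y) = ∑ i, l (Pi.single i (f y i)) := fun y => by
    rw [← map_sum, Finset.univ_sum_single]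
  simp only [this]
  exact .sum fun i _ => hf i (l ∘ₗ LinearMap.single ℂ (fun _ => E) i)

theorem VecRegularAt.prodMk {f : X → E} {g : X → E'} {x : X} (hf : X.VecRegularAt f x)
    (hg : X.VecRegularAt g x) : X.VecRegularAt (fun y => (f y, g y)) x := fun l => by
  have : ∀ y, l (f y, g y) = l (f y, 0) + l (0, g y) := fun y => by
    rw [← map_add]; simp
  simp only [this]
  exact (hf (l ∘ₗ .inl ℂ E E')).add (hg (l ∘ₗ .inr ℂ E E'))

theorem VecRegularAt.bilin {E'' : Type*} [AddCommGroup E''] [Module ℂ E''] [FiniteDimensional ℂ E]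
    {f : X → E} {g : X → E'} {x : X} (hf : X.VecRegularAt f x) (hg : X.VecRegularAt g x)
    (B : E →ₗ[ℂ] E' →ₗ[ℂ] E'') : X.VecRegularAt (fun y => B (f y) (g y)) x := by
  let b := Module.finBasis ℂ E
  have : ∀ y, B (f y) (g y) = ∑ i, b.coord i (f y) • B (b i) (g y) := fun y => by
    conv_lhs => rw [← b.sum_repr (f y), map_sum, LinearMap.sum_apply]
    simp only [map_smul, LinearMap.smul_apply, Module.Basis.coord_apply]
  simp only [this]
  exact .sum fun i _ => (hf (b.coord i)).smul (hg.map (B (b i)))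

theorem VecRegularAt.apply [FiniteDimensional ℂ E] [FiniteDimensional ℂ E']
    {f : X → E →ₗ[ℂ] E'} {g : X → E} {x : X}
    (hf : X.VecRegularAt f x) (hg : X.VecRegularAt g x) :
    X.VecRegularAt (fun y => f y (g y)) x :=
  hf.bilin hg .id

theorem VecRegularAt.linearMap_comp {E'' : Type*} [AddCommGroup E''] [Module ℂ E'']
    [FiniteDimensional ℂ E] [FiniteDimensional ℂ E'] [FiniteDimensional ℂ E'']
    {f : X → E' →ₗ[ℂ] E''} {g : X → E →ₗ[ℂ] E'} {x : X}
    (hf : X.VecRegularAt f x) (hg : X.VecRegularAt g x) :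
    X.VecRegularAt (fun y => f y ∘ₗ g y) x :=
  hf.bilin hg (LinearMap.llcomp ℂ E E' E'')

theorem VecRegularAt.regularAt {f : X → ℂ} {x : X} (hf : X.VecRegularAt f x) :
    X.RegularAt f x := hf .id

theorem VecRegularAt.det [FiniteDimensional ℂ E] {T : X → Module.End ℂ E} {x : X}
    (hT : X.VecRegularAt T x) : X.RegularAt (fun y => LinearMap.det (T y)) x := by
  let b := Module.finBasis ℂ E
  simp only [← LinearMap.det_toMatrix b]
  exact .det fun i j => (hT.map ((LinearMap.toMatrix b b).toLinearMap)).map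
    (Matrix.entryLinearMap ℂ ℂ i j) |>.regularAt

/-- The inverse of a regular family of endomorphisms is regular. -/
theorem VecRegularAt.exists_inv [FiniteDimensional ℂ E] {T : X → Module.End ℂ E} {x : X}
    (hT : X.VecRegularAt T x) (hx : IsUnit (T x)) : ∃ S : X → Module.End ℂ E,
      X.VecRegularAt S x ∧ ∀ᶠ y in 𝓝 x, S y * T y = 1 ∧ T y * S y = 1 := by
  let b := Module.finBasis ℂ E
  have hdx : LinearMap.det (T x) ≠ 0 := (hx.map LinearMap.det).ne_zero
  have hM : ∀ i j, X.RegularAt (fun y => LinearMap.toMatrix b b (T y) i j) x := fun i j =>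
    (hT.map ((LinearMap.toMatrix b b).toLinearMap)).map
      (Matrix.entryLinearMap ℂ ℂ i j) |>.regularAt
  refine ⟨fun y => Matrix.toLinAlgEquiv b (LinearMap.toMatrix b b (T y))⁻¹, ?_, ?_⟩
  · have h1 : X.VecRegularAt (fun y => (LinearMap.toMatrix b b (T y))⁻¹) x := by
      refine vecRegularAt_pi fun i => vecRegularAt_pi fun j => ?_
      intro l
      have hl : ∀ c : ℂ, l c = l 1 * c := fun c => by
        conv_lhs => rw [← mul_one c, ← smul_eq_mul, map_smul, smul_eq_mul, mul_comm]
      exact ((RegularAt.matrix_inv hM (by rwa [LinearMap.det_toMatrix]) i j).const_mul (l 1)).congr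
        (.of_forall fun y => (hl _).symm)
    exact h1.map (Matrix.toLinAlgEquiv b).toLinearMap
  · filter_upwards [hT.det.eventually_ne hdx] with y hy
    have hu : IsUnit (LinearMap.toMatrix b b (T y)).det := by
      rw [LinearMap.det_toMatrix]; exact hy.isUnit
    have h2 : T y = Matrix.toLinAlgEquiv b (LinearMap.toMatrix b b (T y)) :=
      ((Matrix.toLinAlgEquiv b).apply_symm_apply (T y)).symm
    generalize LinearMap.toMatrix b b (T y) = M at hu h2
    rw [h2, ← map_mul, ← map_mul, Matrix.nonsing_inv_mul _ hu, Matrix.mul_nonsing_inv _ hu, map_one]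
    exact ⟨rfl, rfl⟩

end vector

end SpaceWithFunctions

namespace SpaceWithFunctions

/-! ### Frames and Grassmannians -/

section grassmannian

variable {X : SpaceWithFunctions.{u}} {Y : SpaceWithFunctions.{w}}
  {V : Type v} [AddCommGroup V] [Module ℂ V]

theorem finrank_sub {k : ℕ} (W : grassmannian k V) : Module.finrank ℂ (sub W) = k := W.2

theorem grassmannian_ext {k : ℕ} {W W' : grassmannian k V} (h : sub W = sub W') : W = W' :=
  Subtype.ext h

/-- A subspace of the given dimension as a point of the Grassmannian. -/
def ofFinrank {k : ℕ} (W : Submodule ℂ V) (h : Module.finrank ℂ W = k) : grassmannian k V := ⟨W, h⟩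

/-- The subspace spanned by a frame. -/
def spanFrame {k : ℕ} (A : frames k V) : grassmannian k V :=
  ⟨Submodule.span ℂ (Set.range A.1), by
    have h : LinearIndependent ℂ (A.1 : Fin k → V) := A.2
    simpa using finrank_span_eq_card h⟩

theorem sub_spanFrame {k : ℕ} (A : frames k V) :
    sub (spanFrame A) = Submodule.span ℂ (Set.range (A.1 : Fin k → V)) := rfl

theorem isOpen_grassmannian {k : ℕ} {U : Set (grassmannian k V)} :
    IsOpen U ↔ IsOpen (spanFrame ⁻¹' U) := isOpen_coinduced

theorem morphismAt_spanFrame {k : ℕ} (A : frames k V) :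
    MorphismAt (frames k V) (grassmannian k V) spanFrame A := by
  have hc : Continuous (spanFrame : frames k V → grassmannian k V) :=
    continuous_def.2 fun U hU => isOpen_grassmannian.1 hU
  refine ⟨hc.continuousAt, ?_⟩
  rintro q ⟨(f : grassmannian k V → ℂ), hqf, hf⟩
  have h2 : f ∘ spanFrame =ᶠ[𝓝 A] q ∘ spanFrame := by
    have h3 : ∀ᶠ y in 𝓝 (spanFrame A), f y = q y := (Germ.coe_eq.1 hqf).symm
    exact (hc.tendsto A).eventually h3
  have h4 := (show ∀ᶠ y in 𝓝 (spanFrame A), ∀ a, spanFrame a = y →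
    (frames k V).RegularAt (f ∘ spanFrame) a from hf).self_of_nhds A rfl
  exact h4.congr h2

theorem regularAt_grassmannian {k : ℕ} {f : grassmannian k V → ℂ} {U : Set (grassmannian k V)}
    (hU : IsOpen U) (hf : ∀ A : frames k V, spanFrame A ∈ U →
      (frames k V).RegularAt (fun A => f (spanFrame A)) A) {W : grassmannian k V} (hW : W ∈ U) :
    (grassmannian k V).RegularAt f W := by
  refine ⟨f, rfl, ?_⟩
  filter_upwards [hU.mem_nhds hW] with y hy a ha
  exact hf a (by rwa [← ha] at hy)

variable [FiniteDimensional ℂ V]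

theorem spanFrame_surjective {k : ℕ} :
    Function.Surjective (spanFrame : frames k V → grassmannian k V) := by
  rintro ⟨W, hW⟩
  let b := Module.finBasisOfFinrankEq ℂ W hW
  have hb : LinearIndependent ℂ (fun i => (b i : V)) :=
    b.linearIndependent.map' W.subtype W.ker_subtype
  refine ⟨⟨_, hb⟩, Subtype.ext ?_⟩
  change Submodule.span ℂ (Set.range (W.subtype ∘ b)) = W
  rw [Set.range_comp, ← Submodule.map_span, b.span_eq, Submodule.map_top, Submodule.range_subtype]

/-- Linear independence is an open condition. -/
theorem VecRegularAt.eventually_linearIndependent {k : ℕ} {f : X → Fin k → V} {x : X}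
    (hf : X.VecRegularAt f x) (hx : LinearIndependent ℂ (f x)) :
    ∀ᶠ y in 𝓝 x, LinearIndependent ℂ (f y) := by
  obtain ⟨q, hq⟩ := LinearMap.exists_leftInverse_of_injective
    (Fintype.linearCombination ℂ (f x)) (LinearMap.ker_eq_bot.2
      (linearIndependent_iff_injective_fintypeLinearCombination.1 hx))
  -- A left inverse `q` of the frame at `x` turns the nearby families into square matrices with `M x
  -- = 1`, and a non-zero determinant forces independence.
  let M : X → Matrix (Fin k) (Fin k) ℂ := fun y i j => q (f y i) j
  have hM : ∀ i j, X.RegularAt (fun y => M y i j) x := fun i j =>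
    hf (LinearMap.proj j ∘ₗ q ∘ₗ LinearMap.proj i)
  have hMx : M x = 1 := by
    ext i j
    have := LinearMap.congr_fun hq (Pi.single i 1)
    simp only [LinearMap.comp_apply, Fintype.linearCombination_apply_single, one_smul,
      LinearMap.id_apply] at this
    simp only [M, this, Matrix.one_apply, Pi.single_apply, eq_comm]
  filter_upwards [(RegularAt.det hM).eventually_ne (by simp [hMx])] with y hy
  refine LinearIndependent.of_comp q ?_
  exact Matrix.linearIndependent_rows_of_det_ne_zero hy

/-- The projection to `W` along `C`, when these subspaces are complementary. -/
noncomputable def projAlong (C W : Submodule ℂ V) : Module.End ℂ V :=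
  open Classical in if h : IsCompl W C then W.projection C h else 0

theorem projAlong_apply_mem {C W : Submodule ℂ V} (v : V) : projAlong C W v ∈ W := by
  unfold projAlong
  split_ifs with h
  · exact Submodule.projection_apply_mem h v
  · exact W.zero_mem

theorem projAlong_of_mem {C W : Submodule ℂ V} (h : IsCompl W C) {v : V} (hv : v ∈ W) :
    projAlong C W v = v := by
  simp only [projAlong, h, dif_pos]
  exact Submodule.projection_apply_of_mem_left h hv

theorem projAlong_of_mem_right {C W : Submodule ℂ V} {v : V} (hv : v ∈ C) :
    projAlong C W v = 0 := by
  unfold projAlong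
  split_ifs with h
  · exact (Submodule.projection_apply_eq_zero_iff h).2 hv
  · rfl

theorem eq_projAlong {C W : Submodule ℂ V} (h : IsCompl W C) {T : Module.End ℂ V}
    (h1 : ∀ v ∈ W, T v = v) (h2 : ∀ v ∈ C, T v = 0) : T = projAlong C W := by
  ext v
  obtain ⟨w, hw, c, hc, rfl⟩ : ∃ w ∈ W, ∃ c ∈ C, w + c = v :=
    Submodule.mem_sup.1 (by rw [h.sup_eq_top]; trivial)
  rw [map_add, map_add, h1 w hw, h2 c hc, projAlong_of_mem h hw, projAlong_of_mem_right hc]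

/-- Write A_y : ℂ^k → V for the frame at y, and let q : V → ℂ^k have kernel C and be a left inverse
of A_x. Then q A_y is the identity at x, so it is invertible with regular inverse near x, and the
projection is A_y (q A_y)⁻¹ q. -/
theorem projAlong_family {k : ℕ} {C : Submodule ℂ V} {f : X → Fin k → V} {x : X}
    (hf : X.VecRegularAt f x) (hx : LinearIndependent ℂ (f x))
    (hC : IsCompl (Submodule.span ℂ (Set.range (f x))) C) :
    (∀ᶠ y in 𝓝 x, IsCompl (Submodule.span ℂ (Set.range (f y))) C) ∧
      X.VecRegularAt (fun y => projAlong C (Submodule.span ℂ (Set.range (f y)))) x := by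
  let lc : (Fin k → V) →ₗ[ℂ] ((Fin k → ℂ) →ₗ[ℂ] V) :=
    { toFun := fun A => Fintype.linearCombination ℂ A
      map_add' := fun A B => by
        ext; simp [Fintype.linearCombination_apply, Finset.sum_add_distrib]
      map_smul' := fun c A => by ext; simp [Fintype.linearCombination_apply] }
  have hlc : ∀ A, LinearMap.range (lc A) = Submodule.span ℂ (Set.range A) := fun A =>
    Fintype.range_linearCombination ℂ A
  have hinj : Function.Injective (lc (f x)) := linearIndependent_iff_injective_fintypeLinearCombination.1 hx
  let e : (Fin k → ℂ) ≃ₗ[ℂ] LinearMap.range (lc (f x)) := LinearEquiv.ofInjective _ hinj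
  have hC' : IsCompl (LinearMap.range (lc (f x))) C := by rwa [hlc]
  let q : V →ₗ[ℂ] (Fin k → ℂ) := e.symm.toLinearMap ∘ₗ Submodule.projectionOnto _ C hC'
  have hq : LinearMap.ker q = C := by
    rw [LinearEquiv.ker_comp, Submodule.ker_projectionOnto]
  have hlcf : X.VecRegularAt (fun y => lc (f y)) x := hf.map lc
  have hT : X.VecRegularAt (fun y => (q ∘ₗ lc (f y) : Module.End ℂ (Fin k → ℂ))) x :=
    (vecRegularAt_const q x).linearMap_comp hlcf
  have hTx : q ∘ₗ lc (f x) = 1 := by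
    ext1 i
    ext1
    simp only [LinearMap.comp_apply, q, LinearEquiv.coe_coe]
    rw [LinearEquiv.symm_apply_eq]
    exact Submodule.projectionOnto_apply_left hC' (e _)
  obtain ⟨S, hS, hST⟩ := hT.exists_inv (by rw [hTx]; exact isUnit_one)
  have key : ∀ᶠ y in 𝓝 x, IsCompl (Submodule.span ℂ (Set.range (f y))) C ∧
      lc (f y) ∘ₗ S y ∘ₗ q = projAlong C (Submodule.span ℂ (Set.range (f y))) := by
    filter_upwards [hST] with y hy
    have h1 : ∀ a, S y (q (lc (f y) a)) = a := fun a => LinearMap.congr_fun hy.1 a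
    have h2 : ∀ a, q (lc (f y) (S y a)) = a := fun a => LinearMap.congr_fun hy.2 a
    rw [← hlc, ← hq]
    have hc : IsCompl (LinearMap.range (lc (f y))) (LinearMap.ker q) := by
      constructor
      · rw [Submodule.disjoint_def]
        rintro _ ⟨a, rfl⟩ ha
        rw [← h1 a, LinearMap.mem_ker.1 ha, map_zero, map_zero]
      · rw [codisjoint_iff, eq_top_iff]
        intro v _
        refine Submodule.mem_sup.2 ⟨lc (f y) (S y (q v)), ⟨_, rfl⟩, v - lc (f y) (S y (q v)), ?_,
          by abel⟩
        rw [LinearMap.mem_ker, map_sub, h2, sub_self]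
    refine ⟨hc, eq_projAlong hc ?_ ?_⟩
    · rintro _ ⟨a, rfl⟩
      simp [h1]
    · intro v hv
      simp [LinearMap.mem_ker.1 hv]
  refine ⟨key.mono fun y hy => hy.1, ?_⟩
  exact (hlcf.linearMap_comp (hS.linearMap_comp (vecRegularAt_const q x))).congr
    (key.mono fun y hy => hy.2)

theorem vecRegularAt_frames {k : ℕ} (A : frames k V) :
    (frames k V).VecRegularAt (E := Fin k → V) (fun A => A.1) A :=
  (vecRegularAt_affine (E := Fin k → V) A.1).comp (φ := fun A : frames k V => A.1)
    (morphismAt_val A)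

theorem isOpen_isCompl {k : ℕ} (C : Submodule ℂ V) :
    IsOpen {W : grassmannian k V | IsCompl (sub W) C} := by
  rw [isOpen_grassmannian, isOpen_iff_eventually]
  intro A hA
  exact (projAlong_family (vecRegularAt_frames A) A.2 hA).1

/-- Regularity on the quotient is tested on frames. The projection along a fixed `C` is the
coordinate on the chart of complements of `C` used from here on. -/
theorem vecRegularAt_projAlong {k : ℕ} {C : Submodule ℂ V} {W : grassmannian k V}
    (hW : IsCompl (sub W) C) :
    (grassmannian k V).VecRegularAt (fun W => projAlong C (sub W)) W := by
  intro l
  refine regularAt_grassmannian (isOpen_isCompl C) (fun A hA => ?_) hW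
  exact (projAlong_family (vecRegularAt_frames A) A.2 hA).2 l

/-! ### Families of subspaces -/

/-- Every vector of `S x` extends to a regular section of the family `S` of subspaces. -/
def LiftsAt (X : SpaceWithFunctions.{u}) (S : X → Submodule ℂ V) (x : X) : Prop :=
  ∀ w ∈ S x, ∃ f : X → V, X.VecRegularAt f x ∧ f x = w ∧ ∀ᶠ y in 𝓝 x, f y ∈ S y

theorem LiftsAt.comp {S : Y → Submodule ℂ V} {φ : X → Y} {x : X} (hS : Y.LiftsAt S (φ x))
    (hφ : MorphismAt X Y φ x) : X.LiftsAt (fun x => S (φ x)) x := fun w hw => by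
  obtain ⟨f, hf, hfw, hfS⟩ := hS w hw
  exact ⟨fun x => f (φ x), hf.comp hφ, hfw, hφ.eventually hfS⟩

theorem liftsAt_const (S : Submodule ℂ V) (x : X) : X.LiftsAt (fun _ => S) x :=
  fun w hw => ⟨fun _ => w, vecRegularAt_const w x, rfl, .of_forall fun _ => hw⟩

theorem liftsAt_sub {k : ℕ} (W : grassmannian k V) : (grassmannian k V).LiftsAt sub W := by
  intro w hw
  obtain ⟨C, hC⟩ := (sub W).exists_isCompl
  refine ⟨fun W' => projAlong C (sub W') w,
    (vecRegularAt_projAlong hC).apply (vecRegularAt_const w W), projAlong_of_mem hC hw,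
    .of_forall fun W' => projAlong_apply_mem w⟩

theorem MorphismAt.liftsAt {k : ℕ} {φ : X → grassmannian k V} {x : X}
    (h : MorphismAt X (grassmannian k V) φ x) : X.LiftsAt (fun x => sub (φ x)) x :=
  (liftsAt_sub (φ x)).comp h

/-- Lift a basis of the subspace at `x` to regular sections. They remain independent nearby and, the
dimension being constant, they span the whole subspace there; so the map factors locally through the
variety of frames. -/
theorem LiftsAt.morphismAt {k : ℕ} {φ : X → grassmannian k V} {x : X}
    (h : X.LiftsAt (fun x => sub (φ x)) x) : MorphismAt X (grassmannian k V) φ x := by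
  classical
  obtain ⟨⟨A, hA⟩, hAx⟩ := spanFrame_surjective (φ x)
  have hA' : LinearIndependent ℂ (A : Fin k → V) := hA
  have hAs : Submodule.span ℂ (Set.range (A : Fin k → V)) = sub (φ x) := by
    rw [← hAx]; rfl
  choose! f hf hfx hfS using h
  have hmem : ∀ i, (A : Fin k → V) i ∈ sub (φ x) := fun i => by
    rw [← hAs]; exact Submodule.subset_span ⟨i, rfl⟩
  let g : X → Fin k → V := fun y i => f (A i) y
  have hg : X.VecRegularAt g x := vecRegularAt_pi fun i => hf _ (hmem i)
  have hgx : g x = A := funext fun i => hfx _ (hmem i)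
  have hli := hg.eventually_linearIndependent (by rwa [hgx])
  -- The value away from the neighbourhood where `g y` is independent plays no role.
  let G : X → frames k V := fun y => if h : LinearIndependent ℂ (g y) then ⟨g y, h⟩ else ⟨A, hA⟩
  have hGx : ∀ y, LinearIndependent ℂ (g y) → (G y).1 = g y := fun y hy => by
    change (if h : LinearIndependent ℂ (g y) then (⟨g y, h⟩ : frames k V) else ⟨A, hA⟩).1 = g y
    rw [dif_pos hy]
  have hG : MorphismAt X (frames k V) G x := by
    refine morphismAt_restrict (hg.morphismAt.congr ?_)
    filter_upwards [hli] with y hy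
    exact (hGx y hy).symm
  refine ((morphismAt_spanFrame (G x)).comp hG).congr ?_
  have hall : ∀ᶠ y in 𝓝 x, ∀ i, g y i ∈ sub (φ y) := by
    rw [eventually_all]
    exact fun i => hfS _ (hmem i)
  filter_upwards [hli, hall] with y hy hy'
  apply grassmannian_ext
  rw [sub_spanFrame, hGx y hy]
  refine Submodule.eq_of_le_of_finrank_eq (Submodule.span_le.2 ?_) ?_
  · rintro _ ⟨i, rfl⟩
    exact hy' i
  · rw [finrank_span_eq_card hy, finrank_sub, Fintype.card_fin]

theorem LiftsAt.sup {S T : X → Submodule ℂ V} {x : X} (hS : X.LiftsAt S x) (hT : X.LiftsAt T x) :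
    X.LiftsAt (fun x => S x ⊔ T x) x := by
  intro w hw
  obtain ⟨a, ha, b, hb, rfl⟩ := Submodule.mem_sup.1 hw
  obtain ⟨f, hf, rfl, hfS⟩ := hS a ha
  obtain ⟨g, hg, rfl, hgT⟩ := hT b hb
  refine ⟨_, hf.add hg, rfl, ?_⟩
  filter_upwards [hfS, hgT] with y h1 h2
  exact Submodule.add_mem_sup h1 h2

theorem LiftsAt.map {V' : Type*} [AddCommGroup V'] [Module ℂ V'] [FiniteDimensional ℂ V']
    {S : X → Submodule ℂ V} {T : X → V →ₗ[ℂ] V'} {x : X} (hS : X.LiftsAt S x)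
    (hT : X.VecRegularAt T x) : X.LiftsAt (fun x => (S x).map (T x)) x := by
  rintro _ ⟨a, ha, rfl⟩
  obtain ⟨f, hf, rfl, hfS⟩ := hS a ha
  exact ⟨fun y => T y (f y), hT.apply hf, rfl, hfS.mono fun y hy => ⟨_, hy, rfl⟩⟩

end grassmannian

/-! ### Semicontinuity -/

section semicontinuity

variable {X : SpaceWithFunctions.{u}} {V : Type v} [AddCommGroup V] [Module ℂ V]
  [FiniteDimensional ℂ V]

theorem VecRegularAt.eventually_ne {E : Type*} [AddCommGroup E] [Module ℂ E] {f : X → E} {x : X}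
    (hf : X.VecRegularAt f x) (hx : f x ≠ 0) : ∀ᶠ y in 𝓝 x, f y ≠ 0 := by
  obtain ⟨l, hl⟩ : ∃ l : E →ₗ[ℂ] ℂ, l (f x) ≠ 0 := by
    by_contra! h
    exact hx ((Module.forall_dual_apply_eq_zero_iff ℂ _).1 h)
  filter_upwards [(hf l).eventually_ne hl] with y hy h
  exact hy (by simp [h])

theorem isClosed_eq_of_vecRegularAt {E : Type*} [AddCommGroup E] [Module ℂ E] {f g : X → E}
    (hf : ∀ x, X.VecRegularAt f x) (hg : ∀ x, X.VecRegularAt g x) : IsClosed {x | f x = g x} := by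
  rw [← isOpen_compl_iff, isOpen_iff_eventually]
  intro x hx
  filter_upwards [((hf x).sub (hg x)).eventually_ne (sub_ne_zero.2 hx)] with y hy
  exact sub_ne_zero.1 hy

/-- The dimension of a liftable family of subspaces is lower semicontinuous. -/
theorem LiftsAt.finrank_le {S : X → Submodule ℂ V} {x : X} (hS : X.LiftsAt S x) :
    ∀ᶠ y in 𝓝 x, Module.finrank ℂ (S x) ≤ Module.finrank ℂ (S y) := by
  let b := Module.finBasis ℂ (S x)
  have hb : LinearIndependent ℂ (fun i => (b i : V)) :=
    b.linearIndependent.map' (S x).subtype (S x).ker_subtype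
  choose f hf hfx hfS using fun i => hS (b i) (b i).2
  have hg : X.VecRegularAt (fun y i => f i y) x := vecRegularAt_pi hf
  have hli := hg.eventually_linearIndependent (by simpa only [hfx] using hb)
  filter_upwards [hli, eventually_all.2 hfS] with y hy hy'
  have h2 : LinearIndependent ℂ (fun i => (⟨f i y, hy' i⟩ : S y)) :=
    LinearIndependent.of_comp (S y).subtype hy
  simpa using h2.fintype_card_le_finrank

/-- Extend a vector of `S x` outside the second subspace to a section f. Near `x`, membership in the
second subspace means that f is fixed by the projection onto it, and f minus its projection is a
regular vector that is non-zero at `x`. -/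
theorem LiftsAt.eventually_not_le {k : ℕ} {S : X → Submodule ℂ V} {ψ : X → grassmannian k V}
    {x : X} (hS : X.LiftsAt S x) (hψ : MorphismAt X (grassmannian k V) ψ x)
    (h : ¬ S x ≤ sub (ψ x)) : ∀ᶠ y in 𝓝 x, ¬ S y ≤ sub (ψ y) := by
  obtain ⟨w, hw, hw'⟩ := SetLike.not_le_iff_exists.1 h
  obtain ⟨f, hf, rfl, hfS⟩ := hS w hw
  obtain ⟨C, hC⟩ := (sub (ψ x)).exists_isCompl
  have hP := (vecRegularAt_projAlong hC).comp hψ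
  have hne := (hf.sub (hP.apply hf)).eventually_ne (fun h0 => hw' (by
    rw [sub_eq_zero.1 h0]; exact projAlong_apply_mem _))
  filter_upwards [hne, hψ.eventually ((isOpen_isCompl C).mem_nhds hC), hfS] with y h1 h2 h3 h4
  exact h1 (sub_eq_zero.2 (projAlong_of_mem h2 (h4 h3)).symm)

theorem LiftsAt.eventually_not_le_const {S : X → Submodule ℂ V} {x : X} (hS : X.LiftsAt S x)
    {F : Submodule ℂ V} (h : ¬ S x ≤ F) : ∀ᶠ y in 𝓝 x, ¬ S y ≤ F :=
  hS.eventually_not_le (ψ := fun _ => (⟨F, rfl⟩ : grassmannian (Module.finrank ℂ F) V))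
    (morphismAt_const _ x) h

theorem finrank_ker_inf_add_finrank_map {V' : Type*} [AddCommGroup V'] [Module ℂ V']
    (f : V →ₗ[ℂ] V') (W : Submodule ℂ V) :
    Module.finrank ℂ ↥(LinearMap.ker f ⊓ W) + Module.finrank ℂ (W.map f) = Module.finrank ℂ W := by
  have h := LinearMap.finrank_range_add_finrank_ker (f.domRestrict W)
  have h1 : LinearMap.range (f.domRestrict W) = W.map f := by
    ext; simp
  have h2 : (LinearMap.ker (f.domRestrict W)).map W.subtype = LinearMap.ker f ⊓ W := by
    ext v
    simp [and_comm, LinearMap.domRestrict_apply]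
  rw [h1, ← Submodule.finrank_map_subtype_eq, h2] at h
  omega

/-- The dimension of the intersection with a fixed subspace is upper semicontinuous. -/
theorem MorphismAt.finrank_inf_le {k : ℕ} {ψ : X → grassmannian k V} {x : X}
    (hψ : MorphismAt X (grassmannian k V) ψ x) (F : Submodule ℂ V) : ∀ᶠ y in 𝓝 x,
      Module.finrank ℂ ↥(F ⊓ sub (ψ y)) ≤ Module.finrank ℂ ↥(F ⊓ sub (ψ x)) := by
  -- The image in `V ⧸ F` is again a liftable family, so its dimension cannot drop nearby; by
  -- rank–nullity the dimension of the intersection cannot grow.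
  have h := (hψ.liftsAt.map (vecRegularAt_const F.mkQ x)).finrank_le
  filter_upwards [h] with y hy
  have h1 := finrank_ker_inf_add_finrank_map F.mkQ (sub (ψ x))
  have h2 := finrank_ker_inf_add_finrank_map F.mkQ (sub (ψ y))
  rw [finrank_sub, Submodule.ker_mkQ] at h1 h2
  omega

end semicontinuity

/-! ### Affine charts of products of Grassmannians -/

/-- A closed part of an open subset which is a retract of an affine space is affine. -/
theorem isAffine_of_retract {X : SpaceWithFunctions.{u}} {E : Type v} [AddCommGroup E] [Module ℂ E]
    [FiniteDimensional ℂ E] {S U : Set X} (hS : IsClosed S) {e : X → E}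
    (he : ∀ x ∈ U, X.VecRegularAt e x) {r : affine E → X} (hr : IsMorphism r)
    (hrU : ∀ v, r v ∈ U) (hre : ∀ x ∈ U, r (e x) = x) :
    ((X.restrict S).restrict {z | z.1 ∈ U}).IsAffine := by
  let ε : E ≃ₗ[ℂ] (Fin (Module.finrank ℂ E) → ℂ) := (Module.finBasis ℂ E).equivFun
  let A := affine (Fin (Module.finrank ℂ E) → ℂ)
  obtain ⟨δ, hδ⟩ : ∃ δ : A → E, ∀ v, δ v = ε.symm v := ⟨_, fun _ => rfl⟩
  have hεδ : ∀ v : A, ε (δ v) = v := fun v => by rw [hδ]; exact ε.apply_symm_apply v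
  have hδε : ∀ v : E, δ (ε v) = v := fun v => (hδ (ε v)).trans (ε.symm_apply_apply v)
  have hδr : ∀ v : A, A.VecRegularAt δ v := fun v =>
    ((vecRegularAt_affine v).map ε.symm.toLinearMap).congr (.of_forall fun v => (hδ v).symm)
  obtain ⟨ρ, hρ⟩ : ∃ ρ : A → X, ∀ v, ρ v = r (δ v) := ⟨_, fun _ => rfl⟩
  have hρr : ∀ v : A, MorphismAt A X ρ v := fun v =>
    ((isMorphism_iff.1 hr _).comp (hδr v).morphismAt).congr (.of_forall fun v => (hρ v).symm)
  have hρU : ∀ v, ρ v ∈ U := fun v => by rw [hρ]; exact hrU _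
  -- The affine model: the fixed points of the idempotent e ∘ r of `E`, which form the image of `U`,
  -- cut down to the part lying over `S`.
  let T : Set A := {v | e (ρ v) = δ v} ∩ ρ ⁻¹' S
  have hT : IsClosed T := by
    refine IsClosed.inter ?_ (hS.preimage (isMorphism_iff.2 hρr).1)
    exact isClosed_eq_of_vecRegularAt (fun v => (he _ (hρU v)).comp (hρr v)) hδr
  have hρε : ∀ x ∈ U, ρ (ε (e x)) = x := fun x hx =>
    (hρ (ε (e x))).trans ((congrArg r (hδε (e x))).trans (hre x hx))
  refine ⟨_, T, hT, fun z => ⟨ε (e z.1.1), by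
    constructor
    · change e (ρ (ε (e z.1.1))) = δ (ε (e z.1.1))
      exact (congrArg e (hρε _ z.2)).trans (hδε _).symm
    · change ρ (ε (e z.1.1)) ∈ S
      exact (hρε _ z.2).symm ▸ z.1.2⟩, ?_, ?_⟩
  · refine isMorphism_iff.2 fun z => morphismAt_restrict (VecRegularAt.morphismAt ?_)
    exact ((he _ z.2).comp (φ := fun z : (X.restrict S).restrict {z | z.1 ∈ U} => z.1.1)
      ((morphismAt_val _).comp (morphismAt_val _))).map ε.toLinearMap
  · refine ⟨fun v => ⟨⟨ρ v.1, v.2.2⟩, hρU _⟩, ?_, fun z => ?_, fun v => ?_⟩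
    · refine isMorphism_iff.2 fun v => morphismAt_restrict (morphismAt_restrict ?_)
      exact (hρr _).comp (morphismAt_val v)
    · exact Subtype.ext (Subtype.ext (hρε _ z.2))
    · exact Subtype.ext ((congrArg ε v.2.1).trans (hεδ _))

section pi

variable {V : Type u} [AddCommGroup V] [Module ℂ V] [FiniteDimensional ℂ V]

/-- The graph over `W` of the part `W → C` of an endomorphism. -/
noncomputable def graphAut (C W : Submodule ℂ V) (φ : Module.End ℂ V) : Module.End ℂ V :=
  1 + (1 - projAlong C W) * φ * projAlong C W

theorem graphAut_of_mem {C W : Submodule ℂ V} (h : IsCompl W C) (φ : Module.End ℂ V) {w : V}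
    (hw : w ∈ W) : graphAut C W φ w = w + (φ w - projAlong C W (φ w)) := by
  simp [graphAut, projAlong_of_mem h hw]

theorem sub_projAlong_mem {C W : Submodule ℂ V} (h : IsCompl W C) (v : V) :
    v - projAlong C W v ∈ C := by
  simp only [projAlong, h, dif_pos]
  exact Submodule.sub_projection_mem h v

theorem isCompl_map_graphAut {C W : Submodule ℂ V} (h : IsCompl W C) (φ : Module.End ℂ V) :
    IsCompl (W.map (graphAut C W φ)) C := by
  constructor
  · rw [Submodule.disjoint_def]
    rintro _ ⟨w, hw, rfl⟩ hc
    rw [graphAut_of_mem h φ hw] at hc ⊢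
    have h1 : w ∈ C := (C.add_mem_iff_left (sub_projAlong_mem h _)).1 hc
    have h2 : w = 0 := Submodule.disjoint_def.1 h.disjoint w hw h1
    simp [h2]
  · rw [codisjoint_iff, eq_top_iff, ← h.sup_eq_top]
    refine sup_le (fun w hw => ?_) le_sup_right
    refine Submodule.mem_sup.2 ⟨_, ⟨w, hw, rfl⟩, w - graphAut C W φ w, ?_, by abel⟩
    rw [graphAut_of_mem h φ hw, sub_add_cancel_left]
    exact C.neg_mem (sub_projAlong_mem h _)

theorem finrank_map_graphAut {C W : Submodule ℂ V} (h : IsCompl W C) (φ : Module.End ℂ V) :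
    Module.finrank ℂ (W.map (graphAut C W φ)) = Module.finrank ℂ W := by
  have h1 := Submodule.finrank_add_eq_of_isCompl h
  have h2 := Submodule.finrank_add_eq_of_isCompl (isCompl_map_graphAut h φ)
  omega

/-- For w in W the difference of w and its projection P'w to W' lies in C, so P'w projects back to w
in W. Hence the graph map with this parameter is w ↦ P'w on W. -/
theorem map_graphAut_projAlong {C W W' : Submodule ℂ V} (h : IsCompl W C) (h' : IsCompl W' C) :
    W.map (graphAut C W (projAlong C W' - projAlong C W)) = W' := by
  refine Submodule.eq_of_le_of_finrank_eq ?_ ?_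
  · rintro _ ⟨w, hw, rfl⟩
    have h1 : projAlong C W (w - projAlong C W' w) = 0 :=
      projAlong_of_mem_right (sub_projAlong_mem h' w)
    rw [map_sub, projAlong_of_mem h hw, sub_eq_zero] at h1
    rw [graphAut_of_mem h _ hw]
    simp only [LinearMap.sub_apply, map_sub, projAlong_of_mem h hw, ← h1, sub_self, sub_zero,
      add_sub_cancel]
    exact projAlong_apply_mem w
  · rw [finrank_map_graphAut h]
    have h1 := Submodule.finrank_add_eq_of_isCompl h
    have h2 := Submodule.finrank_add_eq_of_isCompl h'
    omega

/-- The chart of the Grassmannian around `W`, consisting of the complements of `C`. -/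
noncomputable def chart {k : ℕ} (C : Submodule ℂ V) (W : grassmannian k V)
    (h : IsCompl (sub W) C) (φ : Module.End ℂ V) : grassmannian k V :=
  ⟨(sub W).map (graphAut C (sub W) φ), (finrank_map_graphAut h φ).trans (finrank_sub W)⟩

theorem vecRegularAt_graphAut (C W : Submodule ℂ V) (φ : affine (Module.End ℂ V)) :
    (affine (Module.End ℂ V)).VecRegularAt (E := Module.End ℂ V)
      (fun φ => graphAut C W φ) φ := by
  have h1 : (affine (Module.End ℂ V)).VecRegularAt (E := Module.End ℂ V) (fun φ => φ) φ :=
    vecRegularAt_affine φ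
  exact (vecRegularAt_const _ φ).add (((vecRegularAt_const (1 - projAlong C W) φ).linearMap_comp
    h1).linearMap_comp (vecRegularAt_const (projAlong C W) φ))

theorem isMorphism_chart {k : ℕ} (C : Submodule ℂ V) (W : grassmannian k V)
    (h : IsCompl (sub W) C) :
    IsMorphism (X := affine (Module.End ℂ V)) (Y := grassmannian k V) (chart C W h) :=
  isMorphism_iff.2 fun φ => LiftsAt.morphismAt
    ((liftsAt_const (sub W) φ).map (vecRegularAt_graphAut C (sub W) φ))

/-- Choose basis vectors whose classes form a basis of `V ⧸ W`. Since only finitely many complements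
arise in this way, finitely many charts cover a Grassmannian. -/
theorem exists_isCompl_span_image {n : ℕ} (b : Module.Basis (Fin n) ℂ V) (W : Submodule ℂ V) :
    ∃ s : Finset (Fin n), IsCompl W (Submodule.span ℂ (b '' s)) := by
  classical
  obtain ⟨κ, a, ha, hspan, hli⟩ := exists_linearIndependent' ℂ (W.mkQ ∘ b)
  have : Finite κ := Finite.of_injective a ha
  cases nonempty_fintype κ
  refine ⟨Finset.univ.image a, ?_⟩
  have himg : b '' ((Finset.univ.image a : Finset (Fin n)) : Set (Fin n)) = Set.range (b ∘ a) := by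
    rw [Finset.coe_image, Finset.coe_univ, Set.image_univ, ← Set.range_comp]
  rw [himg]
  constructor
  · rw [Submodule.disjoint_def]
    intro w hw hw'
    obtain ⟨c, rfl⟩ := (Submodule.mem_span_range_iff_exists_fun ℂ).1 hw'
    have h1 : ∑ i, c i • (W.mkQ ∘ b ∘ a) i = 0 := by
      rw [← (Submodule.Quotient.mk_eq_zero W).2 hw, ← Submodule.mkQ_apply, map_sum]
      simp
    have h2 := Fintype.linearIndependent_iff.1 hli c h1
    simp [h2]
  · rw [codisjoint_iff, ← Submodule.map_mkQ_eq_top, Submodule.map_span, ← Set.range_comp]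
    change Submodule.span ℂ (Set.range ((W.mkQ ∘ b) ∘ a)) = ⊤
    rw [hspan, Set.range_comp, ← Submodule.map_span, b.span_eq, Submodule.map_top,
      Submodule.range_mkQ]

variable {ι : Type} [Finite ι] {d : ι → ℕ}

/-- Subspaces of equal dimension that differ are not contained in one another, and non-containment
is an open condition. -/
theorem isClosed_diagonal_grassmannians {S : Set (pi fun i => grassmannian (d i) V)} :
    IsClosed (X := ((pi fun i => grassmannian (d i) V).restrict S).prod
      ((pi fun i => grassmannian (d i) V).restrict S)) (Set.range fun x => (x, x)) := by
  rw [← isOpen_compl_iff, isOpen_iff_eventually]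
  rintro ⟨W, W'⟩ hne
  have hev : ∀ (i : ι) p, MorphismAt (((pi fun i => grassmannian (d i) V).restrict S).prod
      ((pi fun i => grassmannian (d i) V).restrict S)) (grassmannian (d i) V)
      (fun p => p.1.1 i) p := fun i p =>
    (morphismAt_eval i _).comp ((morphismAt_val _).comp (morphismAt_fst p))
  have hev' : ∀ (i : ι) p, MorphismAt (((pi fun i => grassmannian (d i) V).restrict S).prod
      ((pi fun i => grassmannian (d i) V).restrict S)) (grassmannian (d i) V)
      (fun p => p.2.1 i) p := fun i p =>
    (morphismAt_eval i _).comp ((morphismAt_val _).comp (morphismAt_snd p))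
  obtain ⟨i, hi⟩ : ∃ i, ¬ sub (W.1 i) ≤ sub (W'.1 i) := by
    by_contra! h
    refine hne ⟨W, Prod.ext rfl (Subtype.ext (funext fun i => grassmannian_ext ?_))⟩
    exact Submodule.eq_of_le_of_finrank_eq (h i) (by rw [finrank_sub, finrank_sub])
  filter_upwards [(hev i (W, W')).liftsAt.eventually_not_le (hev' i (W, W')) hi] with p hp
  rintro ⟨x, rfl⟩
  exact hp le_rfl

/-- Closed subsets of products of Grassmannians are varieties. -/
theorem isVariety_restrict_grassmannians {S : Set (pi fun i => grassmannian (d i) V)}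
    (hS : IsClosed S) : ((pi fun i => grassmannian (d i) V).restrict S).IsVariety := by
  classical
  refine ⟨?_, isClosed_diagonal_grassmannians⟩
  cases nonempty_fintype ι
  let b := Module.finBasis ℂ V
  let C : (ι → Finset (Fin (Module.finrank ℂ V))) → ι → Submodule ℂ V :=
    fun s i => Submodule.span ℂ (b '' s i)
  -- Only the families of complements with a non-empty chart are kept, since each chart is a graph
  -- construction over a centre `W₀`.
  let J := {s : ι → Finset (Fin (Module.finrank ℂ V)) //
    ∀ i, ∃ W : grassmannian (d i) V, IsCompl (sub W) (C s i)}
  let U : J → Set (pi fun i => grassmannian (d i) V) := fun s =>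
    {W | ∀ i, IsCompl (sub (W i)) (C s.1 i)}
  have hU : ∀ s, IsOpen (U s) := fun s => by
    have : U s = ⋂ i, (fun W : pi fun i => grassmannian (d i) V => W i) ⁻¹'
        {W | IsCompl (sub W) (C s.1 i)} := by
      ext; simp [U]
    rw [this]
    exact isOpen_iInter_of_finite fun i => (isOpen_isCompl _).preimage
      (isMorphism_iff.2 (morphismAt_eval i)).1
  let ε := Fintype.equivFin J
  refine ⟨Fintype.card J, fun j => {z | z.1 ∈ U (ε.symm j)}, fun j => ⟨isOpen_restrict (hU _), ?_⟩,
    ?_⟩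
  · change (((pi fun i => grassmannian (d i) V).restrict S).restrict
      {z | z.1 ∈ U (ε.symm j)}).IsAffine
    generalize ε.symm j = s
    choose W₀ hW₀ using s.2
    refine isAffine_of_retract (E := ι → Module.End ℂ V) (U := U s) hS
      (e := fun W i => projAlong (C s.1 i) (sub (W i)) - projAlong (C s.1 i) (sub (W₀ i)))
      (fun W hW => vecRegularAt_pi fun i => ?_)
      (r := fun φ i => chart (C s.1 i) (W₀ i) (hW₀ i) (φ i)) ?_ ?_ ?_
    · exact ((vecRegularAt_projAlong (hW i)).comp (morphismAt_eval i W)).sub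
        (vecRegularAt_const _ W)
    · refine isMorphism_iff.2 fun φ => morphismAt_pi fun i => ?_
      have h1 : MorphismAt (affine (ι → Module.End ℂ V)) (affine (Module.End ℂ V))
          (fun φ => φ i) φ := VecRegularAt.morphismAt
        ((vecRegularAt_affine (E := ι → Module.End ℂ V) φ).map (LinearMap.proj i))
      exact (isMorphism_iff.1 (isMorphism_chart _ _ (hW₀ i)) _).comp h1
    · exact fun φ i => isCompl_map_graphAut (hW₀ i) _
    · intro W hW
      funext i
      exact grassmannian_ext (map_graphAut_projAlong (hW₀ i) (hW i))
  · refine Set.eq_univ_of_forall fun W => Set.mem_iUnion.2 ?_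
    choose s hs using fun i => exists_isCompl_span_image b (sub (W.1 i))
    refine ⟨ε ⟨s, fun i => ⟨W.1 i, hs i⟩⟩, ?_⟩
    change W.1 ∈ U (ε.symm (ε _))
    rw [ε.symm_apply_apply]
    exact hs

end pi

/-! ### Polynomial functions and the local rings of affine spaces -/

section polynomial

variable {E : Type u} [AddCommGroup E] [Module ℂ E]

/-- The substitution `T` is the identity in the study of local rings of affine space, and the map
from vectors to one-element families in the study of projective space. -/
theorem exists_mvPolynomial_of_mem_adjoin {f : E → ℂ}
    (hf : f ∈ Algebra.adjoin ℂ {f : E → ℂ | ∃ l : E →ₗ[ℂ] ℂ, f = fun v => l v}) {m : ℕ}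
    (T : (Fin m → ℂ) →ₗ[ℂ] E) :
    ∃ P : MvPolynomial (Fin m) ℂ, ∀ x, f (T x) = MvPolynomial.eval x P := by
  classical
  induction hf using Algebra.adjoin_induction with
  | mem f hf =>
    obtain ⟨l, rfl⟩ := hf
    refine ⟨∑ i, MvPolynomial.C (l (T (Pi.single i 1))) * MvPolynomial.X i, fun x => ?_⟩
    conv_lhs => rw [← Finset.univ_sum_single x]
    simp only [map_sum, map_mul, MvPolynomial.eval_C, MvPolynomial.eval_X]
    refine Finset.sum_congr rfl fun i _ => ?_
    have : (Pi.single i (x i) : Fin m → ℂ) = x i • Pi.single i 1 := by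
      rw [← Pi.single_smul]; simp
    rw [this, map_smul, map_smul, smul_eq_mul, mul_comm]
  | algebraMap r => exact ⟨.C r, fun x => by simp⟩
  | add f g _ _ hf hg =>
    obtain ⟨P, hP⟩ := hf
    obtain ⟨Q, hQ⟩ := hg
    exact ⟨P + Q, fun x => by simp [hP, hQ]⟩
  | mul f g _ _ hf hg =>
    obtain ⟨P, hP⟩ := hf
    obtain ⟨Q, hQ⟩ := hg
    exact ⟨P * Q, fun x => by simp [hP, hQ]⟩

theorem eval_mem_adjoin {m : ℕ} (P : MvPolynomial (Fin m) ℂ) :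
    (fun x => MvPolynomial.eval x P) ∈ Algebra.adjoin ℂ
      {f : (Fin m → ℂ) → ℂ | ∃ l : (Fin m → ℂ) →ₗ[ℂ] ℂ, f = fun v => l v} := by
  induction P using MvPolynomial.induction_on with
  | C a =>
    simp only [MvPolynomial.eval_C]
    exact Subalgebra.algebraMap_mem (Algebra.adjoin ℂ
      {f : (Fin m → ℂ) → ℂ | ∃ l : (Fin m → ℂ) →ₗ[ℂ] ℂ, f = fun v => l v}) a
  | add P Q hP hQ => simpa using! add_mem hP hQ
  | mul_X P i hP =>
    have : (fun x : Fin m → ℂ => x i) ∈ Algebra.adjoin ℂ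
        {f : (Fin m → ℂ) → ℂ | ∃ l : (Fin m → ℂ) →ₗ[ℂ] ℂ, f = fun v => l v} :=
      Algebra.subset_adjoin ⟨LinearMap.proj i, rfl⟩
    simpa using! mul_mem hP this

theorem regularAt_eval {m : ℕ} (P : MvPolynomial (Fin m) ℂ) (a : affine (Fin m → ℂ)) :
    (affine (Fin m → ℂ)).RegularAt (fun x => MvPolynomial.eval x P) a :=
  regularAt_generate_of_mem_adjoin (eval_mem_adjoin P)

/-- The germ of a polynomial function. -/
noncomputable def evalGerm {m : ℕ} (a : affine (Fin m → ℂ)) :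
    MvPolynomial (Fin m) ℂ →+* (affine (Fin m → ℂ)).stalk a where
  toFun P := ⟨((fun x => MvPolynomial.eval x P : affine (Fin m → ℂ) → ℂ) : (𝓝 a).Germ ℂ),
    regularAt_eval P a⟩
  map_one' := by ext; simp; rfl
  map_zero' := by ext; simp; rfl
  map_add' P Q := by ext; simp; rfl
  map_mul' P Q := by ext; simp; rfl

/-- The stalk is the localization of the polynomial ring at the ideal of the point. Polynomials P, Q
with equal germs agree on some locus R ≠ 0 with R(a) ≠ 0, so RP = RQ at all points and hence, ℂ
being infinite, as polynomials. -/
theorem isRegularLocalRing_stalk_affine {m : ℕ} (a : affine (Fin m → ℂ)) :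
    IsRegularLocalRing ((affine (Fin m → ℂ)).stalk a) := by
  let p : Ideal (MvPolynomial (Fin m) ℂ) := RingHom.ker (MvPolynomial.eval a)
  have hp : p.IsPrime := RingHom.ker_isPrime _
  let _ : Algebra (MvPolynomial (Fin m) ℂ) ((affine (Fin m → ℂ)).stalk a) := (evalGerm a).toAlgebra
  have hmem : ∀ P, P ∈ p.primeCompl ↔ MvPolynomial.eval a P ≠ 0 := fun P => Iff.rfl
  have hpoly : ∀ f ∈ Algebra.adjoin ℂ
      {f : (Fin m → ℂ) → ℂ | ∃ l : (Fin m → ℂ) →ₗ[ℂ] ℂ, f = fun v => l v},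
      ∃ P : MvPolynomial (Fin m) ℂ, f = fun x => MvPolynomial.eval x P := fun f hf => by
    obtain ⟨P, hP⟩ := exists_mvPolynomial_of_mem_adjoin hf .id
    exact ⟨P, funext hP⟩
  have hunit : ∀ P : MvPolynomial (Fin m) ℂ, MvPolynomial.eval a P ≠ 0 →
      IsUnit (evalGerm a P) := fun P hP => by
    obtain ⟨h1, h2⟩ := (affine (Fin m → ℂ)).inv_mem a _ (regularAt_eval P a) hP
    refine isUnit_iff_exists_inv.2 ⟨⟨_, h2⟩, Subtype.ext (Germ.coe_eq.2 ?_)⟩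
    filter_upwards [h1] with x hx
    exact mul_inv_cancel₀ hx
  have hloc : IsLocalization.AtPrime ((affine (Fin m → ℂ)).stalk a) p := by
    refine ⟨?_, ?_, ?_⟩
    · rintro ⟨P, hP⟩
      exact hunit P hP
    · rintro ⟨γ, f, hf, g, hg, hga, rfl⟩
      obtain ⟨P, rfl⟩ := hpoly f hf
      obtain ⟨Q, rfl⟩ := hpoly g hg
      refine ⟨⟨P, ⟨Q, hga⟩⟩, Subtype.ext (Germ.coe_eq.2 ?_)⟩
      filter_upwards [(regularAt_eval Q a).eventually_ne hga] with x hx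
      exact div_mul_cancel₀ _ hx
    · intro P Q hPQ
      obtain ⟨t, hts, ht, hat⟩ := mem_nhds_iff.1 (Germ.coe_eq.1 (Subtype.ext_iff.1 hPQ))
      obtain ⟨e, he, hea, het⟩ := ht a hat
      obtain ⟨R, rfl⟩ := hpoly e he
      refine ⟨⟨R, hea⟩, MvPolynomial.funext fun x => ?_⟩
      by_cases hx : MvPolynomial.eval x R = 0
      · simp [hx]
      · have : MvPolynomial.eval x P = MvPolynomial.eval x Q := hts (het x hx)
        simp [this]
  exact IsRegularLocalRing.of_ringEquiv
    (IsLocalization.algEquiv p.primeCompl (Localization.AtPrime p)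
      ((affine (Fin m → ℂ)).stalk a)).toRingEquiv

/-- A polynomial function is polynomial along each line. -/
theorem exists_polynomial_of_mem_adjoin {f : E → ℂ}
    (hf : f ∈ Algebra.adjoin ℂ {f : E → ℂ | ∃ l : E →ₗ[ℂ] ℂ, f = fun v => l v}) (x y : E) :
    ∃ P : Polynomial ℂ, ∀ t, f (x + t • y) = P.eval t := by
  induction hf using Algebra.adjoin_induction with
  | mem f hf =>
    obtain ⟨l, rfl⟩ := hf
    exact ⟨.C (l x) + .C (l y) * .X, fun t => by
      simp only [map_add, map_smul, smul_eq_mul, Polynomial.eval_add, Polynomial.eval_mul,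
        Polynomial.eval_C, Polynomial.eval_X]
      ring⟩
  | algebraMap r => exact ⟨.C r, fun x => by simp⟩
  | add f g _ _ hf hg =>
    obtain ⟨P, hP⟩ := hf
    obtain ⟨Q, hQ⟩ := hg
    exact ⟨P + Q, fun x => by simp [hP, hQ]⟩
  | mul f g _ _ hf hg =>
    obtain ⟨P, hP⟩ := hf
    obtain ⟨Q, hQ⟩ := hg
    exact ⟨P * Q, fun x => by simp [hP, hQ]⟩

/-- On the line joining a point of each open set, the two functions cutting out basic neighbourhoods
become non-zero polynomials in one variable, whose product does not vanish identically. -/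
theorem preirreducibleSpace_affine : PreirreducibleSpace (affine E) := by
  constructor
  rintro U₁ U₂ hU₁ hU₂ ⟨(x : E), -, hx⟩ ⟨(y : E), -, hy⟩
  obtain ⟨f, hf, hfx, hfU⟩ := hU₁ x hx
  obtain ⟨g, hg, hgy, hgU⟩ := hU₂ y hy
  obtain ⟨P, hP⟩ := exists_polynomial_of_mem_adjoin hf x (y - x)
  obtain ⟨Q, hQ⟩ := exists_polynomial_of_mem_adjoin hg x (y - x)
  have hP0 : P ≠ 0 := fun h => hfx (by have := hP 0; rw [zero_smul, add_zero] at this; simp [this, h])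
  have hQ0 : Q ≠ 0 := fun h => hgy (by
    have := hQ 1
    rw [one_smul, add_sub_cancel] at this
    simp [this, h])
  obtain ⟨t, ht⟩ : ∃ t, (P * Q).eval t ≠ 0 := by
    by_contra! h
    exact mul_ne_zero hP0 hQ0 (Polynomial.funext (by simpa using h))
  rw [Polynomial.eval_mul] at ht
  refine ⟨x + t • (y - x), trivial, hfU _ ?_, hgU _ ?_⟩
  · rw [hP]; exact left_ne_zero_of_mul ht
  · rw [hQ]; exact right_ne_zero_of_mul ht

/-- The Grassmannian is the image of the frames, which form an open subset of an irreducible affine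
space. -/
theorem preirreducibleSpace_grassmannian [FiniteDimensional ℂ E] {k : ℕ} :
    PreirreducibleSpace (grassmannian k E) := by
  have := preirreducibleSpace_affine (E := Fin k → E)
  constructor
  rintro U₁ U₂ hU₁ hU₂ ⟨x, -, hx⟩ ⟨y, -, hy⟩
  obtain ⟨A, rfl⟩ := spanFrame_surjective x
  obtain ⟨B, rfl⟩ := spanFrame_surjective y
  have hopen : IsOpen {A : affine (Fin k → E) | LinearIndependent ℂ (A : Fin k → E)} := by
    rw [isOpen_iff_eventually]
    intro A hA
    exact (vecRegularAt_affine (E := Fin k → E) A).eventually_linearIndependent hA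
  have hpre := ((PreirreducibleSpace.isPreirreducible_univ (X := affine (Fin k → E))).open_subset
    hopen (Set.subset_univ _))
  have hpre' : IsPreirreducible (Set.univ : Set (frames k E)) := by
    have := (Subtype.preirreducibleSpace hpre)
    exact this.isPreirreducible_univ
  obtain ⟨C, -, h1, h2⟩ := hpre' _ _ (isOpen_grassmannian.1 hU₁) (isOpen_grassmannian.1 hU₂)
    ⟨A, trivial, hx⟩ ⟨B, trivial, hy⟩
  exact ⟨_, trivial, h1, h2⟩

end polynomial

/-! ### Local isomorphisms -/

/-- The germs of `X` at `x` and of `Y` at `y` are isomorphic. -/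
def LocallyIsomorphic (X : SpaceWithFunctions.{u}) (x : X) (Y : SpaceWithFunctions.{v}) (y : Y) :
    Prop :=
  ∃ (φ : X → Y) (ψ : Y → X), φ x = y ∧ ψ y = x ∧ MorphismAt X Y φ x ∧ MorphismAt Y X ψ y ∧
    (∀ᶠ z in 𝓝 x, ψ (φ z) = z) ∧ ∀ᶠ z in 𝓝 y, φ (ψ z) = z

section local_iso

variable {X : SpaceWithFunctions.{u}} {Y : SpaceWithFunctions.{v}} {Z : SpaceWithFunctions.{w}}

theorem LocallyIsomorphic.symm {x : X} {y : Y} (h : LocallyIsomorphic X x Y y) :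
    LocallyIsomorphic Y y X x := by
  obtain ⟨φ, ψ, h1, h2, h3, h4, h5, h6⟩ := h
  exact ⟨ψ, φ, h2, h1, h4, h3, h6, h5⟩

theorem LocallyIsomorphic.trans {x : X} {y : Y} {z : Z} (h : LocallyIsomorphic X x Y y)
    (h' : LocallyIsomorphic Y y Z z) : LocallyIsomorphic X x Z z := by
  obtain ⟨φ, ψ, rfl, h2, h3, h4, h5, h6⟩ := h
  obtain ⟨φ', ψ', rfl, h2', h3', h4', h5', h6'⟩ := h'
  refine ⟨fun x => φ' (φ x), fun z => ψ (ψ' z), rfl, (congrArg ψ h2').trans h2, h3'.comp h3,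
    MorphismAt.comp (φ := ψ') (by rwa [h2']) h4', ?_, ?_⟩
  · filter_upwards [h5, h3.eventually h5'] with z hz hz'
    rw [hz', hz]
  · rw [← h2'] at h6
    filter_upwards [h6', h4'.eventually h6] with z hz hz'
    rw [hz', hz]

theorem LocallyIsomorphic.prod {X' : SpaceWithFunctions.{u'}} {Y' : SpaceWithFunctions.{v'}}
    {x : X} {x' : X'} {y : Y} {y' : Y'} (h : LocallyIsomorphic X x X' x')
    (h' : LocallyIsomorphic Y y Y' y') :
    LocallyIsomorphic (X.prod Y) (x, y) (X'.prod Y') (x', y') := by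
  obtain ⟨φ, ψ, rfl, h2, h3, h4, h5, h6⟩ := h
  obtain ⟨φ', ψ', rfl, h2', h3', h4', h5', h6'⟩ := h'
  refine ⟨fun p => (φ p.1, φ' p.2), fun p => (ψ p.1, ψ' p.2), rfl, Prod.ext h2 h2',
    (h3.comp (morphismAt_fst (x, y))).prodMk (h3'.comp (morphismAt_snd (x, y))),
    (MorphismAt.comp (φ := fun p : X'.prod Y' => p.1) h4 (morphismAt_fst (φ x, φ' y))).prodMk
      (MorphismAt.comp (φ := fun p : X'.prod Y' => p.2) h4' (morphismAt_snd (φ x, φ' y))), ?_, ?_⟩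
  · filter_upwards [(morphismAt_fst (X := X) (Y := Y) (x, y)).eventually h5,
      (morphismAt_snd (X := X) (Y := Y) (x, y)).eventually h5'] with z hz hz'
    exact Prod.ext hz hz'
  · filter_upwards [(morphismAt_fst (X := X') (Y := Y') (φ x, φ' y)).eventually h6,
      (morphismAt_snd (X := X') (Y := Y') (φ x, φ' y)).eventually h6'] with z hz hz'
    exact Prod.ext hz hz'

theorem IsIsomorphism.locallyIsomorphic {e : X → Y} (he : IsIsomorphism e) (x : X) :
    LocallyIsomorphic X x Y (e x) := by
  obtain ⟨h1, ψ, h2, hl, hr⟩ := he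
  exact ⟨e, ψ, rfl, hl x, isMorphism_iff.1 h1 x, isMorphism_iff.1 h2 _, .of_forall hl,
    .of_forall hr⟩

/-- Local isomorphisms are recorded by globally defined maps; this extends the identity of `U` to
all of `X`, with the value `x` outside `U`. -/
theorem exists_lift_restrict {U : Set X} (hU : IsOpen U) (x : X.restrict U) :
    ∃ ψ : X → X.restrict U, MorphismAt X (X.restrict U) ψ x.1 ∧ (∀ z ∈ U, (ψ z).1 = z) ∧
      ∀ z : X.restrict U, ψ z.1 = z := by
  classical
  let ψ : X → X.restrict U := fun z => if h : z ∈ U then ⟨z, h⟩ else x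
  have hψ : ∀ z ∈ U, (ψ z).1 = z := fun z hz => by
    have : ψ z = ⟨z, hz⟩ := dif_pos hz
    exact congrArg Subtype.val this
  refine ⟨ψ, morphismAt_restrict ((morphismAt_id x.1).congr ?_), hψ,
    fun z => Subtype.ext (hψ _ z.2)⟩
  filter_upwards [hU.mem_nhds x.2] with z hz
  exact (hψ z hz).symm

theorem locallyIsomorphic_restrict {U : Set X} (hU : IsOpen U) (x : X.restrict U) :
    LocallyIsomorphic X x.1 (X.restrict U) x := by
  obtain ⟨ψ, hψ, h1, h2⟩ := exists_lift_restrict hU x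
  refine ⟨ψ, fun z => z.1, h2 x, rfl, hψ, morphismAt_val x, ?_, .of_forall h2⟩
  filter_upwards [hU.mem_nhds x.2] with z hz
  exact h1 z hz

/-- Pullback of germs. -/
noncomputable def MorphismAt.stalkMap {φ : X → Y} {x : X} {y : Y} (hφ : MorphismAt X Y φ x)
    (hy : φ x = y) : Y.stalk y →+* X.stalk x where
  toFun γ := ⟨γ.1.compTendsto φ (hy ▸ hφ.1), by
    obtain ⟨γ, hγ⟩ := γ
    induction γ using Filter.Germ.inductionOn with | _ f =>
    subst hy
    exact hφ.2 f hγ⟩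
  map_one' := rfl
  map_zero' := rfl
  map_add' := by
    rintro ⟨γ, hγ⟩ ⟨δ, hδ⟩
    induction γ using Filter.Germ.inductionOn
    induction δ using Filter.Germ.inductionOn
    rfl
  map_mul' := by
    rintro ⟨γ, hγ⟩ ⟨δ, hδ⟩
    induction γ using Filter.Germ.inductionOn
    induction δ using Filter.Germ.inductionOn
    rfl

theorem MorphismAt.stalkMap_stalkMap {φ : X → Y} {ψ : Y → X} {x : X} {y : Y}
    (hφ : MorphismAt X Y φ x) (hψ : MorphismAt Y X ψ y) (hy : φ x = y) (hx : ψ y = x)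
    (h : ∀ᶠ z in 𝓝 x, ψ (φ z) = z) (γ : X.stalk x) :
    hφ.stalkMap hy (hψ.stalkMap hx γ) = γ := by
  obtain ⟨γ, hγ⟩ := γ
  induction γ using Filter.Germ.inductionOn with | _ f =>
  refine Subtype.ext (Germ.coe_eq.2 ?_)
  filter_upwards [h] with z hz
  exact congrArg f hz

theorem LocallyIsomorphic.isRegularLocalRing {x : X} {y : Y} (h : LocallyIsomorphic X x Y y)
    (hy : IsRegularLocalRing (Y.stalk y)) : IsRegularLocalRing (X.stalk x) := by
  obtain ⟨φ, ψ, h1, h2, h3, h4, h5, h6⟩ := h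
  exact IsRegularLocalRing.of_ringEquiv (R := Y.stalk y)
    { h3.stalkMap h1 with
      invFun := h4.stalkMap h2
      left_inv := fun γ => h4.stalkMap_stalkMap h3 h2 h1 h6 γ
      right_inv := fun γ => h3.stalkMap_stalkMap h4 h1 h2 h5 γ }

/-- `X` looks like an affine space near each point. -/
def IsLocallyAffineSpace (X : SpaceWithFunctions.{u}) : Prop :=
  ∀ x : X, ∃ (m : ℕ) (a : affine (Fin m → ℂ)), LocallyIsomorphic X x (affine (Fin m → ℂ)) a

theorem IsLocallyAffineSpace.isNonsingular (h : X.IsLocallyAffineSpace) : X.IsNonsingular := by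
  intro x
  obtain ⟨m, a, ha⟩ := h x
  exact ha.isRegularLocalRing (isRegularLocalRing_stalk_affine a)

theorem locallyIsomorphic_linearEquiv {E : Type u} {E' : Type v} [AddCommGroup E] [Module ℂ E]
    [AddCommGroup E'] [Module ℂ E'] (ε : E ≃ₗ[ℂ] E') (a : affine E) :
    LocallyIsomorphic (affine E) a (affine E') (ε a) := by
  refine ⟨fun v => ε v, fun v => ε.symm v, rfl, ε.symm_apply_apply a, ?_, ?_,
    .of_forall ε.symm_apply_apply, .of_forall ε.apply_symm_apply⟩
  · exact ((vecRegularAt_affine a).map ε.toLinearMap).morphismAt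
  · exact ((vecRegularAt_affine (E := E') (ε a)).map ε.symm.toLinearMap).morphismAt

theorem locallyIsomorphic_prod_affine {E : Type u} {E' : Type v} [AddCommGroup E] [Module ℂ E]
    [AddCommGroup E'] [Module ℂ E'] (a : affine E) (a' : affine E') :
    LocallyIsomorphic ((affine E).prod (affine E')) (a, a') (affine (E × E')) ((a, a') : E × E') := by
  refine ⟨fun p => ((p.1, p.2) : E × E'), fun p => ((p.1, p.2) : E × E'), rfl, rfl, ?_, ?_,
    .of_forall fun _ => rfl, .of_forall fun _ => rfl⟩
  · exact (VecRegularAt.prodMk (morphismAt_fst (X := affine E) (Y := affine E') (a, a')).vecRegularAt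
      (morphismAt_snd (X := affine E) (Y := affine E') (a, a')).vecRegularAt).morphismAt
  · have h := vecRegularAt_affine (E := E × E') ((a, a') : E × E')
    exact ((h.map (LinearMap.fst ℂ E E')).morphismAt).prodMk
      ((h.map (LinearMap.snd ℂ E E')).morphismAt)

theorem IsLocallyAffineSpace.of_affine (h : ∀ x : X, ∃ (E : Type v) (_ : AddCommGroup E)
    (_ : Module ℂ E) (_ : FiniteDimensional ℂ E) (a : affine E),
      LocallyIsomorphic X x (affine E) a) : X.IsLocallyAffineSpace := by
  intro x
  obtain ⟨E, _, _, _, a, ha⟩ := h x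
  exact ⟨_, _, ha.trans (locallyIsomorphic_linearEquiv (Module.finBasis ℂ E).equivFun a)⟩

theorem IsLocallyAffineSpace.prod (hX : X.IsLocallyAffineSpace) (hY : Y.IsLocallyAffineSpace) :
    (X.prod Y).IsLocallyAffineSpace := by
  refine .of_affine fun p => ?_
  obtain ⟨m, a, ha⟩ := hX p.1
  obtain ⟨l, b, hb⟩ := hY p.2
  exact ⟨(Fin m → ℂ) × (Fin l → ℂ), inferInstance, inferInstance, inferInstance, _,
    (ha.prod hb).trans (locallyIsomorphic_prod_affine a b)⟩

/-- The complements of `C` are the graphs of linear maps from W to `C`, each graph coming from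
exactly one map. The chart on `Module.End ℂ V` has redundant parameters and only exhibits a retract,
so it is restricted here to `sub W →ₗ[ℂ] C`. -/
theorem isLocallyAffineSpace_grassmannian {V : Type v} [AddCommGroup V] [Module ℂ V]
    [FiniteDimensional ℂ V] {k : ℕ} : (grassmannian k V).IsLocallyAffineSpace := by
  refine .of_affine fun W => ?_
  obtain ⟨C, hC⟩ := (sub W).exists_isCompl
  let π := (sub W).projectionOnto C hC
  let π' := C.projectionOnto (sub W) hC.symm
  let j : (sub W →ₗ[ℂ] C) →ₗ[ℂ] Module.End ℂ V :=
    { toFun := fun φ => C.subtype ∘ₗ φ ∘ₗ π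
      map_add' := fun _ _ => by ext; simp
      map_smul' := fun _ _ => by ext; simp }
  let r : affine (sub W →ₗ[ℂ] C) → grassmannian k V := fun φ => chart C W hC (j φ)
  let e : grassmannian k V → affine (sub W →ₗ[ℂ] C) := fun W' =>
    (π' ∘ₗ projAlong C (sub W') ∘ₗ (sub W).subtype : sub W →ₗ[ℂ] C)
  have hjmem : ∀ φ v, j φ v ∈ C := fun φ v => (φ (π v)).2
  have hπ : ∀ w : sub W, π w = w := Submodule.projectionOnto_apply_left hC
  have hπ'0 : ∀ w ∈ sub W, π' w = 0 := fun w hw =>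
    (Submodule.projectionOnto_apply_eq_zero_iff hC.symm).2 hw
  have hπ'C : ∀ c : C, π' c = c := Submodule.projectionOnto_apply_left hC.symm
  have hgr : ∀ (φ : sub W →ₗ[ℂ] C) (w : sub W), graphAut C (sub W) (j φ) w = w + φ w := fun φ w => by
    rw [graphAut_of_mem hC _ w.2, projAlong_of_mem_right (hjmem φ w), sub_zero]
    simp [j, hπ]
  have her : ∀ φ : sub W →ₗ[ℂ] C, e (r φ) = φ := fun φ => by
    refine LinearMap.ext fun w => ?_
    change π' (projAlong C ((sub W).map (graphAut C (sub W) (j φ))) w) = φ w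
    have h1 : (w : V) = graphAut C (sub W) (j φ) w - φ w := by
      rw [hgr]; abel
    rw [h1, map_sub, projAlong_of_mem (isCompl_map_graphAut hC _) ⟨_, w.2, rfl⟩,
      projAlong_of_mem_right (Subtype.property _), sub_zero, hgr, map_add, hπ'0 _ w.2, hπ'C,
      zero_add]
  have hre : ∀ W' : grassmannian k V, IsCompl (sub W') C → r (e W') = W' := fun W' hW' => by
    refine grassmannian_ext (Eq.trans ?_ (map_graphAut_projAlong hC hW'))
    have key : ∀ w ∈ sub W, graphAut C (sub W) (j (e W')) w =
        graphAut C (sub W) (projAlong C (sub W') - projAlong C (sub W)) w := fun w hw => by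
      have h2 : projAlong C (sub W') w - w ∈ C := by
        rw [← neg_sub]; exact C.neg_mem (sub_projAlong_mem hW' w)
      rw [hgr _ ⟨w, hw⟩, graphAut_of_mem hC _ hw, LinearMap.sub_apply, projAlong_of_mem hC hw,
        projAlong_of_mem_right h2, sub_zero]
      congr 1
      change ((π' (projAlong C (sub W') w) : C) : V) = _
      have h3 : projAlong C (sub W') w = (projAlong C (sub W') w - w) + w := by abel
      rw [h3, map_add, hπ'0 w hw, add_zero]
      have := hπ'C ⟨_, h2⟩
      simp only at this
      rw [this]
      simp
    ext v
    constructor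
    · rintro ⟨w, hw, rfl⟩
      exact ⟨w, hw, (key w hw).symm⟩
    · rintro ⟨w, hw, rfl⟩
      exact ⟨w, hw, key w hw⟩
  have hr : ∀ φ, MorphismAt (affine (sub W →ₗ[ℂ] C)) (grassmannian k V) r φ := fun φ =>
    (isMorphism_iff.1 (isMorphism_chart C W hC) _).comp
      ((vecRegularAt_affine (E := sub W →ₗ[ℂ] C) φ).map j).morphismAt
  refine ⟨sub W →ₗ[ℂ] C, inferInstance, inferInstance, inferInstance, e W, e, r, rfl, hre W hC, ?_,
    hr _, ?_, .of_forall her⟩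
  · exact ((vecRegularAt_const π' W).linearMap_comp
      ((vecRegularAt_projAlong hC).linearMap_comp (vecRegularAt_const _ W))).morphismAt
  · filter_upwards [(isOpen_isCompl C).mem_nhds hC] with W' hW'
    exact hre W' hW'

end local_iso

/-! ### Completeness of projective spaces -/

section elimination

variable {Z : SpaceWithFunctions.{u}} {q : ℕ}

/-- A family of polynomials with regular coefficients. -/
def CoeffRegularAt (Z : SpaceWithFunctions.{u}) {q : ℕ} (F : Z → MvPolynomial (Fin q) ℂ) (z : Z) :
    Prop :=
  ∀ m, Z.RegularAt (fun z => (F z).coeff m) z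

theorem coeffRegularAt_const (P : MvPolynomial (Fin q) ℂ) (z : Z) :
    Z.CoeffRegularAt (fun _ => P) z := fun _ => Z.regularAt_const _ z

theorem CoeffRegularAt.add {F G : Z → MvPolynomial (Fin q) ℂ} {z : Z} (hF : Z.CoeffRegularAt F z)
    (hG : Z.CoeffRegularAt G z) : Z.CoeffRegularAt (fun z => F z + G z) z := fun m => by
  simp only [MvPolynomial.coeff_add]
  exact (hF m).add (hG m)

theorem CoeffRegularAt.mul {F G : Z → MvPolynomial (Fin q) ℂ} {z : Z} (hF : Z.CoeffRegularAt F z)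
    (hG : Z.CoeffRegularAt G z) : Z.CoeffRegularAt (fun z => F z * G z) z := fun m => by
  classical
  simp only [MvPolynomial.coeff_mul]
  exact .sum fun p _ => (hF p.1).mul (hG p.2)

/-- The line spanned by a non-zero vector. -/
noncomputable def lineThrough {V : Type v} [AddCommGroup V] [Module ℂ V] (x : V) (hx : x ≠ 0) :
    grassmannian 1 V :=
  spanFrame (⟨fun _ => x, LinearIndependent.of_subsingleton 0 hx⟩ : frames 1 V)

theorem sub_lineThrough {V : Type v} [AddCommGroup V] [Module ℂ V] (x : V) (hx : x ≠ 0) :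
    sub (lineThrough x hx) = Submodule.span ℂ {x} := by
  change Submodule.span ℂ (Set.range fun _ : Fin 1 => x) = _
  simp

theorem exists_lineThrough {V : Type v} [AddCommGroup V] [Module ℂ V] [FiniteDimensional ℂ V]
    (ℓ : grassmannian 1 V) : ∃ x hx, ℓ = lineThrough x hx := by
  obtain ⟨⟨A, hA⟩, rfl⟩ := spanFrame_surjective ℓ
  refine ⟨(A : Fin 1 → V) 0, LinearIndependent.ne_zero (R := ℂ) 0 hA, ?_⟩
  unfold lineThrough
  congr 2
  funext i
  rw [Subsingleton.elim i 0]

theorem exists_mem_adjoin_of_eventually {E : Type v} [AddCommGroup E] [Module ℂ E]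
    {p : affine E → Prop} {a : affine E} (hp : ∀ᶠ x in 𝓝 a, p x) :
    ∃ e ∈ Algebra.adjoin ℂ {f : E → ℂ | ∃ l : E →ₗ[ℂ] ℂ, f = fun v => l v},
      e a ≠ 0 ∧ ∀ x, e x ≠ 0 → p x := by
  obtain ⟨s, hs, hso, has⟩ := eventually_nhds_iff.1 hp
  obtain ⟨e, he, hea, hes⟩ := hso _ has
  exact ⟨e, he, hea, fun x hx => hs x (hes x hx)⟩

theorem eventually_restrict {X : SpaceWithFunctions.{v}} {S : Set X} {p : X.restrict S → Prop}
    {a : X.restrict S} (hp : ∀ᶠ x in 𝓝 a, p x) :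
    ∀ᶠ y in 𝓝 a.1, ∀ x : X.restrict S, x.1 = y → p x := by
  have h : 𝓝 a = Filter.comap Subtype.val (𝓝 a.1) := nhds_induced _ _
  rw [h] at hp
  exact Filter.eventually_comap.1 hp

theorem exists_div_of_regularAt {E : Type v} [AddCommGroup E] [Module ℂ E] {S : Set (affine E)}
    {g : (affine E).restrict S → ℂ} {a : (affine E).restrict S}
    (hg : ((affine E).restrict S).RegularAt g a) :
    ∃ α ∈ Algebra.adjoin ℂ {f : E → ℂ | ∃ l : E →ₗ[ℂ] ℂ, f = fun v => l v},
    ∃ β ∈ Algebra.adjoin ℂ {f : E → ℂ | ∃ l : E →ₗ[ℂ] ℂ, f = fun v => l v},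
    ∃ e ∈ Algebra.adjoin ℂ {f : E → ℂ | ∃ l : E →ₗ[ℂ] ℂ, f = fun v => l v},
      e a.1 ≠ 0 ∧ β a.1 ≠ 0 ∧ ∀ x : (affine E).restrict S, e x.1 ≠ 0 →
        β x.1 ≠ 0 ∧ g x = α x.1 / β x.1 := by
  obtain ⟨f, ⟨α, hα, β, hβ, hβa, hfαβ⟩, hgf⟩ := hg
  have h1 : ∀ᶠ x : (affine E).restrict S in 𝓝 a, g x = f x.1 := Germ.coe_eq.1 hgf
  have h2 : ∀ᶠ x : affine E in 𝓝 a.1, f x = α x / β x := Germ.coe_eq.1 hfαβ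
  have h3 : (affine E).RegularAt β a.1 := regularAt_generate_of_mem_adjoin hβ
  obtain ⟨e, he, hea, h⟩ := exists_mem_adjoin_of_eventually
    ((eventually_restrict h1).and (h2.and (h3.eventually_ne hβa)))
  refine ⟨α, hα, β, hβ, e, he, hea, hβa, fun x hx => ?_⟩
  obtain ⟨h4, h5, h6⟩ := h x.1 hx
  exact ⟨h6, (h4 x rfl).trans h5⟩

/-- A regular function on projective space is a quotient of polynomials. -/
theorem exists_eval_of_regularAt {g : grassmannian 1 (Fin q → ℂ) → ℂ} {a : Fin q → ℂ} {ha : a ≠ 0}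
    (hg : (grassmannian 1 (Fin q → ℂ)).RegularAt g (lineThrough a ha)) :
    ∃ A B : MvPolynomial (Fin q) ℂ, MvPolynomial.eval a B ≠ 0 ∧
      ∀ x hx, g (lineThrough x hx) * MvPolynomial.eval x B = MvPolynomial.eval x A := by
  let T : (Fin q → ℂ) →ₗ[ℂ] (Fin 1 → Fin q → ℂ) := LinearMap.pi fun _ => .id
  obtain ⟨α, hα, β, hβ, e, he, hea, hβa, h⟩ := exists_div_of_regularAt
    ((morphismAt_spanFrame (V := Fin q → ℂ) _).2 g hg)
  obtain ⟨P, hP⟩ := exists_mvPolynomial_of_mem_adjoin hα T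
  obtain ⟨Q, hQ⟩ := exists_mvPolynomial_of_mem_adjoin hβ T
  obtain ⟨R, hR⟩ := exists_mvPolynomial_of_mem_adjoin he T
  -- The identity g = P/Q is known only where R does not vanish; multiplying both sides by R makes
  -- it hold everywhere.
  refine ⟨R * P, R * Q, ?_, fun x hx => ?_⟩
  · rw [map_mul, ← hR, ← hQ]
    exact mul_ne_zero hea hβa
  · simp only [map_mul, ← hR, ← hQ, ← hP]
    by_cases hex : e (T x) = 0
    · simp [hex]
    · obtain ⟨h1, h2⟩ := h (⟨T x, LinearIndependent.of_subsingleton 0 hx⟩ : frames 1 (Fin q → ℂ)) hex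
      have h3 : g (lineThrough x hx) = α (T x) / β (T x) := h2
      have h4 : β (T x) ≠ 0 := h1
      rw [h3]
      field_simp

/-- Denominators only come from the projective factor, so they can be cleared by one polynomial `B`
that does not depend on the point of `Z`; the coefficients that remain are regular on `Z`. -/
theorem exists_family_of_mem_adjoin {z : Z} {a : Fin q → ℂ} {ha : a ≠ 0}
    {f : Z × grassmannian 1 (Fin q → ℂ) → ℂ}
    (hf : f ∈ Algebra.adjoin ℂ {f : Z × grassmannian 1 (Fin q → ℂ) → ℂ |
      (∃ g : Z → ℂ, Z.RegularAt g z ∧ f = fun p => g p.1) ∨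
      ∃ g : grassmannian 1 (Fin q → ℂ) → ℂ,
        (grassmannian 1 (Fin q → ℂ)).RegularAt g (lineThrough a ha) ∧ f = fun p => g p.2}) :
    ∃ (B : MvPolynomial (Fin q) ℂ) (F : Z → MvPolynomial (Fin q) ℂ), MvPolynomial.eval a B ≠ 0 ∧
      Z.CoeffRegularAt F z ∧ ∀ z x hx,
        f (z, lineThrough x hx) * MvPolynomial.eval x B = MvPolynomial.eval x (F z) := by
  classical
  induction hf using Algebra.adjoin_induction with
  | mem f hf =>
    obtain ⟨g, hg, rfl⟩ | ⟨g, hg, rfl⟩ := hf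
    · refine ⟨1, fun z => .C (g z), by simp, fun m => ?_, fun z x hx => by simp⟩
      simp only [MvPolynomial.coeff_C]
      split_ifs
      exacts [hg, Z.regularAt_const 0 z]
    · obtain ⟨A, B, hB, hAB⟩ := exists_eval_of_regularAt hg
      exact ⟨B, fun _ => A, hB, coeffRegularAt_const A z, fun z x hx => hAB x hx⟩
  | algebraMap r => exact ⟨1, fun _ => .C r, by simp, coeffRegularAt_const _ z, fun _ _ _ => by simp⟩
  | add f g _ _ hf hg =>
    obtain ⟨B, F, hB, hF, h⟩ := hf
    obtain ⟨B', F', hB', hF', h'⟩ := hg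
    refine ⟨B * B', fun z => F z * B' + F' z * B, by simp [hB, hB'],
      (hF.mul (coeffRegularAt_const _ z)).add (hF'.mul (coeffRegularAt_const _ z)),
      fun z x hx => ?_⟩
    simp only [map_add, map_mul, ← h z x hx, ← h' z x hx, Pi.add_apply]
    ring
  | mul f g _ _ hf hg =>
    obtain ⟨B, F, hB, hF, h⟩ := hf
    obtain ⟨B', F', hB', hF', h'⟩ := hg
    refine ⟨B * B', fun z => F z * F' z, by simp [hB, hB'], hF.mul hF', fun z x hx => ?_⟩
    simp only [map_mul, ← h z x hx, ← h' z x hx, Pi.mul_apply]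
    ring

/-- If a polynomial vanishes on the line through `x`, so do its homogeneous parts. -/
theorem sum_coeff_mul_prod_eq_zero {P : MvPolynomial (Fin q) ℂ} {x : Fin q → ℂ}
    (h : ∀ t : ℂ, t ≠ 0 → MvPolynomial.eval (t • x) P = 0) (M : ℕ) :
    ∑ m ∈ Finset.finsuppAntidiag Finset.univ M, P.coeff m * ∏ i, x i ^ m i = 0 := by
  classical
  let Q : Polynomial ℂ := ∑ m ∈ P.support,
    Polynomial.C (P.coeff m * ∏ i, x i ^ m i) * Polynomial.X ^ (∑ i, m i)
  have hQ : ∀ t, Q.eval t = MvPolynomial.eval (t • x) P := fun t => by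
    rw [MvPolynomial.eval_eq']
    simp only [Q, Polynomial.eval_finsetSum, Polynomial.eval_mul, Polynomial.eval_C,
      Polynomial.eval_pow, Polynomial.eval_X, Pi.smul_apply, smul_eq_mul, mul_pow,
      Finset.prod_mul_distrib, Finset.prod_pow_eq_pow_sum]
    exact Finset.sum_congr rfl fun m _ => by ring
  -- `Q` is t ↦ P(tx), with the homogeneous parts of P at x as coefficients. Its vanishing is known
  -- only for t ≠ 0, whence the factor X.
  have hQ0 : Polynomial.X * Q = 0 := Polynomial.funext fun t => by
    by_cases ht : t = 0
    · simp [ht]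
    · simp [hQ, h t ht]
  have hQ0' : Q = 0 := by simpa using hQ0
  have hc := congrArg (fun Q => Polynomial.coeff Q M) hQ0'
  simp only [Q, Polynomial.finsetSum_coeff, Polynomial.coeff_C_mul, Polynomial.coeff_X_pow,
    Polynomial.coeff_zero, mul_ite, mul_one, mul_zero] at hc
  rw [← hc, ← Finset.sum_filter]
  refine (Finset.sum_subset (fun m hm => ?_) fun m hm hm' => ?_).symm
  · simp only [Finset.mem_filter] at hm
    simp [Finset.mem_finsuppAntidiag, hm.2]
  · have h1 : M = ∑ i, m i := ((Finset.mem_finsuppAntidiag.1 hm).1).symm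
    simp only [Finset.mem_filter, not_and, MvPolynomial.mem_support_iff] at hm'
    by_cases h2 : P.coeff m = 0
    · simp [h2]
    · exact absurd h1 (hm' h2)

/-- Projective spaces are complete. -/
theorem isClosedMap_fst_prod_lines :
    IsClosedMap (X := Z.prod (grassmannian 1 (Fin q → ℂ))) (Y := Z) fun p => p.1 := by
  classical
  intro C hC
  rw [← isOpen_compl_iff, isOpen_iff_eventually]
  intro z₀ hz₀
  -- Values at `z₀` of the polynomial families, with coefficients regular at `z₀`, that vanish on
  -- `C`. As the fibre of `C` over `z₀` is empty, the only possible zero of this ideal is the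
  -- origin.
  let J : Ideal (MvPolynomial (Fin q) ℂ) :=
    { carrier := {P | ∃ F : Z → MvPolynomial (Fin q) ℂ, Z.CoeffRegularAt F z₀ ∧ F z₀ = P ∧
        ∀ z x hx, (z, lineThrough x hx) ∈ C → MvPolynomial.eval x (F z) = 0}
      add_mem' := by
        rintro _ _ ⟨F, hF, rfl, h⟩ ⟨G, hG, rfl, h'⟩
        exact ⟨_, hF.add hG, rfl, fun z x hx hC => by rw [map_add, h z x hx hC, h' z x hx hC, add_zero]⟩
      zero_mem' := ⟨_, coeffRegularAt_const 0 z₀, rfl, fun _ _ _ _ => map_zero _⟩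
      smul_mem' := by
        rintro P _ ⟨F, hF, rfl, h⟩
        exact ⟨_, (coeffRegularAt_const P z₀).mul hF, rfl, fun z x hx hC => by
          rw [map_mul, h z x hx hC, mul_zero]⟩ }
  have hzero : ∀ a ∈ MvPolynomial.zeroLocus ℂ J, a = 0 := by
    intro a ha
    by_contra ha0
    have hmem : (z₀, lineThrough a ha0) ∈ Cᶜ := fun h => hz₀ ⟨_, h, rfl⟩
    obtain ⟨f, hf, hfa, hfC⟩ := hC.isOpen_compl _ hmem
    obtain ⟨B, F, hB, hF, h⟩ := exists_family_of_mem_adjoin (ha := ha0) hf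
    have hFJ : F z₀ ∈ J := ⟨F, hF, rfl, fun z x hx hzx => by
      rw [← h z x hx]
      by_contra h0
      exact hfC _ (left_ne_zero_of_mul h0) hzx⟩
    have h1 := ha _ hFJ
    have h2 := h z₀ a ha0
    rw [MvPolynomial.aeval_eq_eval] at h1
    exact mul_ne_zero hfa hB (h2.trans h1)
  have hX : ∀ i, ∃ N : ℕ, (MvPolynomial.X i : MvPolynomial (Fin q) ℂ) ^ N ∈ J := by
    intro i
    have : (MvPolynomial.X i : MvPolynomial (Fin q) ℂ) ∈ J.radical := by
      rw [← MvPolynomial.vanishingIdeal_zeroLocus_eq_radical (K := ℂ)]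
      intro a ha
      simp [hzero a ha]
    exact this
  choose N hN using hX
  -- In degree `M` every monomial has some exponent at least `N i`, so it lies in `J`.
  let M := (∑ i, N i) + 1
  have hmon : ∀ m : Fin q →₀ ℕ, ∑ i, m i = M → MvPolynomial.monomial m (1 : ℂ) ∈ J := by
    intro m hm
    obtain ⟨i, hi⟩ : ∃ i, N i ≤ m i := by
      by_contra! h
      have := Finset.sum_le_sum fun i (_ : i ∈ Finset.univ) => (h i).le
      omega
    have hdvd : (MvPolynomial.X i : MvPolynomial (Fin q) ℂ) ^ N i ∣ MvPolynomial.monomial m 1 := by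
      rw [MvPolynomial.X_pow_eq_monomial, MvPolynomial.monomial_dvd_monomial]
      exact ⟨.inr (by simpa using hi), dvd_rfl⟩
    exact J.mem_of_dvd hdvd (hN i)
  let D := {m // m ∈ Finset.finsuppAntidiag (Finset.univ : Finset (Fin q)) M}
  have hD : ∀ m : D, ∑ i, m.1 i = M := fun m => (Finset.mem_finsuppAntidiag.1 m.2).1
  choose G hG hG₀ hGC using fun m : D => hmon m.1 (hD m)
  -- The coefficients in degree `M` of families specializing at `z₀` to all the monomials of that
  -- degree. The matrix is the identity at `z₀`, so it is invertible nearby, whereas a point of `C`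
  -- over z would make the vector of its degree `M` monomials a non-zero element of the kernel.
  let A : Z → Matrix D D ℂ := fun z m m' => (G m z).coeff m'.1
  have hA : Z.RegularAt (fun z => (A z).det) z₀ := .det fun m m' => hG m m'.1
  have hA₀ : A z₀ = 1 := by
    ext m m'
    simp only [A, hG₀, MvPolynomial.coeff_monomial, Matrix.one_apply]
    exact if_congr Subtype.ext_iff.symm rfl rfl
  filter_upwards [hA.eventually_ne (by simp [hA₀])] with z hz
  rintro ⟨⟨z', ℓ⟩, hzℓ, rfl⟩
  obtain ⟨x, hx, rfl⟩ := exists_lineThrough ℓ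
  have hv : (A z').mulVec (fun m' : D => ∏ i, x i ^ m'.1 i) = 0 := by
    funext m
    have h1 : ∀ t : ℂ, t ≠ 0 → MvPolynomial.eval (t • x) (G m z') = 0 := fun t ht => by
      have htx : t • x ≠ 0 := smul_ne_zero ht hx
      refine hGC m z' _ htx ?_
      have : lineThrough (t • x) htx = lineThrough x hx := grassmannian_ext (by
        rw [sub_lineThrough, sub_lineThrough, Submodule.span_singleton_smul_eq ht.isUnit])
      rw [this]
      exact hzℓ
    have h2 := sum_coeff_mul_prod_eq_zero h1 M
    rw [← Finset.sum_coe_sort] at h2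
    exact h2
  have hv0 := Matrix.eq_zero_of_mulVec_eq_zero hz hv
  obtain ⟨i, hi⟩ : ∃ i, x i ≠ 0 := Function.ne_iff.1 hx
  have h3 := congrFun hv0 ⟨Finsupp.single i M, by simp [Finset.mem_finsuppAntidiag]⟩
  simp only [Pi.zero_apply, Finset.prod_eq_zero_iff] at h3
  obtain ⟨j, -, hj⟩ := h3
  by_cases hij : i = j
  · subst hij
    simp [hi] at hj
  · simp [hij] at hj

end elimination

/-! ### Properties of Grassmannian bundles -/

theorem nonempty_grassmannian {p q : ℕ} (hpq : p ≤ q) : Nonempty (grassmannian p (Fin q → ℂ)) :=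
  ⟨spanFrame ⟨Pi.basisFun ℂ (Fin q) ∘ Fin.castLE hpq,
    (Pi.basisFun ℂ (Fin q)).linearIndependent.comp _ (Fin.castLE_injective hpq)⟩⟩

theorem subsingleton_grassmannian_zero {V : Type v} [AddCommGroup V] [Module ℂ V]
    [FiniteDimensional ℂ V] : Subsingleton (grassmannian 0 V) :=
  ⟨fun W W' => grassmannian_ext (by
    rw [Submodule.finrank_eq_zero.1 (finrank_sub W), Submodule.finrank_eq_zero.1 (finrank_sub W')])⟩

/-- A complete space: the projections `X × Z → Z` are closed. -/
def IsComplete (X : SpaceWithFunctions.{u}) : Prop :=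
  ∀ Z : SpaceWithFunctions.{u}, IsClosedMap (X := X.prod Z) (Y := Z) fun p => p.2

theorem isClosedMap_fst_prod_point {S : SpaceWithFunctions.{u}} {G : SpaceWithFunctions.{v}}
    [Subsingleton G] : IsClosedMap (X := S.prod G) (Y := S) fun p => p.1 := by
  intro C hC
  rcases C.eq_empty_or_nonempty with rfl | ⟨⟨s, g⟩, -⟩
  · simp
  have h : Continuous (Y := S.prod G) (fun s : S => (s, g)) :=
    (isMorphism_iff.2 fun s => (morphismAt_id s).prodMk (morphismAt_const g s)).1
  convert hC.preimage h using 1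
  ext s
  constructor
  · rintro ⟨⟨s, g'⟩, hs, rfl⟩
    rwa [Subsingleton.elim g' g] at hs
  · exact fun hs => ⟨_, hs, rfl⟩

theorem isClosedMap_fst_prod_grassmannian {S : SpaceWithFunctions.{u}} {p q : ℕ} (hp : p ≤ 1) :
    IsClosedMap (X := S.prod (grassmannian p (Fin q → ℂ))) (Y := S) fun x => x.1 := by
  interval_cases p
  · have := subsingleton_grassmannian_zero (V := Fin q → ℂ)
    exact isClosedMap_fst_prod_point
  · exact isClosedMap_fst_prod_lines

section bundle

variable {p q : ℕ} {X : SpaceWithFunctions.{u}} {Y : SpaceWithFunctions.{v}} {φ : X → Y}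

theorem IsGrassmannianBundle.exists_trivialization (h : IsGrassmannianBundle p q φ) (y : Y) :
    ∃ (U : Set Y) (_ : IsOpen U) (_ : y ∈ U) (e : φ ⁻¹' U → U × grassmannian p (Fin q → ℂ))
      (σ : U × grassmannian p (Fin q → ℂ) → φ ⁻¹' U),
      IsMorphism (X := (Y.restrict U).prod (grassmannian p (Fin q → ℂ)))
        (Y := X.restrict (φ ⁻¹' U)) σ ∧ IsIsomorphism (X := X.restrict (φ ⁻¹' U))
        (Y := (Y.restrict U).prod (grassmannian p (Fin q → ℂ))) e ∧
      (∀ x, σ (e x) = x) ∧ ∀ b, φ (σ b).1 = b.1 := by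
  obtain ⟨U, hU, hyU, e, he, heφ⟩ := h.2 y
  obtain ⟨he1, σ, hσ, hl, hr⟩ := id he
  refine ⟨U, hU, hyU, e, σ, hσ, he, hl, fun b => ?_⟩
  have := heφ (σ b)
  rw [hr b] at this
  exact (congrArg Subtype.val this).symm

theorem IsGrassmannianBundle.continuous (h : IsGrassmannianBundle p q φ) : Continuous φ := h.1.1

theorem IsGrassmannianBundle.surjective (h : IsGrassmannianBundle p q φ) (hpq : p ≤ q) :
    Function.Surjective φ := by
  intro y
  obtain ⟨U, hU, hyU, e, σ, hσ, he, hl, hφ⟩ := h.exists_trivialization y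
  obtain ⟨g⟩ := nonempty_grassmannian hpq
  exact ⟨(σ (⟨y, hyU⟩, g)).1, hφ _⟩

/-- Through each point passes a local section, constant in a trivialization; points of the base near
φ(x) lift along it into the given open set. -/
theorem IsGrassmannianBundle.isOpenMap (h : IsGrassmannianBundle p q φ) : IsOpenMap φ := by
  intro O hO
  rw [isOpen_iff_eventually]
  rintro _ ⟨x, hx, rfl⟩
  obtain ⟨U, hU, hyU, e, σ, hσ, he, hl, hφ⟩ := h.exists_trivialization (φ x)
  let s : Y.restrict U → X := fun y => (σ (y, (e ⟨x, hyU⟩).2)).1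
  have hs : ∀ y, MorphismAt (Y.restrict U) X s y := fun y =>
    (morphismAt_val _).comp ((isMorphism_iff.1 hσ _).comp
      ((morphismAt_id y).prodMk (morphismAt_const _ y)))
  have hb : (e ⟨x, hyU⟩).1 = ⟨φ x, hyU⟩ := Subtype.ext (by rw [← hφ, hl])
  have hsx : s ⟨φ x, hyU⟩ = x := by
    have h1 : σ ((⟨φ x, hyU⟩ : U), (e ⟨x, hyU⟩).2) = ⟨x, hyU⟩ := by
      rw [← hb]; exact hl _
    exact congrArg Subtype.val h1
  have h2 := (hs ⟨φ x, hyU⟩).eventually (p := fun z => z ∈ O) (by rw [hsx]; exact hO.mem_nhds hx)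
  filter_upwards [eventually_restrict h2, hU.mem_nhds hyU] with y hy hyU'
  exact ⟨_, hy ⟨y, hyU'⟩ rfl, hφ _⟩

/-- The map is open, and each fibre is the image of a Grassmannian under a trivialization, hence
irreducible. -/
theorem IsGrassmannianBundle.irreducibleSpace (h : IsGrassmannianBundle p q φ) (hpq : p ≤ q)
    (hY : IrreducibleSpace Y) : IrreducibleSpace X := by
  have hne : Nonempty X := (h.surjective hpq).nonempty
  have hpre : IsPreirreducible (φ ⁻¹' Set.univ) := by
    refine IsPreirreducible.preimage_of_isPreirreducible_fiber
      PreirreducibleSpace.isPreirreducible_univ φ h.isOpenMap fun y => ?_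
    obtain ⟨U, hU, hyU, e, σ, hσ, he, hl, hφ⟩ := h.exists_trivialization y
    have := preirreducibleSpace_grassmannian (E := Fin q → ℂ) (k := p)
    let s : grassmannian p (Fin q → ℂ) → X := fun g => (σ ((⟨y, hyU⟩ : U), g)).1
    have hs : ∀ g, MorphismAt (grassmannian p (Fin q → ℂ)) X s g := fun g =>
      (morphismAt_val _).comp ((isMorphism_iff.1 hσ _).comp
        ((morphismAt_const (Y := Y.restrict U) (⟨y, hyU⟩ : U) g).prodMk (morphismAt_id g)))
    have himg := (PreirreducibleSpace.isPreirreducible_univ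
      (X := grassmannian p (Fin q → ℂ))).image s (isMorphism_iff.2 hs).1.continuousOn
    convert himg using 1
    ext x
    constructor
    · intro hx
      have hx' : φ x = y := hx
      subst hx'
      have hb : (e ⟨x, hyU⟩).1 = ⟨φ x, hyU⟩ := Subtype.ext (by rw [← hφ, hl])
      refine ⟨(e ⟨x, hyU⟩).2, trivial, ?_⟩
      have h1 : σ ((⟨φ x, hyU⟩ : U), (e ⟨x, hyU⟩).2) = ⟨x, hyU⟩ := by
        rw [← hb]; exact hl _
      exact congrArg Subtype.val h1
    · rintro ⟨g, -, rfl⟩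
      exact hφ _
  rw [Set.preimage_univ] at hpre
  exact { isPreirreducible_univ := hpre, toNonempty := hne }

theorem IsGrassmannianBundle.isLocallyAffineSpace (h : IsGrassmannianBundle p q φ)
    (hY : Y.IsLocallyAffineSpace) : X.IsLocallyAffineSpace := by
  intro x
  obtain ⟨U, hU, hyU, e, σ, hσ, he, hl, hφ⟩ := h.exists_trivialization (φ x)
  have h1 := locallyIsomorphic_restrict (hU.preimage h.continuous) ⟨x, hyU⟩
  have h2 := he.locallyIsomorphic (⟨x, hyU⟩ : φ ⁻¹' U)
  have hYU : (Y.restrict U).IsLocallyAffineSpace := fun y => by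
    obtain ⟨m, a, ha⟩ := hY y.1
    exact ⟨m, a, (locallyIsomorphic_restrict hU y).symm.trans ha⟩
  obtain ⟨m, a, ha⟩ := (hYU.prod isLocallyAffineSpace_grassmannian) (e ⟨x, hyU⟩)
  exact ⟨m, a, h1.trans (h2.trans ha)⟩

/-- Closedness is local on the target, and over a trivializing open set the map becomes the
projection (U × Z) × G → U × Z. The bound on `p` makes G a point or a projective space, where
completeness is available. -/
theorem IsGrassmannianBundle.isClosedMap_prod (h : IsGrassmannianBundle p q φ) (hp : p ≤ 1)
    (Z : SpaceWithFunctions.{w}) :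
    IsClosedMap (X := X.prod Z) (Y := Y.prod Z) fun a => (φ a.1, a.2) := by
  intro C hC
  rw [← isOpen_compl_iff, isOpen_iff_eventually]
  rintro ⟨y, z⟩ hyz
  obtain ⟨U, hU, hyU, e, σ, hσ, he, hl, hφ⟩ := h.exists_trivialization y
  let G := grassmannian p (Fin q → ℂ)
  let B := (Y.restrict U).prod Z
  let s : B.prod G → X.prod Z := fun b => ((σ (b.1.1, b.2)).1, b.1.2)
  have hs : ∀ b, MorphismAt (B.prod G) (X.prod Z) s b := fun b =>
    ((morphismAt_val _).comp ((isMorphism_iff.1 hσ _).comp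
      (((morphismAt_fst (X := Y.restrict U) (Y := Z) _).comp (morphismAt_fst b)).prodMk
        (morphismAt_snd b)))).prodMk
      ((morphismAt_snd (X := Y.restrict U) (Y := Z) _).comp (morphismAt_fst b))
  have hcl := isClosedMap_fst_prod_grassmannian (S := B) (q := q) hp _
    (hC.preimage (isMorphism_iff.2 hs).1)
  have hmem : (((⟨y, hyU⟩ : U), z) : B) ∈ ((fun b : B.prod G => b.1) '' (s ⁻¹' C))ᶜ := by
    rintro ⟨⟨⟨y', z'⟩, g⟩, hb, heq⟩
    have h1 : y' = ⟨y, hyU⟩ := congrArg Prod.fst heq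
    have h2 : z' = z := congrArg Prod.snd heq
    subst h1 h2
    exact hyz ⟨_, hb, Prod.ext (hφ _) rfl⟩
  obtain ⟨ψ, hψ, hψU, hψ'⟩ := exists_lift_restrict hU (⟨y, hyU⟩ : Y.restrict U)
  have hκ : MorphismAt (Y.prod Z) B (fun a => (ψ a.1, a.2)) (y, z) :=
    (MorphismAt.comp (φ := fun a : Y.prod Z => a.1) hψ (morphismAt_fst (y, z))).prodMk
      (morphismAt_snd (y, z))
  have hyψ : ((ψ y, z) : B) = ((⟨y, hyU⟩ : U), z) := Prod.ext (hψ' ⟨y, hyU⟩) rfl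
  have hmem' : ((ψ y, z) : B) ∈ ((fun b : B.prod G => b.1) '' (s ⁻¹' C))ᶜ :=
    (congrArg (· ∈ ((fun b : B.prod G => b.1) '' (s ⁻¹' C))ᶜ) hyψ).mpr hmem
  have hU' := (morphismAt_fst (X := Y) (Y := Z) (y, z)).eventually (hU.mem_nhds hyU)
  filter_upwards [hκ.eventually (hcl.isOpen_compl.mem_nhds hmem'), hU'] with a ha haU
  rintro ⟨⟨x, z'⟩, hx, rfl⟩
  have hxU : φ x ∈ U := haU
  have hb : (e ⟨x, hxU⟩).1 = ψ (φ x) := Subtype.ext (by rw [← hφ, hl, hψU _ hxU])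
  refine ha ⟨((ψ (φ x), z'), (e ⟨x, hxU⟩).2), ?_, rfl⟩
  have h1 : σ (ψ (φ x), (e ⟨x, hxU⟩).2) = ⟨x, hxU⟩ := by
    rw [← hb]; exact hl _
  have h2 : s ((ψ (φ x), z'), (e ⟨x, hxU⟩).2) = (x, z') :=
    Prod.ext (congrArg Subtype.val h1) rfl
  exact (congrArg (· ∈ C) h2).mpr hx

end bundle

/-- Iterated towers of projective space bundles, up to isomorphism. -/
inductive IsProjectiveTower : SpaceWithFunctions.{u} → Prop
  | point (X : SpaceWithFunctions.{u}) (hX : Nonempty X) (hX' : Subsingleton X) :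
      IsProjectiveTower X
  | bundle (X Y : SpaceWithFunctions.{u}) (φ : X → Y) (p q : ℕ) (hp : p ≤ 1) (hpq : p ≤ q)
      (hφ : IsGrassmannianBundle p q φ) (hY : IsProjectiveTower Y) : IsProjectiveTower X

namespace IsProjectiveTower

variable {X : SpaceWithFunctions.{u}}

theorem isGrassmannianTower (h : IsProjectiveTower X) : IsGrassmannianTower X := by
  induction h with
  | point X hX hX' => exact .point X hX hX'
  | bundle X Y φ p q _ hpq hφ _ ih => exact .bundle X Y φ p q hpq hφ ih

theorem irreducibleSpace (h : IsProjectiveTower X) : IrreducibleSpace X := by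
  induction h with
  | point X hX hX' =>
    exact { isPreirreducible_univ := Set.subsingleton_univ.isPreirreducible, toNonempty := hX }
  | bundle X Y φ p q _ hpq hφ _ ih => exact hφ.irreducibleSpace hpq ih

theorem isLocallyAffineSpace (h : IsProjectiveTower X) : X.IsLocallyAffineSpace := by
  induction h with
  | point X hX hX' =>
    intro x
    refine ⟨0, (0 : Fin 0 → ℂ), fun _ => (0 : Fin 0 → ℂ), fun _ => x, rfl, rfl, morphismAt_const _ _,
      morphismAt_const _ _, .of_forall fun _ => Subsingleton.elim _ _,
      .of_forall fun _ => Subsingleton.elim (α := Fin 0 → ℂ) _ _⟩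
  | bundle X Y φ p q _ hpq hφ _ ih => exact hφ.isLocallyAffineSpace ih

theorem isComplete (h : IsProjectiveTower X) : X.IsComplete := by
  induction h with
  | point X hX hX' =>
    intro Z C hC
    obtain ⟨x⟩ := hX
    have hc : Continuous (Y := X.prod Z) (fun z : Z => (x, z)) :=
      (isMorphism_iff.2 fun z => (morphismAt_const x z).prodMk (morphismAt_id z)).1
    convert hC.preimage hc using 1
    ext z
    constructor
    · rintro ⟨⟨x', z⟩, hs, rfl⟩
      rwa [Subsingleton.elim x' x] at hs
    · exact fun hs => ⟨_, hs, rfl⟩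
  | bundle X Y φ p q hp hpq hφ _ ih =>
    intro Z
    exact (ih Z).comp (hφ.isClosedMap_prod hp Z)

end IsProjectiveTower

/-! ### The Grassmannian bundle of subspaces between two families -/

section between

variable {V : Type v} [AddCommGroup V] [Module ℂ V] [FiniteDimensional ℂ V]

theorem VecRegularAt.eventually {X : SpaceWithFunctions.{u}} {f : X → V} {x : X}
    (hf : X.VecRegularAt f x) : ∀ᶠ y in 𝓝 x, X.VecRegularAt f y := by
  let b := Module.finBasis ℂ V
  have h : ∀ᶠ y in 𝓝 x, ∀ i, X.RegularAt (fun z => b.coord i (f z)) y :=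
    eventually_all.2 fun i => (hf (b.coord i)).eventually
  filter_upwards [h] with y hy
  refine VecRegularAt.congr (f := fun z => ∑ i, b.coord i (f z) • b i)
    (.sum fun i _ => (hy i).smul (vecRegularAt_const _ y)) (.of_forall fun z => b.sum_repr (f z))

/-- Coordinates on the quotient of two nested subspaces. -/
theorem exists_quotient_coordinates {L U : Submodule ℂ V} (h : L ≤ U) {l u : ℕ}
    (hl : Module.finrank ℂ L = l) (hu : Module.finrank ℂ U = u) :
    ∃ (ρ : V →ₗ[ℂ] (Fin (u - l) → ℂ)) (γ : (Fin (u - l) → ℂ) →ₗ[ℂ] V),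
      (∀ v ∈ L, ρ v = 0) ∧ (∀ a, ρ (γ a) = a) ∧ (∀ a, γ a ∈ U) ∧ ∀ v ∈ U, v - γ (ρ v) ∈ L := by
  obtain ⟨D, hD⟩ := L.exists_isCompl
  obtain ⟨C, hC⟩ := U.exists_isCompl
  have hsup : L ⊔ D ⊓ U = U := by
    rw [← sup_inf_assoc_of_le D h, hD.sup_eq_top, top_inf_eq]
  have hinf : L ⊓ (D ⊓ U) = ⊥ := by
    rw [← inf_assoc, hD.inf_eq_bot, bot_inf_eq]
  have hcard : Module.finrank ℂ ↥(D ⊓ U) = u - l := by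
    have := Submodule.finrank_sup_add_finrank_inf_eq L (D ⊓ U)
    rw [hsup, hinf, finrank_bot] at this
    omega
  -- `D ⊓ U` is a complement of `L` in `U` and so a model of the quotient; ρ is the projection to it
  -- along `L ⊔ C`.
  have hQ : IsCompl (D ⊓ U) (L ⊔ C) := by
    constructor
    · rw [Submodule.disjoint_def]
      intro x hx hx'
      obtain ⟨a, ha, c, hc, rfl⟩ := Submodule.mem_sup.1 hx'
      have h1 : c ∈ U := (U.add_mem_iff_right (h ha)).1 hx.2
      have h2 : c = 0 := Submodule.disjoint_def.1 hC.disjoint c h1 hc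
      subst h2
      rw [add_zero] at hx ⊢
      exact Submodule.disjoint_def.1 hD.disjoint a ha hx.1
    · rw [codisjoint_iff, ← sup_assoc, sup_comm _ L, hsup, hC.sup_eq_top]
  let ε : ↥(D ⊓ U) ≃ₗ[ℂ] (Fin (u - l) → ℂ) := (Module.finBasisOfFinrankEq ℂ _ hcard).equivFun
  let π := (D ⊓ U).projectionOnto (L ⊔ C) hQ
  have hπ : ∀ w : ↥(D ⊓ U), π w = w := Submodule.projectionOnto_apply_left hQ
  have hπ0 : ∀ v ∈ L, π v = 0 := fun v hv =>
    (Submodule.projectionOnto_apply_eq_zero_iff hQ).2 (Submodule.mem_sup_left hv)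
  refine ⟨ε.toLinearMap ∘ₗ π, (D ⊓ U).subtype ∘ₗ ε.symm.toLinearMap, fun v hv => ?_, fun a => ?_,
    fun a => ?_, fun v hv => ?_⟩
  · simp [hπ0 v hv]
  · simp [hπ]
  · exact (ε.symm a).2.2
  · rw [← hsup] at hv
    obtain ⟨a, ha, w, hw, rfl⟩ := Submodule.mem_sup.1 hv
    have := hπ ⟨w, hw⟩
    simp only at this
    simpa [hπ0 a ha, this] using ha

variable {Y : SpaceWithFunctions.{u}} {L U : Y → Submodule ℂ V} {l d m : ℕ}

theorem LiftsAt.vecRegularAt_projAlong {y : Y} {C : Submodule ℂ V} (hL : Y.LiftsAt L y)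
    (hl : ∀ y, Module.finrank ℂ (L y) = l) (hC : IsCompl (L y) C) :
    Y.VecRegularAt (fun y => projAlong C (L y)) y := by
  have h1 : MorphismAt Y (grassmannian l V) (fun y => ofFinrank (L y) (hl y)) y :=
    LiftsAt.morphismAt hL
  exact (SpaceWithFunctions.vecRegularAt_projAlong (W := ofFinrank (L y) (hl y)) hC).comp
    (φ := fun y => ofFinrank (L y) (hl y)) h1

/-- Nested families of subspaces are locally moved to constant ones by linear automorphisms. -/
theorem exists_straightening (hL : ∀ y, Y.LiftsAt L y) (hU : ∀ y, Y.LiftsAt U y)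
    (hl : ∀ y, Module.finrank ℂ (L y) = l) (hm : ∀ y, Module.finrank ℂ (U y) = m)
    (hLU : ∀ y, L y ≤ U y) (y₀ : Y) : ∃ Θ Ψ : Y → Module.End ℂ V, ∀ᶠ y in 𝓝 y₀,
      Y.VecRegularAt Θ y ∧ Y.VecRegularAt Ψ y ∧ (∀ v, Ψ y (Θ y v) = v) ∧ (∀ v, Θ y (Ψ y v) = v) ∧
      (L y₀).map (Θ y) = L y ∧ (U y₀).map (Θ y) = U y := by
  obtain ⟨D, hD⟩ := (L y₀).exists_isCompl
  obtain ⟨C, hC⟩ := (U y₀).exists_isCompl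
  let P := fun y => projAlong D (L y)
  let Q := fun y => projAlong C (U y)
  have hP : Y.VecRegularAt P y₀ := (hL y₀).vecRegularAt_projAlong hl hD
  have hQ : Y.VecRegularAt Q y₀ := (hU y₀).vecRegularAt_projAlong hm hC
  -- On `L y₀` this is `P y`; on `U y₀` the last term vanishes and the others take values in `U y`;
  -- at `y₀` it is the identity, so it is invertible nearby.
  let Θ : Y → Module.End ℂ V := fun y => P y + Q y ∘ₗ (Q y₀ - P y₀) + (1 - Q y₀)
  have hΘ : Y.VecRegularAt Θ y₀ :=
    (hP.add (hQ.linearMap_comp (vecRegularAt_const _ y₀))).add (vecRegularAt_const _ y₀)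
  have hP0 : ∀ v ∈ L y₀, P y₀ v = v := fun v hv => projAlong_of_mem hD hv
  have hQ0 : ∀ v ∈ U y₀, Q y₀ v = v := fun v hv => projAlong_of_mem hC hv
  have hΘ0 : Θ y₀ = 1 := by
    ext v
    have h1 : Q y₀ (Q y₀ v) = Q y₀ v := hQ0 _ (projAlong_apply_mem v)
    have h2 : Q y₀ (P y₀ v) = P y₀ v := hQ0 _ (hLU _ (projAlong_apply_mem v))
    simp [Θ, h1, h2]
  have hΘL : ∀ y, (L y₀).map (Θ y) ≤ L y := by
    rintro y _ ⟨v, hv, rfl⟩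
    have : Θ y v = P y v := by simp [Θ, hP0 v hv, hQ0 v (hLU _ hv)]
    rw [this]
    exact projAlong_apply_mem v
  have hΘU : ∀ y, (U y₀).map (Θ y) ≤ U y := by
    rintro y _ ⟨v, hv, rfl⟩
    have : Θ y v = P y v + Q y (v - P y₀ v) := by simp [Θ, hQ0 v hv]
    rw [this]
    exact add_mem (hLU _ (projAlong_apply_mem v)) (projAlong_apply_mem _)
  obtain ⟨Ψ, hΨ, hΨΘ⟩ := hΘ.exists_inv (by rw [hΘ0]; exact isUnit_one)
  refine ⟨Θ, Ψ, ?_⟩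
  filter_upwards [hΘ.eventually, hΨ.eventually, hΨΘ] with y h1 h2 h3
  have h4 : ∀ v, Ψ y (Θ y v) = v := fun v => LinearMap.congr_fun h3.1 v
  have hinj : Function.Injective (Θ y) := Function.LeftInverse.injective h4
  refine ⟨h1, h2, h4, fun v => LinearMap.congr_fun h3.2 v,
    Submodule.eq_of_le_of_finrank_eq (hΘL y) ?_, Submodule.eq_of_le_of_finrank_eq (hΘU y) ?_⟩
  · rw [hl y, ← hl y₀]
    exact (Submodule.equivMapOfInjective _ hinj _).finrank_eq.symm
  · rw [hm y, ← hm y₀]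
    exact (Submodule.equivMapOfInjective _ hinj _).finrank_eq.symm

/-- Locally the pair (L, U) is straightened to its value at `y₀` by Θ with inverse Ψ, and subspaces
between L and U correspond to subspaces of the quotient. The trivialization is W ↦ ρ(Ψ W), with
inverse M ↦ Θ(L y₀ + γ M). -/
theorem isGrassmannianBundle_between (hL : ∀ y, Y.LiftsAt L y) (hU : ∀ y, Y.LiftsAt U y)
    (hl : ∀ y, Module.finrank ℂ (L y) = l) (hm : ∀ y, Module.finrank ℂ (U y) = m)
    (hLU : ∀ y, L y ≤ U y) (hld : l ≤ d) :
    IsGrassmannianBundle (d - l) (m - l) (X := (Y.prod (grassmannian d V)).restrict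
      {p | L p.1 ≤ sub p.2 ∧ sub p.2 ≤ U p.1}) (Y := Y) fun x => x.1.1 := by
  have hφ : ∀ x, MorphismAt ((Y.prod (grassmannian d V)).restrict
      {p | L p.1 ≤ sub p.2 ∧ sub p.2 ≤ U p.1}) Y (fun x => x.1.1) x := fun x =>
    (morphismAt_fst _).comp (morphismAt_val x)
  refine ⟨isMorphism_iff.2 hφ, fun y₀ => ?_⟩
  obtain ⟨Θ, Ψ, hΘΨ⟩ := exists_straightening hL hU hl hm hLU y₀
  obtain ⟨N, hN, hNo, hyN⟩ := eventually_nhds_iff.1 hΘΨ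
  obtain ⟨ρ, γ, hρ, hργ, hγ, hγρ⟩ := exists_quotient_coordinates (hLU y₀) (hl y₀) (hm y₀)
  have hργ' : ρ ∘ₗ γ = LinearMap.id := LinearMap.ext hργ
  have hρW : ∀ W : Submodule ℂ V, L y₀ ≤ W → W ≤ U y₀ → Module.finrank ℂ W = d →
      Module.finrank ℂ (W.map ρ) = d - l := fun W h1 h2 h3 => by
    have hk : LinearMap.ker ρ ⊓ W = L y₀ := by
      refine le_antisymm ?_ (le_inf (fun v hv => hρ v hv) h1)
      rintro v ⟨hv, hvW⟩
      have := hγρ v (h2 hvW)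
      rwa [LinearMap.mem_ker.1 hv, map_zero, sub_zero] at this
    have := finrank_ker_inf_add_finrank_map ρ W
    rw [hk, hl] at this
    omega
  have hγM : ∀ M : Submodule ℂ (Fin (m - l) → ℂ), Module.finrank ℂ M = d - l →
      Module.finrank ℂ ↥(L y₀ ⊔ M.map γ) = d := fun M hM => by
    have h1 : L y₀ ⊓ M.map γ = ⊥ := by
      rw [eq_bot_iff]
      rintro _ ⟨hv, a, ha, rfl⟩
      have := hρ _ hv
      rw [hργ] at this
      simp [this]
    have h2 : Module.finrank ℂ (M.map γ) = d - l := by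
      rw [← (Submodule.equivMapOfInjective γ (Function.LeftInverse.injective hργ) M).finrank_eq, hM]
    have := Submodule.finrank_sup_add_finrank_inf_eq (L y₀) (M.map γ)
    rw [h1, finrank_bot, h2, hl] at this
    omega
  have hWγ : ∀ W : Submodule ℂ V, L y₀ ≤ W → W ≤ U y₀ → L y₀ ⊔ (W.map ρ).map γ = W :=
    fun W h1 h2 => by
      refine le_antisymm (sup_le h1 ?_) fun w hw => ?_
      · rintro _ ⟨_, ⟨w, hw, rfl⟩, rfl⟩
        have := W.sub_mem hw (h1 (hγρ w (h2 hw)))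
        rwa [sub_sub_cancel] at this
      · exact Submodule.mem_sup.2 ⟨_, hγρ w (h2 hw), γ (ρ w), ⟨_, ⟨w, hw, rfl⟩, rfl⟩, by abel⟩
  have hMρ : ∀ M : Submodule ℂ (Fin (m - l) → ℂ), (L y₀ ⊔ M.map γ).map ρ = M := fun M => by
    rw [Submodule.map_sup, ← Submodule.map_comp, hργ', Submodule.map_id]
    refine sup_eq_right.2 ?_
    rintro _ ⟨v, hv, rfl⟩
    simp [hρ v hv]
  have hΨ : ∀ y ∈ N, ∀ W : Submodule ℂ V, (W.map (Θ y)).map (Ψ y) = W := fun y hy W => by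
    rw [← Submodule.map_comp, show Ψ y ∘ₗ Θ y = LinearMap.id from LinearMap.ext (hN y hy).2.2.1,
      Submodule.map_id]
  have hΘ : ∀ y ∈ N, ∀ W : Submodule ℂ V, (W.map (Ψ y)).map (Θ y) = W := fun y hy W => by
    rw [← Submodule.map_comp, show Θ y ∘ₗ Ψ y = LinearMap.id from LinearMap.ext (hN y hy).2.2.2.1,
      Submodule.map_id]
  have hΨL : ∀ y ∈ N, ∀ W, L y ≤ W → L y₀ ≤ W.map (Ψ y) := fun y hy W hW => by
    rw [← hΨ y hy (L y₀), (hN y hy).2.2.2.2.1]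
    exact Submodule.map_mono hW
  have hΨU : ∀ y ∈ N, ∀ W, W ≤ U y → W.map (Ψ y) ≤ U y₀ := fun y hy W hW => by
    rw [← hΨ y hy (U y₀), (hN y hy).2.2.2.2.2]
    exact Submodule.map_mono hW
  have hΨd : ∀ y ∈ N, ∀ W : Submodule ℂ V, Module.finrank ℂ (W.map (Ψ y)) = Module.finrank ℂ W :=
    fun y hy W => (Submodule.equivMapOfInjective (Ψ y)
      (Function.LeftInverse.injective (hN y hy).2.2.2.1) W).finrank_eq.symm
  have hΘd : ∀ y ∈ N, ∀ W : Submodule ℂ V, Module.finrank ℂ (W.map (Θ y)) = Module.finrank ℂ W :=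
    fun y hy W => (Submodule.equivMapOfInjective (Θ y)
      (Function.LeftInverse.injective (hN y hy).2.2.1) W).finrank_eq.symm
  let X' := (Y.prod (grassmannian d V)).restrict {p | L p.1 ≤ sub p.2 ∧ sub p.2 ≤ U p.1}
  let φ : X' → Y := fun x => x.1.1
  let XN := X'.restrict (φ ⁻¹' N)
  let B := (Y.restrict N).prod (grassmannian (d - l) (Fin (m - l) → ℂ))
  have hφN : ∀ x : XN, MorphismAt XN Y (fun x => φ x.1) x := fun x =>
    (hφ x.1).comp (morphismAt_val x)
  have hWN : ∀ x : XN, MorphismAt XN (grassmannian d V) (fun x => x.1.1.2) x := fun x =>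
    (morphismAt_snd _).comp ((morphismAt_val x.1).comp (morphismAt_val x))
  let e : XN → B := fun x => (⟨φ x.1, x.2⟩, ofFinrank (((sub x.1.1.2).map (Ψ (φ x.1))).map ρ)
    (hρW _ (hΨL _ x.2 _ x.1.2.1) (hΨU _ x.2 _ x.1.2.2)
      ((hΨd _ x.2 _).trans (finrank_sub x.1.1.2))))
  have he : ∀ x, MorphismAt XN B e x := fun x => by
    refine (morphismAt_restrict (hφN x)).prodMk (LiftsAt.morphismAt ?_)
    exact ((hWN x).liftsAt.map (((hN _ x.2).2.1).comp (φ := fun x : XN => φ x.1) (hφN x))).map (vecRegularAt_const ρ x)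
  have hyB : ∀ b : B, MorphismAt B Y (fun b => b.1.1) b := fun b =>
    (morphismAt_val _).comp (morphismAt_fst b)
  have hW : ∀ b : B, L b.1.1 ≤ (L y₀ ⊔ (sub b.2).map γ).map (Θ b.1.1) ∧
      (L y₀ ⊔ (sub b.2).map γ).map (Θ b.1.1) ≤ U b.1.1 := fun b => by
    refine ⟨?_, ?_⟩
    · refine le_trans ?_ (Submodule.map_mono (le_sup_left : L y₀ ≤ L y₀ ⊔ (sub b.2).map γ))
      exact (hN _ b.1.2).2.2.2.2.1.ge
    · refine le_trans (Submodule.map_mono (sup_le (hLU y₀) ?_)) (hN _ b.1.2).2.2.2.2.2.le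
      rintro _ ⟨a, -, rfl⟩
      exact hγ a
  let σ : B → XN := fun b => ⟨⟨(b.1.1, ofFinrank ((L y₀ ⊔ (sub b.2).map γ).map (Θ b.1.1))
    ((hΘd _ b.1.2 _).trans (hγM _ (finrank_sub b.2)))), hW b⟩, b.1.2⟩
  have hσ : ∀ b, MorphismAt B XN σ b := fun b => by
    refine morphismAt_restrict (morphismAt_restrict ((hyB b).prodMk (LiftsAt.morphismAt ?_)))
    have h1 : B.LiftsAt (fun b => sub b.2) b := (morphismAt_snd b).liftsAt
    exact ((liftsAt_const (L y₀) b).sup (h1.map (vecRegularAt_const γ b))).map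
      ((hN _ b.1.2).1.comp (φ := fun b : B => b.1.1) (hyB b))
  refine ⟨N, hNo, hyN, e, ⟨isMorphism_iff.2 he, σ, isMorphism_iff.2 hσ, fun x => ?_, fun b => ?_⟩,
    fun x => rfl⟩
  · refine Subtype.ext (Subtype.ext (Prod.ext rfl (grassmannian_ext ?_)))
    change (L y₀ ⊔ (((sub x.1.1.2).map (Ψ (φ x.1))).map ρ).map γ).map (Θ (φ x.1)) = sub x.1.1.2
    rw [hWγ _ (hΨL _ x.2 _ x.1.2.1) (hΨU _ x.2 _ x.1.2.2), hΘ _ x.2]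
  · refine Prod.ext rfl (grassmannian_ext ?_)
    change (((L y₀ ⊔ (sub b.2).map γ).map (Θ b.1.1)).map (Ψ b.1.1)).map ρ = sub b.2
    rw [hΨ _ b.1.2, hMρ]

end between

/-! ### Adding an entry to a family of subspaces -/

section iso

variable {X : SpaceWithFunctions.{u}} {Y : SpaceWithFunctions.{v}} {Z : SpaceWithFunctions.{w}}

/-- A single inverse over `W` serves all subsets `W'`, such as the cell inside the rank locus. -/
theorem IsMorphism.isIsomorphismOver {φ : X → Y} (hφ : IsMorphism φ) {W W' : Set Y} (hW : W' ⊆ W)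
    {ψ : Y.restrict W → X} (hψ : IsMorphism ψ) (h1 : ∀ y, φ (ψ y) = y.1)
    (h2 : ∀ x (hx : φ x ∈ W), ψ ⟨φ x, hx⟩ = x) : IsIsomorphismOver φ W' := by
  let χ : Y.restrict W' → X.restrict (φ ⁻¹' W') := fun y =>
    ⟨ψ ⟨y.1, hW y.2⟩, (congrArg (· ∈ W') (h1 ⟨y.1, hW y.2⟩)).mpr y.2⟩
  refine ⟨isMorphism_iff.2 fun x => morphismAt_restrict ?_, χ, isMorphism_iff.2 fun y =>
    morphismAt_restrict ?_, fun x => Subtype.ext ?_, fun y => Subtype.ext ?_⟩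
  · exact (isMorphism_iff.1 hφ x.1).comp (morphismAt_val x)
  · have h3 : MorphismAt (Y.restrict W') (Y.restrict W) (fun y => ⟨y.1, hW y.2⟩) y :=
      morphismAt_restrict (morphismAt_val y)
    exact (isMorphism_iff.1 hψ _).comp h3
  · exact h2 _ _
  · exact h1 _

theorem IsGrassmannianBundle.comp_isIsomorphism {p q : ℕ} {e : X → Y} {φ : Y → Z}
    (hφ : IsGrassmannianBundle p q φ) (he : IsIsomorphism e) :
    IsGrassmannianBundle p q fun x => φ (e x) := by
  refine ⟨hφ.1.comp he.1, fun z => ?_⟩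
  obtain ⟨U, hU, hzU, t, ht, htφ⟩ := hφ.2 z
  obtain ⟨he1, e', he', hl, hr⟩ := he
  have h1 : IsIsomorphismOver e (φ ⁻¹' U) := he1.isIsomorphismOver subset_rfl
    (ψ := fun y => e' y.1) (he'.comp isMorphism_val) (fun y => hr y.1) fun x _ => hl x
  exact ⟨U, hU, hzU, _, ht.comp h1, fun x => htφ _⟩

end iso

section update

variable {V : Type u} [AddCommGroup V] [Module ℂ V] [FiniteDimensional ℂ V] {ι : Type}
  [DecidableEq ι] {d : ι → ℕ}

theorem morphismAt_update {X : SpaceWithFunctions.{u}} {p : ι}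
    {φ : X → pi fun i => grassmannian (d i) V} {ψ : X → grassmannian (d p) V} {x : X}
    (hφ : MorphismAt X (pi fun i => grassmannian (d i) V) φ x)
    (hψ : MorphismAt X (grassmannian (d p) V) ψ x) :
    MorphismAt X (pi fun i => grassmannian (d i) V)
      (fun x => Function.update (φ x) p (ψ x)) x := by
  refine morphismAt_pi (A := fun i => grassmannian (d i) V) fun i => ?_
  by_cases hi : i = p
  · subst hi
    exact hψ.congr (.of_forall fun x => (Function.update_self i (ψ x) (φ x)).symm)
  · exact ((morphismAt_eval (A := fun i => grassmannian (d i) V) i (φ x)).comp hφ).congr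
      (.of_forall fun x => (Function.update_of_ne hi (ψ x) (φ x)).symm)

/-- Choosing one more entry between bounds given by the other entries is a Grassmannian bundle. -/
theorem exists_isGrassmannianBundle_update {S S' : Set (∀ i, grassmannian (d i) V)} {p : ι}
    {w₀ : grassmannian (d p) V} {L U : (∀ i, grassmannian (d i) V) → Submodule ℂ V} {l m : ℕ}
    (hL : ∀ W, (pi fun i => grassmannian (d i) V).LiftsAt L W)
    (hU : ∀ W, (pi fun i => grassmannian (d i) V).LiftsAt U W)
    (hl : ∀ W, Module.finrank ℂ (L W) = l) (hm : ∀ W, Module.finrank ℂ (U W) = m)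
    (hLp : ∀ W w, L (Function.update W p w) = L W) (hUp : ∀ W w, U (Function.update W p w) = U W)
    (hS : ∀ W ∈ S, W p = w₀ ∧ L W ≤ U W)
    (hS' : ∀ W ∈ S', Function.update W p w₀ ∈ S ∧ L W ≤ sub (W p) ∧ sub (W p) ≤ U W)
    (hSS' : ∀ W ∈ S, ∀ w, L W ≤ sub w → sub w ≤ U W → Function.update W p w ∈ S')
    (hld : l ≤ d p) :
    ∃ φ, IsGrassmannianBundle (d p - l) (m - l)
      (X := (pi fun i => grassmannian (d i) V).restrict S')
      (Y := (pi fun i => grassmannian (d i) V).restrict S) φ := by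
  let P := pi fun i => grassmannian (d i) V
  let X := P.restrict S'
  let Y := P.restrict S
  let B := (Y.prod (grassmannian (d p) V)).restrict {b | L b.1.1 ≤ sub b.2 ∧ sub b.2 ≤ U b.1.1}
  have hb : IsGrassmannianBundle (d p - l) (m - l) (X := B) (Y := Y) fun b => b.1.1 :=
    isGrassmannianBundle_between (L := fun y : Y => L y.1) (U := fun y : Y => U y.1)
      (fun y => (hL y.1).comp (morphismAt_val y)) (fun y => (hU y.1).comp (morphismAt_val y))
      (fun y => hl y.1) (fun y => hm y.1) (fun y => (hS y.1 y.2).2) hld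
  -- The entry at `p` is moved to the second factor and its place filled by the fixed value `w₀`, so
  -- that all stages of the tower live in the same product.
  let e : X → B := fun x => ⟨(⟨Function.update x.1 p w₀, (hS' x.1 x.2).1⟩, x.1 p),
    (hLp _ w₀).le.trans (hS' x.1 x.2).2.1, (hS' x.1 x.2).2.2.trans (hUp _ w₀).ge⟩
  let e' : B → X := fun b => ⟨Function.update b.1.1.1 p b.1.2, hSS' _ b.1.1.2 _ b.2.1 b.2.2⟩
  have he : ∀ x, MorphismAt X B e x := fun x => by
    refine morphismAt_restrict ((morphismAt_restrict (morphismAt_update (morphismAt_val x)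
      (morphismAt_const w₀ x))).prodMk ?_)
    exact (morphismAt_eval p x.1).comp (φ := fun x : X => x.1) (morphismAt_val x)
  have he' : ∀ b, MorphismAt B X e' b := fun b =>
    morphismAt_restrict (morphismAt_update ((morphismAt_val _).comp
      ((morphismAt_fst _).comp (morphismAt_val b))) ((morphismAt_snd _).comp (morphismAt_val b)))
  refine ⟨_, hb.comp_isIsomorphism (e := e) ⟨isMorphism_iff.2 he, e', isMorphism_iff.2 he',
    fun x => Subtype.ext ?_, fun b => Subtype.ext (Prod.ext (Subtype.ext ?_) ?_)⟩⟩
  · exact (Function.update_idem _ _ _).trans (Function.update_eq_self _ _)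
  · exact (Function.update_idem _ _ _).trans
      ((congrArg _ (hS _ b.1.1.2).1.symm).trans (Function.update_eq_self _ _))
  · exact Function.update_self _ _ _

end update

end SpaceWithFunctions

/-! ### The variety of diagrams as a tower of projective space bundles -/

namespace SchubertIndex

open SpaceWithFunctions

variable {h n : ℕ} {K : FlagDims h} (I : SchubertIndex K n) {V : Type u} [AddCommGroup V]
  [Module ℂ V] [FiniteDimensional ℂ V] (F : CompleteFlag V n)

/-- One further column contributes at most one index. This is why the fibres of the tower are points
or projective spaces. -/
theorem μ_le_succ (t : Fin h) {i j : Fin K.top} (hij : (i : ℕ) ≤ j + 1) : I.μ t i ≤ I.μ t j + 1 := by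
  classical
  unfold μ
  have : (Finset.univ.filter fun i' => i' ≤ i ∧ I.α i' ≤ t) ⊆
      insert i (Finset.univ.filter fun i' => i' ≤ j ∧ I.α i' ≤ t) := by
    intro k
    simp only [Finset.mem_filter, Finset.mem_univ, true_and, Finset.mem_insert, Fin.le_def,
      Fin.ext_iff]
    omega
  exact (Finset.card_le_card this).trans (Finset.card_insert_le _ _)

theorem μ_le_one (t : Fin h) {i : Fin K.top} (hi : (i : ℕ) = 0) : I.μ t i ≤ 1 := by
  classical
  unfold μ
  have : (Finset.univ.filter fun i' => i' ≤ i ∧ I.α i' ≤ t) ⊆ {i} := by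
    intro k
    simp only [Finset.mem_filter, Finset.mem_univ, true_and, Finset.mem_singleton, Fin.le_def,
      Fin.ext_iff]
    omega
  exact (Finset.card_le_card this).trans (by simp)

/-- Diagrams in which only the entries in `J` are free, the others being those of `W₀`. -/
def partialDiagrams (W₀ : ∀ p : Fin h × Fin K.top, grassmannian (I.μ p.1 p.2) V)
    (J : Set (Fin h × Fin K.top)) : Set (∀ p : Fin h × Fin K.top, grassmannian (I.μ p.1 p.2) V) :=
  {W | (∀ p ∉ J, W p = W₀ p) ∧ (∀ p ∈ J, ∀ p' ∈ J, p ≤ p' → sub (W p) ≤ sub (W p')) ∧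
    ∀ p ∈ J, sub (W p) ≤ F.F (I.a p.2)}

theorem mem_partialDiagrams_univ {W₀ W : ∀ p : Fin h × Fin K.top, grassmannian (I.μ p.1 p.2) V} :
    W ∈ I.partialDiagrams F W₀ Set.univ ↔
      (∀ t i i', i ≤ i' → sub (W (t, i)) ≤ sub (W (t, i'))) ∧
      (∀ t t' i, t ≤ t' → sub (W (t, i)) ≤ sub (W (t', i))) ∧
      ∀ t i, sub (W (t, i)) ≤ F.F (I.a i) := by
  constructor
  · rintro ⟨-, h1, h2⟩
    exact ⟨fun t i i' hi => h1 _ trivial _ trivial ⟨le_rfl, hi⟩,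
      fun t t' i ht => h1 _ trivial _ trivial ⟨ht, le_rfl⟩, fun t i => h2 (t, i) trivial⟩
  · rintro ⟨h1, h2, h3⟩
    exact ⟨fun p hp => absurd trivial hp,
      fun p _ p' _ hp => (h1 p.1 p.2 p'.2 hp.2).trans (h2 p.1 p'.1 p'.2 hp.1),
      fun p _ => h3 p.1 p.2⟩

/-- An entry is added to a partial diagram between the previous entry of its row and the next
entry of its column. -/
theorem exists_bundle_insert {W₀ : ∀ p : Fin h × Fin K.top, grassmannian (I.μ p.1 p.2) V}
    (hW₀ : W₀ ∈ I.partialDiagrams F W₀ Set.univ) {J : Set (Fin h × Fin K.top)}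
    {p : Fin h × Fin K.top} (hp : p ∉ J)
    (hlow : ((p.2 : ℕ) = 0 ∧ ∀ q ∈ J, ¬ q ≤ p) ∨ ∃ r ∈ J, r ≤ p ∧ r.1 = p.1 ∧
      (p.2 : ℕ) ≤ r.2 + 1 ∧ ∀ q ∈ J, q ≤ p → q ≤ r)
    (hupp : (∀ q ∈ J, ¬ p ≤ q) ∨ ∃ r ∈ J, p ≤ r ∧ r.2 = p.2 ∧ ∀ q ∈ J, p ≤ q → r ≤ q) :
    ∃ (a b : ℕ) (_ : a ≤ 1) (_ : a ≤ b), ∃ φ, IsGrassmannianBundle a b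
      (X := (I.diagramProduct V).restrict (I.partialDiagrams F W₀ (insert p J)))
      (Y := (I.diagramProduct V).restrict (I.partialDiagrams F W₀ J)) φ := by
  classical
  have hF : ∀ i i', i ≤ i' → F.F (I.a i) ≤ F.F (I.a i') := fun i i' hi =>
    F.mono (I.a_strictMono.monotone hi)
  -- Lower bound for the new entry: zero in the first column, otherwise the entry `r` on its left,
  -- whose dimension is smaller by at most 1.
  obtain ⟨L, l, hL, hl, hLp, hd, hLW₀, hLmem, hLins⟩ :
      ∃ (L : (∀ p : Fin h × Fin K.top, grassmannian (I.μ p.1 p.2) V) → Submodule ℂ V) (l : ℕ),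
      (∀ W, (I.diagramProduct V).LiftsAt L W) ∧ (∀ W, Module.finrank ℂ (L W) = l) ∧
      (∀ W w, L (Function.update W p w) = L W) ∧ I.μ p.1 p.2 - l ≤ 1 ∧ L W₀ ≤ sub (W₀ p) ∧
      (∀ W ∈ I.partialDiagrams F W₀ (insert p J), L W ≤ sub (W p)) ∧
      ∀ W ∈ I.partialDiagrams F W₀ J, (∀ q ∈ J, q ≤ p → sub (W q) ≤ L W) ∧
        L W ≤ F.F (I.a p.2) ∧ ∀ q ∈ J, p ≤ q → L W ≤ sub (W q) := by
    obtain ⟨h0, hno⟩ | ⟨r, hr, hrp, hr1, hr2, hrm⟩ := hlow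
    · refine ⟨fun _ => ⊥, 0, fun W => liftsAt_const _ W, fun _ => finrank_bot ℂ V, fun _ _ => rfl,
        by have := I.μ_le_one p.1 h0; omega, bot_le, fun _ _ => bot_le,
        fun W hW => ⟨fun q hq hqp => absurd hqp (hno q hq), bot_le, fun _ _ _ => bot_le⟩⟩
    · have hne : r ≠ p := fun h => hp (h ▸ hr)
      refine ⟨fun W => sub (W r), I.μ r.1 r.2, fun W => (morphismAt_eval r W).liftsAt,
        fun W => finrank_sub (W r), fun W w => by simp [hne], ?_, hW₀.2.1 _ trivial _ trivial hrp,
        fun W hW => hW.2.1 _ (.inr hr) _ (.inl rfl) hrp, fun W hW =>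
        ⟨fun q hq hqp => hW.2.1 _ hq _ hr (hrm q hq hqp), (hW.2.2 r hr).trans (hF _ _ hrp.2),
          fun q hq hpq => hW.2.1 _ hr _ hq (hrp.trans hpq)⟩⟩
      have := I.μ_le_succ p.1 hr2
      rw [hr1]
      omega
  -- Upper bound: the flag member if no entry of `J` lies above `p`, otherwise the least such entry;
  -- being in the same column, it already lies in that flag member.
  obtain ⟨U, m, hU, hm, hUp, hUW₀, hUmem, hUins⟩ :
      ∃ (U : (∀ p : Fin h × Fin K.top, grassmannian (I.μ p.1 p.2) V) → Submodule ℂ V) (m : ℕ),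
      (∀ W, (I.diagramProduct V).LiftsAt U W) ∧ (∀ W, Module.finrank ℂ (U W) = m) ∧
      (∀ W w, U (Function.update W p w) = U W) ∧ sub (W₀ p) ≤ U W₀ ∧
      (∀ W ∈ I.partialDiagrams F W₀ (insert p J), sub (W p) ≤ U W) ∧
      ∀ W ∈ I.partialDiagrams F W₀ J, (∀ q ∈ J, p ≤ q → U W ≤ sub (W q)) ∧
        U W ≤ F.F (I.a p.2) ∧ ∀ S : Submodule ℂ V, S ≤ F.F (I.a p.2) →
          (∀ q ∈ J, p ≤ q → S ≤ sub (W q)) → S ≤ U W := by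
    obtain hno | ⟨r, hr, hpr, hr2, hrm⟩ := hupp
    · exact ⟨fun _ => F.F (I.a p.2), _, fun W => liftsAt_const _ W, fun _ => rfl, fun _ _ => rfl,
        hW₀.2.2 p trivial, fun W hW => hW.2.2 p (.inl rfl),
        fun W hW => ⟨fun q hq hqp => absurd hqp (hno q hq), le_rfl, fun S hS _ => hS⟩⟩
    · have hne : r ≠ p := fun h => hp (h ▸ hr)
      exact ⟨fun W => sub (W r), I.μ r.1 r.2, fun W => (morphismAt_eval r W).liftsAt,
        fun W => finrank_sub (W r), fun W w => by simp [hne], hW₀.2.1 _ trivial _ trivial hpr,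
        fun W hW => hW.2.1 _ (.inl rfl) _ (.inr hr) hpr, fun W hW =>
        ⟨fun q hq hqp => hW.2.1 _ hr _ hq (hrm q hq hqp), hr2 ▸ hW.2.2 r hr,
          fun S _ hS => hS r hr hpr⟩⟩
  -- The given full diagram `W₀` has an entry between the two bounds, which yields the inequalities
  -- making the fibre non-empty.
  have hld : l ≤ I.μ p.1 p.2 := by
    rw [← hl W₀, ← finrank_sub (W₀ p)]
    exact Submodule.finrank_mono hLW₀
  have hdm : I.μ p.1 p.2 ≤ m := by
    rw [← hm W₀, ← finrank_sub (W₀ p)]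
    exact Submodule.finrank_mono hUW₀
  refine ⟨I.μ p.1 p.2 - l, m - l, hd, by omega, ?_⟩
  refine exists_isGrassmannianBundle_update (d := fun p : Fin h × Fin K.top => I.μ p.1 p.2)
    (w₀ := W₀ p) hL hU hl hm hLp hUp (fun W hW => ⟨hW.1 p hp, ?_⟩) (fun W hW => ⟨?_, hLmem W hW,
      hUmem W hW⟩) (fun W hW w hw hw' => ?_) hld
  · exact (hUins W hW).2.2 _ (hLins W hW).2.1 (hLins W hW).2.2
  · have hJ : ∀ q ∈ J, Function.update W p (W₀ p) q = W q := fun q hq =>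
      Function.update_of_ne (fun h : q = p => hp (h ▸ hq)) _ _
    refine ⟨fun q hq => ?_, fun q hq q' hq' hqq' => ?_, fun q hq => ?_⟩
    · by_cases hqp : q = p
      · subst hqp; simp
      · rw [Function.update_of_ne hqp]
        exact hW.1 q (by simp [hqp, hq])
    · rw [hJ q hq, hJ q' hq']
      exact hW.2.1 _ (.inr hq) _ (.inr hq') hqq'
    · rw [hJ q hq]
      exact hW.2.2 q (.inr hq)
  · have hJ : ∀ q ∈ J, Function.update W p w q = W q := fun q hq =>
      Function.update_of_ne (fun h : q = p => hp (h ▸ hq)) _ _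
    have hpp : Function.update W p w p = w := Function.update_self _ _ _
    refine ⟨fun q hq => ?_, ?_, ?_⟩
    · simp only [Set.mem_insert_iff, not_or] at hq
      rw [Function.update_of_ne hq.1]
      exact hW.1 q hq.2
    · rintro q (rfl | hq) q' (rfl | hq') hqq'
      · exact le_rfl
      · rw [hpp, hJ q' hq']
        exact hw'.trans ((hUins W hW).1 q' hq' hqq')
      · rw [hpp, hJ q hq]
        exact ((hLins W hW).1 q hq hqq').trans hw
      · rw [hJ q hq, hJ q' hq']
        exact hW.2.1 _ hq _ hq' hqq'
    · rintro q (rfl | hq)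
      · rw [hpp]
        exact hw'.trans (hUins W hW).2.1
      · rw [hJ q hq]
        exact hW.2.2 q hq

theorem mul_add_lt_mul_add_iff {k a b c e : ℕ} (hb : b < k) (he : e < k) :
    c * k + e < a * k + b ↔ c < a ∨ (c = a ∧ e < b) := by
  rcases lt_trichotomy c a with hca | rfl | hca
  · have := Nat.mul_le_mul_right k (Nat.succ_le_of_lt hca)
    rw [Nat.succ_mul] at this
    omega
  · omega
  · have := Nat.mul_le_mul_right k (Nat.succ_le_of_lt hca)
    rw [Nat.succ_mul] at this
    omega

/-- The free entries are the first `s` in the order that runs through the rows from the last one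
downwards and from left to right in each row. When p is added, the free entries below it are those
on its left in its row, and those above it lie in later rows, the least being its neighbour in the
next row. -/
theorem isProjectiveTower_partialDiagrams
    {W₀ : ∀ p : Fin h × Fin K.top, grassmannian (I.μ p.1 p.2) V}
    (hW₀ : W₀ ∈ I.partialDiagrams F W₀ Set.univ) (s : ℕ) (hs : s ≤ h * K.top) :
    IsProjectiveTower ((I.diagramProduct V).restrict (I.partialDiagrams F W₀
      {q | (h - 1 - q.1) * K.top + q.2 < s})) := by
  induction s with
  | zero =>
    have h0 : I.partialDiagrams F W₀ {q | (h - 1 - q.1) * K.top + q.2 < 0} = {W₀} := by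
      ext W
      simp [partialDiagrams, funext_iff]
    rw [h0]
    exact .point _ ⟨⟨W₀, rfl⟩⟩ ⟨fun x y => Subtype.ext (x.2.trans y.2.symm)⟩
  | succ s ih =>
    have hk : 0 < K.top := Nat.pos_of_ne_zero fun h0 => by simp [h0] at hs
    obtain ⟨a, b, ha, hb, rfl⟩ : ∃ a b, a < h ∧ b < K.top ∧ s = a * K.top + b :=
      ⟨s / K.top, s % K.top, Nat.div_lt_of_lt_mul (by rw [mul_comm]; omega), Nat.mod_lt s hk,
        (Nat.div_add_mod' s K.top).symm⟩
    let p : Fin h × Fin K.top := (⟨h - 1 - a, by omega⟩, ⟨b, hb⟩)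
    have hlt : ∀ q : Fin h × Fin K.top, (h - 1 - q.1) * K.top + q.2 < a * K.top + b ↔
        (p.1 : ℕ) < q.1 ∨ ((p.1 : ℕ) = q.1 ∧ (q.2 : ℕ) < p.2) := fun q => by
      have hq := q.1.2
      rw [mul_add_lt_mul_add_iff hb q.2.2]
      simp only [p]
      omega
    have hins : {q : Fin h × Fin K.top | (h - 1 - q.1) * K.top + q.2 < a * K.top + b + 1} =
        insert p {q | (h - 1 - q.1) * K.top + q.2 < a * K.top + b} := by
      ext q
      have hq := q.1.2
      rw [Set.mem_insert_iff, Set.mem_ofPred_eq, Set.mem_ofPred_eq, Nat.lt_succ_iff_lt_or_eq,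
        or_comm]
      refine or_congr_left ⟨fun he => ?_, fun he => ?_⟩
      · have h1 := (mul_add_lt_mul_add_iff (c := h - 1 - q.1) hb q.2.2).not.1 he.not_lt
        have h2 := (mul_add_lt_mul_add_iff (a := h - 1 - q.1) q.2.2 hb).not.1 he.not_gt
        refine Prod.ext (Fin.ext ?_) (Fin.ext ?_) <;> simp only [p] <;> omega
      · subst he
        simp only [p]
        rw [show h - 1 - (h - 1 - a) = a by omega]
    have hmem : ∀ q : Fin h × Fin K.top, q ∈ {q : Fin h × Fin K.top |
        (h - 1 - q.1) * K.top + q.2 < a * K.top + b} ↔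
        (p.1 : ℕ) < q.1 ∨ ((p.1 : ℕ) = q.1 ∧ (q.2 : ℕ) < p.2) := hlt
    rw [hins]
    have hbundle := I.exists_bundle_insert F hW₀ (p := p)
      (J := {q | (h - 1 - q.1) * K.top + q.2 < a * K.top + b})
      (by rw [hmem]; omega) ?_ ?_
    · obtain ⟨c, e, hc, hce, φ, hφ⟩ := hbundle
      exact .bundle _ _ φ c e hc hce hφ (ih (by omega))
    · by_cases hb0 : b = 0
      · refine .inl ⟨hb0, fun q hq hqp => ?_⟩
        rw [hmem] at hq
        have h1 : (q.1 : ℕ) ≤ p.1 := hqp.1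
        have h2 : (p.2 : ℕ) = 0 := hb0
        omega
      · have hp2 : (p.2 : ℕ) = b := rfl
        refine .inr ⟨(p.1, ⟨b - 1, by omega⟩), ?_, ⟨le_rfl, ?_⟩, rfl, ?_, fun q hq hqp => ⟨hqp.1, ?_⟩⟩
        · rw [hmem]
          exact .inr ⟨rfl, show b - 1 < b by omega⟩
        · exact show b - 1 ≤ b by omega
        · exact show b ≤ b - 1 + 1 by omega
        · rw [hmem] at hq
          have h1 : (q.1 : ℕ) ≤ p.1 := hqp.1
          rw [Fin.le_def]
          simp only
          omega
    · by_cases ha0 : a = 0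
      · refine .inl fun q hq hpq => ?_
        rw [hmem] at hq
        have h1 : (p.2 : ℕ) ≤ q.2 := hpq.2
        have h2 : (p.1 : ℕ) = h - 1 - a := rfl
        have h3 := q.1.2
        omega
      · have h2 : (p.1 : ℕ) = h - 1 - a := rfl
        refine .inr ⟨(⟨p.1 + 1, by omega⟩, p.2), ?_, ⟨?_, le_rfl⟩, rfl, fun q hq hpq => ⟨?_, hpq.2⟩⟩
        · rw [hmem]
          simp only
          omega
        · rw [Fin.le_def]
          simp only
          omega
        · rw [hmem] at hq
          have h1 : (p.2 : ℕ) ≤ q.2 := hpq.2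
          rw [Fin.le_def]
          simp only
          omega

theorem isProjectiveTower_diagrams (hne : Nonempty (I.diagrams F)) :
    IsProjectiveTower (I.diagrams F) := by
  obtain ⟨W₀, hW₀⟩ := hne
  have h1 := I.isProjectiveTower_partialDiagrams F ((I.mem_partialDiagrams_univ F).2 hW₀) _ le_rfl
  have h2 : {q : Fin h × Fin K.top | (h - 1 - q.1) * K.top + q.2 < h * K.top} = Set.univ := by
    refine Set.eq_univ_of_forall fun q => ?_
    have := q.1.2
    exact (mul_add_lt_mul_add_iff (b := 0) (by have := q.2.2; omega) q.2.2).2 (.inl (by omega))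
  have h3 : I.partialDiagrams F W₀ Set.univ = _ :=
    Set.ext fun W => I.mem_partialDiagrams_univ F (W₀ := W₀) (W := W)
  rw [h2, h3] at h1
  exact h1

end SchubertIndex

namespace SpaceWithFunctions

/-! ### Intersection with a fixed subspace -/

section inf

variable {X : SpaceWithFunctions.{u}} {V : Type v} [AddCommGroup V] [Module ℂ V]
  [FiniteDimensional ℂ V]

/-- The intersection with a fixed subspace lifts where it has constant dimension. -/
theorem LiftsAt.inf_const {S : X → Submodule ℂ V} {x : X} (hS : X.LiftsAt S x) (F : Submodule ℂ V)
    {k l : ℕ} (hk : ∀ y, Module.finrank ℂ (S y) = k)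
    (hl : ∀ y, Module.finrank ℂ ↥(F ⊓ S y) = l) : X.LiftsAt (fun y => F ⊓ S y) x := by
  classical
  have hr : ∀ y, Module.finrank ℂ ((S y).map F.mkQ) = k - l := fun y => by
    have := finrank_ker_inf_add_finrank_map F.mkQ (S y)
    rw [Submodule.ker_mkQ, hk, hl] at this
    omega
  let b := Module.finBasisOfFinrankEq ℂ ((S x).map F.mkQ) (hr x)
  have hb : LinearIndependent ℂ (fun i => (b i : V ⧸ F)) :=
    b.linearIndependent.map' (Submodule.subtype _) (Submodule.ker_subtype _)
  choose d₀ hd₀ hd₀' using fun i => (b i).2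
  choose d hd hdx hdS using fun i => hS (d₀ i) (hd₀ i)
  let lc : (Fin (k - l) → V ⧸ F) →ₗ[ℂ] ((Fin (k - l) → ℂ) →ₗ[ℂ] V ⧸ F) :=
    { toFun := fun A => Fintype.linearCombination ℂ A
      map_add' := fun A B => by
        ext; simp [Fintype.linearCombination_apply, Finset.sum_add_distrib]
      map_smul' := fun c A => by ext; simp [Fintype.linearCombination_apply] }
  let g : X → Fin (k - l) → V ⧸ F := fun y i => F.mkQ (d i y)
  have hg : X.VecRegularAt g x := vecRegularAt_pi fun i => (hd i).map F.mkQ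
  have hgx : g x = fun i => (b i : V ⧸ F) := funext fun i => by simp only [g, hdx, hd₀']
  obtain ⟨s, hs⟩ := LinearMap.exists_leftInverse_of_injective (lc (g x)) (LinearMap.ker_eq_bot.2
    (linearIndependent_iff_injective_fintypeLinearCombination.1 (by rw [hgx]; exact hb)))
  have hT : X.VecRegularAt (fun y => (s ∘ₗ lc (g y) : Module.End ℂ (Fin (k - l) → ℂ))) x :=
    (vecRegularAt_const s x).linearMap_comp (hg.map lc)
  obtain ⟨R, hR, hRT⟩ := hT.exists_inv (by rw [hs]; exact isUnit_one)
  rintro w ⟨hwF, hwS⟩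
  obtain ⟨f, hf, rfl, hfS⟩ := hS w hwS
  have hc : X.VecRegularAt (fun y => R y (s (F.mkQ (f y)))) x :=
    hR.apply ((hf.map F.mkQ).map s)
  -- The sections `d i` of the family have classes modulo `F` forming a basis of the image of `S x`.
  -- Subtracting from f the combination of them with the same class modulo `F` moves it into `F`; at
  -- `x` the correction is zero.
  refine ⟨fun y => f y - ∑ i, R y (s (F.mkQ (f y))) i • d i y,
    hf.sub (.sum fun i _ => (hc.map (LinearMap.proj i)).regularAt.smul (hd i)), ?_, ?_⟩
  · have : F.mkQ (f x) = 0 := (Submodule.Quotient.mk_eq_zero F).2 hwF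
    simp only [this, map_zero, Pi.zero_apply, zero_smul, Finset.sum_const_zero, sub_zero]
  · filter_upwards [hRT, hfS, eventually_all.2 hdS] with y h1 h2 h3
    have hmem : f y - ∑ i, R y (s (F.mkQ (f y))) i • d i y ∈ S y :=
      (S y).sub_mem h2 ((S y).sum_mem fun i _ => (S y).smul_mem _ (h3 i))
    refine ⟨?_, hmem⟩
    -- Constancy of the dimension of the intersection enters here: the image modulo `F` does not
    -- grow, so the classes of the `d i` still span it near `x`.
    have hrange : LinearMap.range (lc (g y)) = (S y).map F.mkQ := by
      refine Submodule.eq_of_le_of_finrank_eq ?_ ?_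
      · rw [show LinearMap.range (lc (g y)) = Submodule.span ℂ (Set.range (g y)) from
          Fintype.range_linearCombination ℂ (g y), Submodule.span_le]
        rintro _ ⟨i, rfl⟩
        exact ⟨_, h3 i, rfl⟩
      · rw [hr, LinearMap.finrank_range_of_inj, Module.finrank_fin_fun]
        intro a a' haa'
        rw [← Module.End.one_apply (R := ℂ) a, ← Module.End.one_apply (R := ℂ) a', ← h1.1]
        simp only [Module.End.mul_apply, LinearMap.comp_apply, haa']
    obtain ⟨c, hc⟩ : F.mkQ (f y) ∈ LinearMap.range (lc (g y)) := by
      rw [hrange]; exact ⟨_, h2, rfl⟩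
    have hRc : R y (s (F.mkQ (f y))) = c := by
      rw [← hc]; exact LinearMap.congr_fun h1.1 c
    refine (Submodule.Quotient.mk_eq_zero F).1 ?_
    change F.mkQ _ = 0
    rw [map_sub, map_sum, hRc, ← hc, sub_eq_zero]
    simp [lc, Fintype.linearCombination_apply, g]

/-- Where the entries of two families of subspaces are nested is closed. -/
theorem isClosed_sub_le {k l : ℕ} {φ : X → grassmannian k V} {ψ : X → grassmannian l V}
    (hφ : ∀ x, MorphismAt X (grassmannian k V) φ x)
    (hψ : ∀ x, MorphismAt X (grassmannian l V) ψ x) : IsClosed {x | sub (φ x) ≤ sub (ψ x)} := by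
  rw [← isOpen_compl_iff, isOpen_iff_eventually]
  exact fun x hx => (hφ x).liftsAt.eventually_not_le (hψ x) hx

theorem isClosed_sub_le_const {k : ℕ} {φ : X → grassmannian k V}
    (hφ : ∀ x, MorphismAt X (grassmannian k V) φ x) (F : Submodule ℂ V) :
    IsClosed {x | sub (φ x) ≤ F} := by
  rw [← isOpen_compl_iff, isOpen_iff_eventually]
  exact fun x hx => (hφ x).liftsAt.eventually_not_le_const hx

theorem isClosed_le_finrank_inf {k : ℕ} {φ : X → grassmannian k V}
    (hφ : ∀ x, MorphismAt X (grassmannian k V) φ x) (F : Submodule ℂ V) (m : ℕ) :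
    IsClosed {x | m ≤ Module.finrank ℂ ↥(F ⊓ sub (φ x))} := by
  rw [← isOpen_compl_iff, isOpen_iff_eventually]
  intro x hx
  filter_upwards [(hφ x).finrank_inf_le F] with y hy hy'
  exact hx (hy'.trans hy)

end inf

/-! ### Morphisms from complete spaces -/

/-- The image of `C` in Y × Z is the projection from X × (Y × Z) of the points lying over `C` and on
the graph of φ, and the graph is closed because the diagonal of `Y` is. -/
theorem IsComplete.isProper {X Y : SpaceWithFunctions.{u}} (hX : X.IsComplete) {φ : X → Y}
    (hφ : IsMorphism φ) (hY : IsClosed (X := Y.prod Y) (Set.range fun y : Y => (y, y))) :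
    IsProper φ := by
  refine ⟨hφ, fun Z _ C hC => ?_⟩
  let D : Set (X.prod (Y.prod Z)) := {p | (p.1, p.2.2) ∈ C ∧ (φ p.1, p.2.1) ∈ Set.range fun y : Y => (y, y)}
  have h1 : Continuous (X := X.prod (Y.prod Z)) (Y := X.prod Z) fun p => (p.1, p.2.2) :=
    (isMorphism_iff.2 fun p => (morphismAt_fst p).prodMk
      ((morphismAt_snd _).comp (morphismAt_snd p))).1
  have h2 : Continuous (X := X.prod (Y.prod Z)) (Y := Y.prod Y) fun p => (φ p.1, p.2.1) :=
    (isMorphism_iff.2 fun p => ((isMorphism_iff.1 hφ _).comp (morphismAt_fst p)).prodMk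
      ((morphismAt_fst _).comp (morphismAt_snd p))).1
  have hD : IsClosed D := (hC.preimage h1).inter (hY.preimage h2)
  have h3 := hX (Y.prod Z) D hD
  convert h3 using 1
  ext p
  constructor
  · rintro ⟨⟨x, z⟩, hx, rfl⟩
    exact ⟨(x, (φ x, z)), ⟨hx, ⟨φ x, rfl⟩⟩, rfl⟩
  · rintro ⟨⟨x, y, z⟩, ⟨hx, y', hy'⟩, rfl⟩
    have h4 : y' = φ x := congrArg Prod.fst hy'
    have h5 : y' = y := congrArg Prod.snd hy'
    subst h5
    exact ⟨(x, z), hx, Prod.ext h4.symm rfl⟩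

end SpaceWithFunctions

/-! ### The projection over the rank locus, and openness of the cell -/

namespace SchubertIndex

open SpaceWithFunctions

variable {h n : ℕ} {K : FlagDims h} (I : SchubertIndex K n) {V : Type u} [AddCommGroup V]
  [Module ℂ V] [FiniteDimensional ℂ V] (F : CompleteFlag V n)

theorem isVariety_schubertVariety : (I.schubertVariety F).IsVariety := by
  refine isVariety_restrict_grassmannians (d := fun t : Fin h => K.k t.succ) (IsClosed.inter ?_ ?_)
  · change IsClosed {Λ : pi fun t : Fin h => grassmannian (K.k t.succ) V | ∀ t t', t ≤ t' → sub (Λ t) ≤ sub (Λ t')}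
    simp only [Set.ofPred_forall]
    exact isClosed_iInter fun t => isClosed_iInter fun t' => isClosed_iInter fun _ =>
      isClosed_sub_le (morphismAt_eval t) (morphismAt_eval t')
  · change IsClosed {Λ : pi fun t : Fin h => grassmannian (K.k t.succ) V | ∀ t i, I.μ t i ≤ Module.finrank ℂ ↥(F.F (I.a i) ⊓ sub (Λ t))}
    simp only [Set.ofPred_forall]
    exact isClosed_iInter fun t => isClosed_iInter fun i =>
      isClosed_le_finrank_inf (morphismAt_eval t) _ _

theorem isVariety_diagrams : (I.diagrams F).IsVariety := by
  let P := pi fun p : Fin h × Fin K.top => grassmannian (I.μ p.1 p.2) V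
  have hev : ∀ t i, ∀ W : P, MorphismAt P (grassmannian (I.μ t i) V) (fun W => W (t, i)) W :=
    fun t i => morphismAt_eval (A := fun p : Fin h × Fin K.top => grassmannian (I.μ p.1 p.2) V) (t, i)
  refine isVariety_restrict_grassmannians (d := fun p : Fin h × Fin K.top => I.μ p.1 p.2)
    (IsClosed.inter ?_ (IsClosed.inter ?_ ?_))
  · change IsClosed {W : P | ∀ t i i', i ≤ i' → sub (W (t, i)) ≤ sub (W (t, i'))}
    simp only [Set.ofPred_forall]
    exact isClosed_iInter fun t => isClosed_iInter fun i => isClosed_iInter fun i' =>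
      isClosed_iInter fun _ => isClosed_sub_le (hev t i) (hev t i')
  · change IsClosed {W : P | ∀ t t' i, t ≤ t' → sub (W (t, i)) ≤ sub (W (t', i))}
    simp only [Set.ofPred_forall]
    exact isClosed_iInter fun t => isClosed_iInter fun t' => isClosed_iInter fun i =>
      isClosed_iInter fun _ => isClosed_sub_le (hev t i) (hev t' i)
  · change IsClosed {W : P | ∀ t i, sub (W (t, i)) ≤ F.F (I.a i)}
    simp only [Set.ofPred_forall]
    exact isClosed_iInter fun t => isClosed_iInter fun i => isClosed_sub_le_const (hev t i) _

theorem liftsAt_entry (t : Fin h) (i : Fin K.top) (W : I.diagrams F) :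
    (I.diagrams F).LiftsAt (fun W => I.entry F W t i) W :=
  ((morphismAt_eval (A := fun p : Fin h × Fin K.top => grassmannian (I.μ p.1 p.2) V) (t, i)
    W.1).comp (φ := fun W : I.diagrams F => W.1) (morphismAt_val W)).liftsAt

theorem morphismAt_step (t : Fin h) (Λ : I.schubertVariety F) :
    MorphismAt (I.schubertVariety F) (grassmannian (K.k t.succ) V)
      (fun Λ => (Λ.1 : ∀ t : Fin h, grassmannian (K.k t.succ) V) t) Λ :=
  (morphismAt_eval (A := fun t : Fin h => grassmannian (K.k t.succ) V) t
    Λ.1).comp (φ := fun Λ : I.schubertVariety F => Λ.1) (morphismAt_val Λ)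

theorem isMorphism_projection : IsMorphism (I.projection F) := by
  refine isMorphism_iff.2 fun W => morphismAt_restrict (morphismAt_pi
    (A := fun t : Fin h => grassmannian (K.k t.succ) V) fun t => LiftsAt.morphismAt ?_)
  exact I.liftsAt_entry F t (last K t) W

theorem finrank_entry (W : I.diagrams F) (t : Fin h) (i : Fin K.top) :
    Module.finrank ℂ (I.entry F W t i) = I.μ t i := finrank_sub _

theorem finrank_step (Λ : I.schubertVariety F) (t : Fin h) :
    Module.finrank ℂ (I.step F Λ t) = K.k t.succ := finrank_sub _

theorem step_mono (Λ : I.schubertVariety F) {t t' : Fin h} (htt' : t ≤ t') :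
    I.step F Λ t ≤ I.step F Λ t' := Λ.2.1 t t' htt'

theorem le_last (t : Fin h) (i : Fin K.top) : i ≤ last K t := by
  have := i.2
  simp only [last, Fin.le_def]
  omega

theorem schubertVariety_ext {Λ Λ' : I.schubertVariety F} (hΛ : ∀ t, I.step F Λ t = I.step F Λ' t) :
    Λ = Λ' := Subtype.ext (funext fun t => grassmannian_ext (hΛ t))

theorem diagrams_ext {W W' : I.diagrams F} (hW : ∀ t i, I.entry F W t i = I.entry F W' t i) :
    W = W' := Subtype.ext (funext fun p => grassmannian_ext (hW p.1 p.2))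

/-- The inverse sends Λ to the diagram of intersections F_{a_i} ∩ Λ_t, which have the right constant
dimensions on the rank locus. An entry of a diagram over Λ is contained in this intersection and is
equal to it by dimension. -/
theorem isIsomorphismOver_projection {C : Set (I.schubertVariety F)} (hC : C ⊆ I.rankLocus F) :
    IsIsomorphismOver (I.projection F) C := by
  let Y := (I.schubertVariety F).restrict (I.rankLocus F)
  let ψ : Y → I.diagrams F := fun Λ =>
    ⟨fun p => ofFinrank (F.F (I.a p.2) ⊓ I.step F Λ.1 p.1) (Λ.2 p.1 p.2),
      fun t i i' hi => inf_le_inf_right _ (F.mono (I.a_strictMono.monotone hi)),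
      fun t t' i ht => inf_le_inf_left _ (I.step_mono F Λ.1 ht), fun t i => inf_le_left⟩
  have hψ : IsMorphism ψ := by
    refine isMorphism_iff.2 fun Λ => morphismAt_restrict (morphismAt_pi
      (A := fun p : Fin h × Fin K.top => grassmannian (I.μ p.1 p.2) V) fun p => LiftsAt.morphismAt ?_)
    exact LiftsAt.inf_const (S := fun Λ : Y => I.step F Λ.1 p.1)
      ((I.morphismAt_step F p.1 Λ.1).comp (φ := fun Λ : Y => Λ.1) (morphismAt_val Λ)).liftsAt _
      (fun Λ => I.finrank_step F Λ.1 p.1) fun Λ => Λ.2 p.1 p.2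
  refine (I.isMorphism_projection F).isIsomorphismOver hC hψ (fun Λ => ?_) fun W hW => ?_
  · refine I.schubertVariety_ext F fun t => ?_
    refine Submodule.eq_of_le_of_finrank_eq inf_le_right ?_
    rw [finrank_step, finrank_step]
  · refine I.diagrams_ext F fun t i => ?_
    refine (Submodule.eq_of_le_of_finrank_eq (le_inf (W.2.2.2 t i) (W.2.1 t i _ (le_last t i))) ?_).symm
    exact (I.finrank_entry F W t i).trans (hW t i).symm

theorem cell_subset_rankLocus : I.cell F ⊆ I.rankLocus F := by
  intro Λ hΛ t i
  rw [hΛ t (I.a i)]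
  simp only [I.a_strictMono.le_iff_le]
  rfl

/-- On the Schubert variety, the dimensions prescribed on the cell are lower bounds. -/
theorem card_le_finrank_inf_step (Λ : I.schubertVariety F) (t : Fin h) (j : Fin (n + 1)) :
    (Finset.univ.filter fun i => I.a i ≤ j ∧ I.α i ≤ t).card ≤
      Module.finrank ℂ ↥(F.F j ⊓ I.step F Λ t) := by
  classical
  by_cases hne : (Finset.univ.filter fun i => I.a i ≤ j).Nonempty
  -- For the largest i with a_i ≤ j, every index counted is at most i, so the rank condition at i
  -- gives the bound.
  · obtain ⟨i, hi, hmax⟩ := Finset.exists_max_image _ id hne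
    simp only [Finset.mem_filter, Finset.mem_univ, true_and, id] at hi hmax
    have h1 : (Finset.univ.filter fun i => I.a i ≤ j ∧ I.α i ≤ t).card ≤ I.μ t i := by
      refine Finset.card_le_card fun i' hi' => ?_
      simp only [Finset.mem_filter, Finset.mem_univ, true_and] at hi' ⊢
      exact ⟨hmax i' hi'.1, hi'.2⟩
    exact h1.trans ((Λ.2.2 t i).trans (Submodule.finrank_mono (inf_le_inf_right _ (F.mono hi))))
  · rw [Finset.not_nonempty_iff_eq_empty] at hne
    have : (Finset.univ.filter fun i => I.a i ≤ j ∧ I.α i ≤ t) = ∅ := by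
      rw [Finset.eq_empty_iff_forall_notMem] at hne ⊢
      simp only [Finset.mem_filter, Finset.mem_univ, true_and] at hne ⊢
      exact fun i hi => hne i hi.1
    simp [this]

/-- The values prescribed on the cell are minimal on the Schubert variety, and the dimensions of
intersections can only drop nearby. -/
theorem isOpen_cell : IsOpen (I.cell F) := by
  rw [isOpen_iff_eventually]
  intro Λ hΛ
  have h1 : ∀ᶠ Λ' in 𝓝 Λ, ∀ (t : Fin h) (j : Fin (n + 1)),
      Module.finrank ℂ ↥(F.F j ⊓ I.step F Λ' t) ≤ Module.finrank ℂ ↥(F.F j ⊓ I.step F Λ t) := by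
    rw [eventually_all]
    intro t
    rw [eventually_all]
    exact fun j => (I.morphismAt_step F t Λ).finrank_inf_le (F.F j)
  filter_upwards [h1] with Λ' h2 t j
  exact le_antisymm ((h2 t j).trans (hΛ t j).le) (I.card_le_finrank_inf_step F Λ' t j)

end SchubertIndex

/-! ### Recursive choice and hyperplanes adapted to a filtration -/

namespace SpaceWithFunctions

/-- Used twice for surjectivity: along the rows within a column, and along the columns. -/
theorem exists_seq {A : Type*} {r : A → A → Prop} {p : ℕ → A → Prop} {a : A} (h0 : p 0 a)
    (hs : ∀ n a, p n a → ∃ b, p (n + 1) b ∧ r a b) :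
    ∃ f : ℕ → A, f 0 = a ∧ (∀ n, p n (f n)) ∧ ∀ n, r (f n) (f (n + 1)) := by
  choose! g hg hr using hs
  let f : ℕ → A := fun n => n.rec a g
  have hf : ∀ n, p n (f n) := fun n => by
    induction n with
    | zero => exact h0
    | succ n ih => exact hg n _ ih
  exact ⟨f, rfl, hf, fun n => hr n _ (hf n)⟩

variable {V : Type u} [AddCommGroup V] [Module ℂ V] [FiniteDimensional ℂ V]

/-- A hyperplane of `W` through `P` which contains every member of a filtration that can be
contained in one. -/
theorem exists_hyperplane {n : ℕ} {F : Fin n → Submodule ℂ V} (hF : Monotone F)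
    {P W : Submodule ℂ V} (hPW : P < W) :
    ∃ f : V →ₗ[ℂ] ℂ, P ≤ LinearMap.ker f ∧
      Module.finrank ℂ ↥(LinearMap.ker f ⊓ W) + 1 = Module.finrank ℂ W ∧
      ∀ j, F j ⊓ W ⊔ P = W ∨ F j ⊓ W ≤ LinearMap.ker f := by
  classical
  obtain ⟨Q, hPQ, hQW, hQF⟩ : ∃ Q, P ≤ Q ∧ Q < W ∧ ∀ j, F j ⊓ W ⊔ P = W ∨ F j ⊓ W ≤ Q := by
    by_cases hne : (Finset.univ.filter fun j => F j ⊓ W ⊔ P ≠ W).Nonempty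
    -- The largest member with F_j ∩ W + P ≠ W contains all others of this kind, so any hyperplane
    -- of W through F_j ∩ W + P will do.
    · obtain ⟨j, hj, hmax⟩ := Finset.exists_max_image _ id hne
      simp only [Finset.mem_filter, Finset.mem_univ, true_and, id] at hj hmax
      refine ⟨F j ⊓ W ⊔ P, le_sup_right, lt_of_le_of_ne (sup_le inf_le_right hPW.le) hj,
        fun i => or_iff_not_imp_left.2 fun hi => ?_⟩
      exact (inf_le_inf_right _ (hF (hmax i hi))).trans le_sup_left
    · refine ⟨P, le_rfl, hPW, fun j => .inl ?_⟩
      by_contra hj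
      exact hne ⟨j, by simpa using hj⟩
  obtain ⟨w, hw, hwQ⟩ := SetLike.exists_of_lt hQW
  obtain ⟨f, hfw, hfQ⟩ := Submodule.exists_le_ker_of_notMem hwQ
  refine ⟨f, hPQ.trans hfQ, ?_, fun j => (hQF j).imp_right fun h => h.trans hfQ⟩
  have h1 := finrank_ker_inf_add_finrank_map f W
  have h2 : W.map f = ⊤ := by
    refine eq_top_iff.2 fun c _ => ⟨(c / f w) • w, W.smul_mem _ hw, ?_⟩
    simp [div_mul_cancel₀ _ hfw]
  rwa [h2, finrank_top, Module.finrank_self] at h1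

end SpaceWithFunctions

/-! ### Bases adapted to a complete flag -/

namespace CompleteFlag

variable {V : Type u} [AddCommGroup V] [Module ℂ V] [FiniteDimensional ℂ V] {n : ℕ}

/-- A basis adapted to a complete flag. -/
theorem exists_basis (F : CompleteFlag V n) : ∃ v : Fin n → V, LinearIndependent ℂ v ∧
    ∀ j, F.F j = Submodule.span ℂ (v '' {i | i.castSucc < j}) := by
  have hlt : ∀ i : Fin n, F.F i.castSucc < F.F i.succ := fun i =>
    lt_of_le_of_ne (F.mono (Fin.castSucc_lt_succ).le) fun h => by
      have := congrArg (fun W : Submodule ℂ V => Module.finrank ℂ W) h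
      simp [F.finrank_eq] at this
  choose v hv hv' using fun i => SetLike.exists_of_lt (hlt i)
  have hspan : ∀ j, F.F j = Submodule.span ℂ (v '' {i | i.castSucc < j}) := fun j => by
    induction j using Fin.induction with
    | zero =>
      have h0 : F.F 0 = ⊥ := Submodule.finrank_eq_zero.1 (F.finrank_eq 0)
      simp [h0]
    | succ j ih =>
      have h1 : v '' {i | i.castSucc < j.succ} = insert (v j) (v '' {i | i.castSucc < j.castSucc}) := by
        rw [← Set.image_insert_eq]
        congr 1
        ext i
        simp only [Set.mem_ofPred_eq, Set.mem_insert_iff, Fin.lt_def, Fin.ext_iff, Fin.val_castSucc,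
          Fin.val_succ]
        omega
      rw [h1, Submodule.span_insert, ← ih]
      refine (Submodule.eq_of_le_of_finrank_le (sup_le ?_ (hlt j).le) ?_).symm
      · rw [Submodule.span_singleton_le_iff_mem]
        exact hv j
      · rw [F.finrank_eq]
        have h2 : F.F j.castSucc < Submodule.span ℂ {v j} ⊔ F.F j.castSucc :=
          lt_of_le_of_ne le_sup_right fun h => hv' j (h ▸ Submodule.mem_sup_left
            (Submodule.mem_span_singleton_self _))
        have h3 := Submodule.finrank_lt_finrank_of_lt h2
        rw [F.finrank_eq] at h3
        simpa [Nat.succ_le_iff] using h3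
  refine ⟨v, linearIndependent_of_top_le_span_of_card_eq_finrank ?_ ?_, hspan⟩
  · rw [← F.eq_top, hspan]
    exact Submodule.span_mono (Set.image_subset_range _ _)
  · rw [← finrank_top, ← F.eq_top, F.finrank_eq]
    simp

end CompleteFlag

/-! ### Non-emptiness of the cell and surjectivity of the projection -/

namespace SchubertIndex

open SpaceWithFunctions

variable {h n : ℕ} {K : FlagDims h} (I : SchubertIndex K n) {V : Type u} [AddCommGroup V]
  [Module ℂ V] [FiniteDimensional ℂ V] (F : CompleteFlag V n)

theorem card_α_le (t : Fin h) : (Finset.univ.filter fun i => I.α i ≤ t).card = K.k t.succ :=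
  (congrArg Finset.card (Finset.filter_congr fun i _ => by rw [Fin.le_def, Nat.lt_succ_iff])).trans
    (I.card_α_lt (t + 1) (by omega))

/-- In a basis adapted to the flag, take Λ_t spanned by the basis vectors of positions a_i with α_i
≤ t. Intersections of coordinate subspaces are spanned by the common basis vectors, which are
counted by the prescribed number. -/
theorem nonempty_cell : (I.cell F).Nonempty := by
  classical
  obtain ⟨v, hv, hF⟩ := F.exists_basis
  -- The a_i count dimensions from 1, while the basis is indexed from 0.
  let b : Fin K.top → Fin n := fun i => (I.a i).pred (I.a_pos i).ne'
  have hb : ∀ i j, (b i).castSucc < j ↔ I.a i ≤ j := fun i j => by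
    have := I.a_pos i
    simp only [b, Fin.lt_def, Fin.le_def, Fin.val_castSucc, Fin.val_pred, Fin.val_zero] at this ⊢
    omega
  have hbi : Function.Injective b := fun i i' hii' => I.a_strictMono.injective (by
    simpa [b, Fin.pred_inj] using hii')
  let Λ : Fin h → Submodule ℂ V := fun t => Submodule.span ℂ (v '' (b '' {i | I.α i ≤ t}))
  have key : ∀ t j, Module.finrank ℂ ↥(F.F j ⊓ Λ t) =
      (Finset.univ.filter fun i => I.a i ≤ j ∧ I.α i ≤ t).card := fun t j => by
    have h1 : F.F j ⊓ Λ t = Submodule.span ℂ (v '' ({i | i.castSucc < j} ∩ b '' {i | I.α i ≤ t})) := by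
      rw [hF, show Λ t = Submodule.span ℂ (v '' (b '' {i | I.α i ≤ t})) from rfl, Finsupp.span_image_eq_map_linearCombination,
        Finsupp.span_image_eq_map_linearCombination, Finsupp.span_image_eq_map_linearCombination,
        Finsupp.supported_inter, Submodule.map_inf _ hv]
    have h2 : ({i | i.castSucc < j} ∩ b '' {i | I.α i ≤ t}) =
        ↑((Finset.univ.filter fun i => I.a i ≤ j ∧ I.α i ≤ t).image b) := by
      ext i
      simp only [Set.mem_inter_iff, Set.mem_ofPred_eq, Set.mem_image, Finset.coe_image,
        Finset.coe_filter, Finset.mem_univ, true_and]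
      constructor
      · rintro ⟨h3, i, hi, rfl⟩
        exact ⟨i, ⟨(hb i j).1 h3, hi⟩, rfl⟩
      · rintro ⟨i, hi, rfl⟩
        exact ⟨(hb i j).2 hi.1, i, hi.2, rfl⟩
    rw [h1, h2, ← Finset.coe_image, finrank_span_finset_eq_card, Finset.card_image_of_injective _ hv.injective, Finset.card_image_of_injective _ hbi]
    rw [Finset.coe_image]
    exact hv.linearIndepOn_id.mono (Set.image_subset_range _ _)
  have hdim : ∀ t, Module.finrank ℂ (Λ t) = K.k t.succ := fun t => by
    have := key t (Fin.last n)
    rw [F.eq_top, top_inf_eq] at this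
    rw [this, ← I.card_α_le t]
    simp [Fin.le_last]
  refine ⟨⟨fun t => ofFinrank (Λ t) (hdim t), fun t t' htt' => ?_, fun t i => ?_⟩, key⟩
  · exact Submodule.span_mono (Set.image_mono (Set.image_mono fun i hi => hi.trans htt'))
  · refine ((key t (I.a i)).trans ?_).ge
    simp only [I.a_strictMono.le_iff_le]
    rfl

/-- The entries of the rank matrix, with a column and a row of zeros added. -/
def rank (s r : ℕ) : ℕ :=
  (Finset.univ.filter fun i : Fin K.top => (i : ℕ) < r ∧ (I.α i : ℕ) < s).card

theorem μ_eq_rank (t : Fin h) (i : Fin K.top) : I.μ t i = I.rank (t + 1) (i + 1) := by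
  unfold μ rank
  simp only [Fin.le_def, Nat.lt_succ_iff]

theorem rank_mono {s s' r r' : ℕ} (hs : s ≤ s') (hr : r ≤ r') : I.rank s r ≤ I.rank s' r' := by
  refine Finset.card_le_card fun i hi => ?_
  simp only [Finset.mem_filter, Finset.mem_univ, true_and] at hi ⊢
  omega

theorem rank_succ_column {s r : ℕ} (hr : r < K.top) :
    I.rank s (r + 1) = I.rank s r + if (I.α ⟨r, hr⟩ : ℕ) < s then 1 else 0 := by
  classical
  unfold rank
  have h1 : (Finset.univ.filter fun i : Fin K.top => (i : ℕ) < r + 1 ∧ (I.α i : ℕ) < s) =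
      (Finset.univ.filter fun i : Fin K.top => (i : ℕ) < r ∧ (I.α i : ℕ) < s) ∪
        if (I.α ⟨r, hr⟩ : ℕ) < s then {⟨r, hr⟩} else ∅ := by
    ext i
    simp only [Finset.mem_union, Finset.mem_filter, Finset.mem_univ, true_and]
    by_cases hi : i = ⟨r, hr⟩
    · subst hi
      split_ifs with h2 <;> simp [h2]
    · have : (i : ℕ) ≠ r := fun h => hi (Fin.ext h)
      split_ifs with h2 <;> simp [hi] <;> omega
  rw [h1, Finset.card_union_of_disjoint]
  · split_ifs <;> simp
  · rw [Finset.disjoint_left]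
    intro i hi
    simp only [Finset.mem_filter, Finset.mem_univ, true_and] at hi
    split_ifs
    · simp only [Finset.mem_singleton]
      rintro rfl
      exact absurd hi.1 (lt_irrefl _)
    · simp

/-- The difference of the rows s + 1 and s in column r counts the indices before r of colour exactly
s, and this number grows with r. -/
theorem rank_add_rank_le {s r r' : ℕ} (hr : r ≤ r') :
    I.rank (s + 1) r + I.rank s r' ≤ I.rank (s + 1) r' + I.rank s r := by
  classical
  unfold rank
  rw [← Finset.card_union_add_card_inter, ← Finset.card_union_add_card_inter]
  refine add_le_add (Finset.card_le_card fun i hi => ?_) (Finset.card_le_card fun i hi => ?_)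
  all_goals
    simp only [Finset.mem_filter, Finset.mem_univ, true_and, Finset.mem_union,
      Finset.mem_inter] at hi ⊢
    omega

/-- A nested sequence of subspaces with the dimensions of the column `r`, satisfying the rank
conditions of the previous columns. -/
structure IsColumn (r : ℕ) (W : ℕ → Submodule ℂ V) : Prop where
  mono : Monotone W
  finrank_eq : ∀ s, Module.finrank ℂ (W s) = I.rank s r
  rank_le : ∀ s (i : Fin K.top), (i : ℕ) < r →
    I.rank s (i + 1) ≤ Module.finrank ℂ ↥(F.F (I.a i) ⊓ W s)

variable {I F}

/-- The entries are chosen by increasing row. Given the entry P of row s, the entry of row s + 1 is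
`W (s + 1)` itself or a hyperplane of it through P, according to the colour of the column removed;
the hyperplane is the one adapted to the flag. -/
theorem IsColumn.exists_prev {r : ℕ} (hr : r < K.top) {W : ℕ → Submodule ℂ V}
    (hW : I.IsColumn F (r + 1) W) : ∃ W', I.IsColumn F r W' ∧ W' ≤ W := by
  have hstep : ∀ (s : ℕ) (P : Submodule ℂ V), (Module.finrank ℂ P = I.rank s r ∧ P ≤ W s ∧ ∀ i : Fin K.top, (i : ℕ) < r →
      I.rank s (i + 1) ≤ Module.finrank ℂ ↥(F.F (I.a i) ⊓ P)) →
      ∃ Q : Submodule ℂ V, (Module.finrank ℂ Q = I.rank (s + 1) r ∧ Q ≤ W (s + 1) ∧ ∀ i : Fin K.top, (i : ℕ) < r →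
        I.rank (s + 1) (i + 1) ≤ Module.finrank ℂ ↥(F.F (I.a i) ⊓ Q)) ∧ P ≤ Q := ?_
  · obtain ⟨W', -, h1, h2⟩ := exists_seq (a := ⊥) ⟨by simp [rank], bot_le, by simp [rank]⟩ hstep
    exact ⟨W', ⟨monotone_nat_of_le_succ h2, fun s => (h1 s).1, fun s => (h1 s).2.2⟩,
      fun s => (h1 s).2.1⟩
  rintro s P ⟨hP, hPW, hPF⟩
  have hPW' : P ≤ W (s + 1) := hPW.trans (hW.mono s.le_succ)
  have hdim := hW.finrank_eq (s + 1)
  rw [I.rank_succ_column hr] at hdim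
  split_ifs at hdim with hc
  · have hlt : P < W (s + 1) := lt_of_le_of_ne hPW' fun h => by
      have := I.rank_mono (show s ≤ s + 1 by omega) (le_refl r)
      rw [← h] at hdim
      omega
    obtain ⟨f, hf1, hf2, hf3⟩ := exists_hyperplane F.mono hlt
    refine ⟨LinearMap.ker f ⊓ W (s + 1), ⟨by omega, inf_le_right, fun i hi => ?_⟩,
      le_inf hf1 hPW'⟩
    obtain h3 | h3 := hf3 (I.a i)
    -- Here F_{a_i} ∩ W + P = W, so dim (F_{a_i} ∩ W) = dim W - dim P + dim (F_{a_i} ∩ P), and the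
    -- hyperplane costs at most 1. The rank condition for P and `rank_add_rank_le` give the required
    -- bound.
    · have h4 := Submodule.finrank_sup_add_finrank_inf_eq (F.F (I.a i) ⊓ W (s + 1)) P
      rw [h3, inf_assoc, inf_eq_right.2 hPW'] at h4
      have h5 := finrank_ker_inf_add_finrank_map f (F.F (I.a i) ⊓ W (s + 1))
      rw [inf_left_comm] at h5
      have h6 := Submodule.finrank_le ((F.F (I.a i) ⊓ W (s + 1)).map f)
      rw [Module.finrank_self] at h6
      have h7 := hPF i hi
      have h8 := I.rank_add_rank_le (s := s) (Nat.succ_le_of_lt hi)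
      simp only [Nat.succ_eq_add_one] at h8
      omega
    · refine (hW.rank_le (s + 1) i (by omega)).trans (Submodule.finrank_mono ?_)
      exact le_inf inf_le_left (le_inf h3 inf_le_right)
  · exact ⟨W (s + 1), ⟨by omega, le_rfl, fun i hi => hW.rank_le _ i (by omega)⟩, hPW'⟩

variable (I F)

/-- The supremum extends the flag to all row numbers: it is zero for s = 0, the step with index s -
1 for 0 < s ≤ h, and stationary afterwards. -/
theorem isColumn_schubertVariety (Λ : I.schubertVariety F) :
    I.IsColumn F K.top fun s => ⨆ (t : Fin h) (_ : (t : ℕ) < s), I.step F Λ t := by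
  let S : ℕ → Submodule ℂ V := fun s => ⨆ (t : Fin h) (_ : (t : ℕ) < s), I.step F Λ t
  have key : ∀ s, (S s = ⊥ ∧ ∀ r, I.rank s r = 0) ∨ ∃ t, S s = I.step F Λ t ∧ ∀ r, I.rank s r = I.rank (t + 1) r := fun s => by
    by_cases hne : (Finset.univ.filter fun t : Fin h => (t : ℕ) < s).Nonempty
    · obtain ⟨t, ht, hmax⟩ := Finset.exists_max_image _ id hne
      simp only [Finset.mem_filter, Finset.mem_univ, true_and, id] at ht hmax
      refine .inr ⟨t, le_antisymm (iSup₂_le fun t' ht' => I.step_mono F Λ (hmax t' ht'))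
        (le_iSup₂_of_le t ht le_rfl), fun r => ?_⟩
      unfold rank
      congr 1
      refine Finset.filter_congr fun i _ => and_congr_right fun _ => ⟨fun hi => ?_, fun hi => ?_⟩
      · exact Nat.lt_succ_of_le (hmax _ hi)
      · omega
    · have hno : ∀ t : Fin h, ¬ (t : ℕ) < s := fun t ht => hne ⟨t, by simpa using ht⟩
      exact .inl ⟨by simp [S, hno], fun r => by simp [rank, hno]⟩
  change I.IsColumn F K.top S
  refine ⟨fun s s' hs => iSup₂_mono' fun t ht => ⟨t, ht.trans_le hs, le_rfl⟩, fun s => ?_,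
    fun s i _ => ?_⟩
  · obtain ⟨h1, h2⟩ | ⟨t, h1, h2⟩ := key s
    · rw [h1, h2, finrank_bot]
    · rw [h1, h2, I.finrank_step, ← I.card_α_le]
      unfold rank
      congr 1
      exact Finset.filter_congr fun i _ => ⟨fun hi => ⟨i.2, Nat.lt_succ_of_le hi⟩,
        fun hi => Nat.le_of_lt_succ hi.2⟩
  · obtain ⟨h1, h2⟩ | ⟨t, h1, h2⟩ := key s
    · simp [h2]
    · rw [h1, h2, ← μ_eq_rank]
      exact Λ.2.2 t i

/-- Start with the flag as last column and descend column by column; the d-th term of the sequence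
is the column `K.top - d`. The shifts by one below come from the zero row and zero column added to
the rank matrix. -/
theorem projection_surjective : Function.Surjective (I.projection F) := by
  intro Λ
  obtain ⟨W, hW0, hW, hWW⟩ := exists_seq (A := ℕ → Submodule ℂ V) (r := fun W W' => W' ≤ W)
    (p := fun d W => I.IsColumn F (K.top - d) W) (I.isColumn_schubertVariety F Λ) (by
      intro d W hW
      by_cases hd : d < K.top
      · refine IsColumn.exists_prev (by omega) ?_
        rwa [show K.top - (d + 1) + 1 = K.top - d by omega]
      -- Once column 0 is reached, truncated subtraction keeps the column number at 0 and the
      -- sequence may stay constant.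
      · rw [show K.top - d = K.top - (d + 1) by omega] at hW
        exact ⟨W, hW, le_rfl⟩)
  have hanti : Antitone W := antitone_nat_of_succ_le hWW
  have hdim : ∀ (t : Fin h) (i : Fin K.top),
      Module.finrank ℂ (W (K.top - (i + 1)) (t + 1)) = I.μ t i := fun t i => by
    rw [(hW _).finrank_eq, μ_eq_rank]
    congr 1
    omega
  refine ⟨⟨fun p => ofFinrank (W (K.top - (p.2 + 1)) (p.1 + 1)) (hdim p.1 p.2), ?_, ?_, ?_⟩, ?_⟩
  · intro t i i' hi
    have : (i : ℕ) ≤ i' := hi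
    exact hanti (show K.top - ((i' : ℕ) + 1) ≤ K.top - (i + 1) by omega) _
  · intro t t' i ht
    have : (t : ℕ) ≤ t' := ht
    exact (hW _).mono (show (t : ℕ) + 1 ≤ t' + 1 by omega)
  · intro t i
    -- In its own column the rank condition says that the intersection with F_{a_i} has at least the
    -- dimension of the entry, so the entry lies in F_{a_i}.
    have h1 := (hW (K.top - (i + 1))).rank_le (t + 1) i (by omega)
    rw [← μ_eq_rank, ← hdim] at h1
    exact inf_eq_right.1 (Submodule.eq_of_le_of_finrank_le inf_le_right h1)
  · refine I.schubertVariety_ext F fun t => ?_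
    have h1 : K.top - ((last K t : ℕ) + 1) = 0 := by simp only [last]; omega
    have h2 : W (K.top - ((last K t : ℕ) + 1)) (t + 1) = I.step F Λ t := by
      rw [h1, hW0]
      exact le_antisymm (iSup₂_le fun t' ht' => I.step_mono F Λ (Nat.lt_succ_iff.1 ht'))
        (le_iSup₂_of_le t (Nat.lt_succ_self _) le_rfl)
    exact h2

end SchubertIndex

theorem mainTheorem8 {V : Type u} [AddCommGroup V] [Module ℂ V] [FiniteDimensional ℂ V]
    {h n : ℕ} (K : FlagDims h) (I : SchubertIndex K n) (F : CompleteFlag V n) :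
    SpaceWithFunctions.IsGrassmannianTower (I.diagrams F) ∧
    SpaceWithFunctions.IsResolution (I.projection F) ∧
    (IsOpen (I.cell F) ∧ Dense (I.cell F)) ∧
    SpaceWithFunctions.IsIsomorphismOver (I.projection F) (I.cell F) ∧
    SpaceWithFunctions.IsIsomorphismOver (I.projection F) (I.rankLocus F) := by
  obtain ⟨Λ₀, hΛ₀⟩ := I.nonempty_cell F
  -- A diagram over a point of the cell: it is the base point for the tower and shows that the
  -- preimage of the cell is non-empty, hence dense in the irreducible Γ. The image of this preimage
  -- under the surjection π is then dense.
  obtain ⟨W₀, hW₀⟩ := I.projection_surjective F Λ₀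
  have htower := I.isProjectiveTower_diagrams F ⟨W₀⟩
  have hirr := htower.irreducibleSpace
  have hπ := I.isMorphism_projection F
  have hopen := I.isOpen_cell F
  have hdense : Dense (I.projection F ⁻¹' I.cell F) :=
    (hopen.preimage hπ.1).dense ⟨W₀, by rw [Set.mem_preimage, hW₀]; exact hΛ₀⟩
  have hdense' : Dense (I.cell F) := by
    have := (I.projection_surjective F).denseRange.dense_image hπ.1 hdense
    exact this.mono (Set.image_preimage_subset _ _)
  have hiso := I.isIsomorphismOver_projection F (I.cell_subset_rankLocus F)
  exact ⟨htower.isGrassmannianTower,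
    { variety_source := I.isVariety_diagrams F
      variety_target := I.isVariety_schubertVariety F
      irreducible := hirr
      nonsingular := htower.isLocallyAffineSpace.isNonsingular
      proper := htower.isComplete.isProper hπ (I.isVariety_schubertVariety F).2
      birational := ⟨hπ, _, _, Set.mapsTo_preimage _ _, hopen.preimage hπ.1, hdense, hopen,
        hdense', hiso⟩ },
    ⟨hopen, hdense'⟩, hiso, I.isIsomorphismOver_projection F subset_rfl⟩
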